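/- A choice dictionary with universe size $n\in\mathbb{N}=\{1,2,\ldots\}$ is a data structure that, after being initialized with $n$, maintains an initially empty subset $S$ of $U=\{1,\ldots,n\}$ under the operations $\mathrm{insert}(\ell)$ ($S:=S\cup\{\ell\}$), $\mathrm{delete}(\ell)$ ($S:=S\setminus\{\ell\}$), $\mathrm{contains}(\ell)$ (returns $1$ if $\ell\in S$ and $0$ otherwise), each for $\ell\in U$, and $\mathrm{choice}$ (returns an arbitrary element of $S$ if $S\neq\emptyset$, and $0$ otherwise). It is externally sized if every operation is given access to $n$, which is stored outside of the data structure, and atomic if all operations, including the initialization, execute in constant time. The model of computation is a word RAM with word length $w$, where $2^w>n$. In constant time it can load and store a memory word at a computed address, load a constant, jump conditionally on the comparison of two words, add, subtract and multiply modulo $2^w$, divide with truncation (by a nonzero divisor), shift left (modulo $2^w$) and right, compute bitwise AND, OR and XOR, and load a built-in integer $\sigma$ that deviates from $\sqrt w$ by at most a constant factor, i.e., $\sqrt w\le C\sigma$ and $\sigma\le C\sqrt w$ for a constant $C$. The memory is initially arbitrary (not assumed to be cleared). **Theorem.** There is an externally sized atomic choice dictionary on the word RAM that, when initialized for universe size $n$,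 occupies $n+1$ bits between operations and needs $O(w)$ additional bits of transient space during the execution of each operation. That is, for every $C$ there are a constant number of one-word registers, a constant time bound $T$ and fixed programs for the initialization and the four operations, all depending only on $C$, such that for all $w$, all $\sigma$ as above and all $n$ with $1\le n<2^w$ the programs realize a choice dictionary with universe size $n$ in any $n+1$ consecutive bits of memory that begin at a word boundary: each operation executes at most $T$ instructions and accesses only the registers and the memory words that contain bits of the data structure, nothing but these $n+1$ bits is remembered from one operation to the next, and no other memory bit is changed by an operation. -/

import Mathlib

/-!
A word RAM with word length `w`: words are elements of `BitVec w`, the memory is a sequence of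
words addressed by words, and a program also works with a fixed finite number of registers of one
word each.
-/

namespace WordRAM

/-- The binary arithmetic and bitwise operations of the machine. -/
inductive BinOp
  | add | sub | mul | div | shl | shr | and | or | xor

/-- The value of an operation. Addition, subtraction, multiplication and left shift are modulo
`2 ^ w`; division is truncating and has no result for divisor `0`. -/
def BinOp.eval {w : ℕ} (o : BinOp) (x y : BitVec w) : Option (BitVec w) :=
  match o with
  | .add => some (x + y)
  | .sub => some (x - y)
  | .mul => some (x * y)
  | .div => if y = 0 then none else some (BitVec.ofNat w (x.toNat / y.toNat))
  | .shl => some (x <<< y.toNat)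
  | .shr => some (x >>> y.toNat)
  | .and => some (x &&& y)
  | .or => some (x ||| y)
  | .xor => some (x ^^^ y)

/-- The instructions of a program with `R` registers. Nothing in an instruction depends on the
word length. -/
inductive Instr (R : ℕ)
  /-- Load the constant `k` (modulo `2 ^ w`) into register `r`. -/
  | const (r : Fin R) (k : ℕ)
  /-- Load the built-in approximation of `√w` into register `r`. -/
  | loadSqrt (r : Fin R)
  /-- Apply `o` to registers `a` and `b`, result to register `r`. -/
  | op (o : BinOp) (r a b : Fin R)
  /-- Load into register `r` the memory word whose address is in register `a`. -/
  | load (r a : Fin R)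
  /-- Store register `b` into the memory word whose address is in register `a`. -/
  | store (a b : Fin R)
  /-- Jump to instruction `t` if registers `a` and `b` are equal. -/
  | jumpEq (a b : Fin R) (t : ℕ)
  /-- Jump to instruction `t` if register `a` is smaller than register `b`. -/
  | jumpLt (a b : Fin R) (t : ℕ)

/-- A program is a finite list of instructions. -/
abbrev Program (R : ℕ) := List (Instr R)

/-- A machine configuration: program counter, registers and memory. Only the memory words with
addresses below `2 ^ w` can be reached by a program. -/
structure Config (w R : ℕ) where
  pc : ℕ
  regs : Fin R → BitVec w
  mem : ℕ → BitVec w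

/-- Assign `v` to register `r` and proceed to the next instruction. -/
def Config.setReg {w R : ℕ} (c : Config w R) (r : Fin R) (v : BitVec w) : Config w R :=
  { c with pc := c.pc + 1, regs := Function.update c.regs r v }

/-- Execute one instruction. Here `σ` is the built-in approximation of `√w`, and `acc` says which
memory words the program is allowed to access; the value is `none` (a run-time error) upon an access
to any other memory word and upon a division by zero. -/
def Instr.exec {w R : ℕ} (σ : BitVec w) (acc : ℕ → Prop) [DecidablePred acc]
    (i : Instr R) (c : Config w R) : Option (Config w R) :=
  match i with
  | .const r k => some (c.setReg r (BitVec.ofNat w k))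
  | .loadSqrt r => some (c.setReg r σ)
  | .op o r a b => (o.eval (c.regs a) (c.regs b)).map (c.setReg r)
  | .load r a =>
      if acc (c.regs a).toNat then some (c.setReg r (c.mem (c.regs a).toNat)) else none
  | .store a b =>
      if acc (c.regs a).toNat then
        some { c with
          pc := c.pc + 1
          mem := Function.update c.mem (c.regs a).toNat (c.regs b) }
      else none
  | .jumpEq a b t => some { c with pc := if c.regs a = c.regs b then t else c.pc + 1 }
  | .jumpLt a b t =>
      some { c with pc := if (c.regs a).toNat < (c.regs b).toNat then t else c.pc + 1 }

/-- `run σ acc P T c = some c'` means that `P`, started in configuration `c`, stops in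
configuration `c'` after at most `T` instructions and without a run-time error. A program stops when
the program counter leaves it. -/
def run {w R : ℕ} (σ : BitVec w) (acc : ℕ → Prop) [DecidablePred acc] (P : Program R) :
    ℕ → Config w R → Option (Config w R)
  | 0, c =>
      match P[c.pc]? with
      | none => some c
      | some _ => none
  | T + 1, c =>
      match P[c.pc]? with
      | none => some c
      | some i => (i.exec σ acc c).bind (run σ acc P T)

/-- Bit number `g` of the memory: the bits of word `0`, least significant bit first, are followed
by those of word `1`, and so on. -/
def memBit {w : ℕ} (m : ℕ → BitVec w) (g : ℕ) : Bool :=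
  (m (g / w)).getLsbD (g % w)

/-- The word with address `a` contains at least one of the `B` consecutive memory bits that start
with the first bit of the word with address `p`. -/
abbrev InBlock (w p B a : ℕ) : Prop := p ≤ a ∧ w * a < w * p + B

/-- The programs of the five operations of a choice dictionary. They use `K + 3` registers. -/
structure DictCode (K : ℕ) where
  init : Program (K + 3)
  insert : Program (K + 3)
  delete : Program (K + 3)
  contains : Program (K + 3)
  choice : Program (K + 3)

/-- `Call σ T n B P ℓ d post`: suppose that a data structure occupies `B` consecutive memory
bits, beginning at a word boundary, whose present contents are `d`. Call the program `P` with the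
universe size `n` in register `0`, the argument `ℓ` in register `1` and the address of the first
word of the data structure in register `2`, the contents of all other registers and of all other
memory bits being arbitrary. Then `P` stops after at most `T` instructions, it accesses only memory
words that contain bits of the data structure, it leaves all other memory bits as they were, and the
new contents `d'` of the `B` bits and the number `r` returned in register `1` satisfy `post d' r`. -/
def Call {w K : ℕ} (σ : BitVec w) (T n B : ℕ) (P : Program (K + 3)) (ℓ : ℕ)
    (d : Fin B → Bool) (post : (Fin B → Bool) → ℕ → Prop) : Prop :=
  ∀ (p : BitVec w) (c : Config w (K + 3)),
    -- the data structure fits into the addressable memory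
    w * p.toNat + B ≤ w * 2 ^ w →
    c.pc = 0 → (c.regs 0).toNat = n → (c.regs 1).toNat = ℓ → c.regs 2 = p →
    (∀ j : Fin B, memBit c.mem (w * p.toNat + j) = d j) →
    ∃ c' : Config w (K + 3),
      run σ (InBlock w p.toNat B) P T c = some c' ∧
      (∀ g : ℕ, g < w * p.toNat ∨ w * p.toNat + B ≤ g → memBit c'.mem g = memBit c.mem g) ∧
      post (fun j => memBit c'.mem (w * p.toNat + j)) (c'.regs 1).toNat

/-- The programs `D` realize, for word length `w` and universe size `n`, an externally sized choice
dictionary that occupies `B` bits between operations and executes every operation, including the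
initialization, in at most `T` steps. `Rep d S` says that the bits `d` are a possible content of the
data structure when its client set is `S`. -/
def IsChoiceDictionary {w K : ℕ} (σ : BitVec w) (D : DictCode K) (T n B : ℕ) : Prop :=
  ∃ Rep : (Fin B → Bool) → Set ℕ → Prop,
    (∀ d x, Call σ T n B D.init x d (fun d' _ => Rep d' ∅)) ∧
    ∀ d S, Rep d S →
      (∀ ℓ ∈ Set.Icc 1 n, Call σ T n B D.insert ℓ d (fun d' _ => Rep d' (S ∪ {ℓ}))) ∧
      (∀ ℓ ∈ Set.Icc 1 n, Call σ T n B D.delete ℓ d (fun d' _ => Rep d' (S \ {ℓ}))) ∧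
      (∀ ℓ ∈ Set.Icc 1 n, Call σ T n B D.contains ℓ d
        (fun d' r => Rep d' S ∧ (ℓ ∈ S → r = 1) ∧ (ℓ ∉ S → r = 0))) ∧
      (∀ x, Call σ T n B D.choice x d
        (fun d' r => Rep d' S ∧ (S.Nonempty → r ∈ S) ∧ (S = ∅ → r = 0)))

end WordRAM

/-! The bit vector of the client set is cut into words, and these into `N = n / w / 3` blocks of
three words; at most three words, the last one possibly partial, remain after the blocks and are
treated directly. A barrier `k` splits the blocks into left ones (number below `k`) and right ones.
A left and a right block are matched if their first words contain each other's numbers. The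
invariant `Valid` is that a left block represents a nonzero value exactly if it is unmatched, and a
right block exactly if it is matched. As a matching pairs left with right blocks, `k` is then the
number of nonzero blocks. A nonzero left block is stored in itself. A matched pair has six words,
for two pointers and the three words of the right block; the left block is zero and needs no space.
The sixth word, word 1 of the right block, is spare.

The barrier is stored in word 1 of the last block, which is spare as long as that block is a right
one, that is, `k < N`. The single extra bit, number `n`, tells whether `k = N`. Initialization sets
`k = 0`: then every block is an unmatched right block and so represents zero, whatever the memory
contains. If `k > 0`, a nonzero block is found at once: block 0 if it is unmatched, and otherwise
its partner.

Writing arbitrary data into an unmatched left block may create a matching by accident. The block on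
the other side is then an unmatched right block with a meaningless pointer, and it is made to point
to itself, which can never be part of a matching (`partner_setBlock`). When a block becomes nonzero
or zero, the barrier moves by one (`wp_raise`, `wp_lower`), which touches only a constant number of
blocks and leaves or consumes one free left block, unmatched and zero. This serves to store the new
value or to take over the displaced one (`wp_fillBlock`, `wp_emptyBlock`).

The word length and a bit position in a nonzero word are obtained from the binary logarithm of a
power of two, computed in constant time from the approximation of `√w` (`wp_logLarge`). With `s` a
small fraction of `√w` and `i = q * s + r`, the remainder of `2 ^ i` modulo `2 ^ s - 1` is `2 ^ r`,
and the quotient is `(2 ^ s) ^ q`. An exponent of base `e + 1` is read off modulo `e ^ 2`, where `(e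
+ 1) ^ q` is `1 + q * e`. One multiplication and a mask spread `2 ^ r` to `(2 ^ (s + 1)) ^ r`, so
that `r` can be found in the same way.

Programs are written with variables of an arbitrary type. Read with numbers as variables, they have
a weakest precondition semantics; read with register numbers, they yield machine code. Relational
parametricity (`Related`) connects the two readings in `run_code`. -/

namespace WordRAM

/-! ### Loop-free programs, their semantics and their translation to machine code. -/

/-- Loop-free programs in higher-order abstract syntax: `V` is the type of variables, each of which
holds one word and is assigned once, and `α` is the type of the result. -/
inductive Prog (V α : Type) : Type
  | ret (a : α)
  | const (k : ℕ) (f : V → Prog V α)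
  | loadSqrt (f : V → Prog V α)
  | op (o : BinOp) (a b : V) (f : V → Prog V α)
  | load (a : V) (f : V → Prog V α)
  | store (a b : V) (p : Prog V α)
  | ifEq (a b : V) (p q : Prog V α)
  | ifLt (a b : V) (p q : Prog V α)

namespace Prog

/-- Sequential composition. -/
def seq {V α β : Type} : Prog V α → (α → Prog V β) → Prog V β
  | ret a, g => g a
  | const k f, g => const k fun v => (f v).seq g
  | loadSqrt f, g => loadSqrt fun v => (f v).seq g
  | op o a b f, g => op o a b fun v => (f v).seq g
  | load a f, g => load a fun v => (f v).seq g
  | store a b p, g => store a b (p.seq g)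
  | ifEq a b p q, g => ifEq a b (p.seq g) (q.seq g)
  | ifLt a b p q, g => ifLt a b (p.seq g) (q.seq g)

instance {V : Type} : Monad (Prog V) where
  pure := ret
  bind := seq

/-- Two programs are related if they differ only in the variables, which are related by `G`, and in
the results, which are related by `R`. -/
inductive Related {V W α β : Type} (G : V → W → Prop) (R : α → β → Prop) :
    Prog V α → Prog W β → Prop
  | ret {a b} : R a b → Related G R (ret a) (ret b)
  | const {k f g} : (∀ x y, G x y → Related G R (f x) (g y)) →
      Related G R (const k f) (const k g)
  | loadSqrt {f g} : (∀ x y, G x y → Related G R (f x) (g y)) →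
      Related G R (loadSqrt f) (loadSqrt g)
  | op {o a b a' b' f g} : G a a' → G b b' → (∀ x y, G x y → Related G R (f x) (g y)) →
      Related G R (op o a b f) (op o a' b' g)
  | load {a a' f g} : G a a' → (∀ x y, G x y → Related G R (f x) (g y)) →
      Related G R (load a f) (load a' g)
  | store {a b a' b' p q} : G a a' → G b b' → Related G R p q →
      Related G R (store a b p) (store a' b' q)
  | ifEq {a b a' b' p q p' q'} : G a a' → G b b' → Related G R p p' → Related G R q q' →
      Related G R (ifEq a b p q) (ifEq a' b' p' q')
  | ifLt {a b a' b' p q p' q'} : G a a' → G b b' → Related G R p p' → Related G R q q' →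
      Related G R (ifLt a b p q) (ifLt a' b' p' q')

theorem Related.bind {V W α β γ δ : Type} {G : V → W → Prop} {R : α → β → Prop}
    {R' : γ → δ → Prop} {p : Prog V α} {q : Prog W β} {f : α → Prog V γ} {g : β → Prog W δ}
    (h : Related G R p q) (hfg : ∀ x y, R x y → Related G R' (f x) (g y)) :
    Related G R' (p >>= f) (q >>= g) := by
  change Related G R' (p.seq f) (q.seq g)
  induction h with
  | ret h => exact hfg _ _ h
  | const _ ih => exact .const ih
  | loadSqrt _ ih => exact .loadSqrt ih
  | op h₁ h₂ _ ih => exact .op h₁ h₂ ih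
  | load h₁ _ ih => exact .load h₁ ih
  | store h₁ h₂ _ ih => exact .store h₁ h₂ ih
  | ifEq h₁ h₂ _ _ ih₁ ih₂ => exact .ifEq h₁ h₂ ih₁ ih₂
  | ifLt h₁ h₂ _ _ ih₁ ih₂ => exact .ifLt h₁ h₂ ih₁ ih₂

theorem Related.pure {V W α β : Type} {G : V → W → Prop} {R : α → β → Prop} {a : α} {b : β}
    (h : R a b) : Related G R (Pure.pure a : Prog V α) (Pure.pure b) := .ret h

/-- The weakest precondition of a program whose variables hold natural numbers below `2 ^ w`: it
runs without error, and result and final memory satisfy `Q`. -/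
def wp {w : ℕ} (σ : BitVec w) (acc : ℕ → Prop) {α : Type} :
    Prog ℕ α → (α → (ℕ → BitVec w) → Prop) → (ℕ → BitVec w) → Prop
  | ret a, Q, m => Q a m
  | const k f, Q, m => wp σ acc (f (k % 2 ^ w)) Q m
  | loadSqrt f, Q, m => wp σ acc (f σ.toNat) Q m
  | op o a b f, Q, m =>
      ∃ v : BitVec w, o.eval (BitVec.ofNat w a) (BitVec.ofNat w b) = some v ∧
        wp σ acc (f v.toNat) Q m
  | load a f, Q, m => acc a ∧ wp σ acc (f (m a).toNat) Q m
  | store a b p, Q, m => acc a ∧ wp σ acc p Q (Function.update m a (BitVec.ofNat w b))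
  | ifEq a b p q, Q, m => (a = b → wp σ acc p Q m) ∧ (a ≠ b → wp σ acc q Q m)
  | ifLt a b p q, Q, m => (a < b → wp σ acc p Q m) ∧ (b ≤ a → wp σ acc q Q m)

section wp

variable {w : ℕ} {σ : BitVec w} {acc : ℕ → Prop} {α β : Type}

theorem wp_seq (p : Prog ℕ α) (f : α → Prog ℕ β) (Q : β → (ℕ → BitVec w) → Prop)
    (m : ℕ → BitVec w) :
    wp σ acc (p.seq f) Q m ↔ wp σ acc p (fun a m' => wp σ acc (f a) Q m') m := by
  induction p generalizing m <;> simp_all [seq, wp]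

theorem wp_bind (p : Prog ℕ α) (f : α → Prog ℕ β) (Q : β → (ℕ → BitVec w) → Prop)
    (m : ℕ → BitVec w) :
    wp σ acc (p >>= f) Q m ↔ wp σ acc p (fun a m' => wp σ acc (f a) Q m') m :=
  wp_seq p f Q m

theorem wp_mono {p : Prog ℕ α} {Q Q' : α → (ℕ → BitVec w) → Prop} {m : ℕ → BitVec w}
    (h : wp σ acc p Q m) (hQ : ∀ a m', Q a m' → Q' a m') : wp σ acc p Q' m := by
  induction p generalizing m with
  | ret a => exact hQ _ _ h
  | const k f ih => exact ih _ h
  | loadSqrt f ih => exact ih _ h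
  | op o a b f ih => obtain ⟨v, hv, h⟩ := h; exact ⟨v, hv, ih _ h⟩
  | load a f ih => exact ⟨h.1, ih _ h.2⟩
  | store a b p ih => exact ⟨h.1, ih h.2⟩
  | ifEq a b p q ih₁ ih₂ => exact ⟨fun e => ih₁ (h.1 e), fun e => ih₂ (h.2 e)⟩
  | ifLt a b p q ih₁ ih₂ => exact ⟨fun e => ih₁ (h.1 e), fun e => ih₂ (h.2 e)⟩

end wp

/-- The number of instructions in the machine code of a program whose next free register is `n`. -/
def size : Prog ℕ ℕ → ℕ → ℕ
  | ret _, _ => 2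
  | const _ f, n => (f n).size (n + 1) + 1
  | loadSqrt f, n => (f n).size (n + 1) + 1
  | op _ _ _ f, n => (f n).size (n + 1) + 1
  | load _ f, n => (f n).size (n + 1) + 1
  | store _ _ p, n => p.size n + 1
  | ifEq _ _ p q, n => q.size n + p.size n + 1
  | ifLt _ _ p q, n => q.size n + p.size n + 1

/-- A bound on the number of registers used by the machine code. -/
def regsNeeded : Prog ℕ ℕ → ℕ → ℕ
  | ret _, n => n
  | const _ f, n => (f n).regsNeeded (n + 1)
  | loadSqrt f, n => (f n).regsNeeded (n + 1)
  | op _ _ _ f, n => (f n).regsNeeded (n + 1)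
  | load _ f, n => (f n).regsNeeded (n + 1)
  | store _ _ p, n => p.regsNeeded n
  | ifEq _ _ p q, n => max (p.regsNeeded n) (q.regsNeeded n)
  | ifLt _ _ p q, n => max (p.regsNeeded n) (q.regsNeeded n)

/-- The machine code of a program whose variables are register numbers, for placement at address
`base`; `n` is the next free register. The result is moved to register `1`, and the code is left
with a jump to `halt`. -/
def code (K halt : ℕ) : Prog ℕ ℕ → ℕ → ℕ → List (Instr (K + 3))
  | ret a, _, _ => [.op .or 1 (Fin.ofNat _ a) (Fin.ofNat _ a), .jumpEq 0 0 halt]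
  | const k f, n, base => .const (Fin.ofNat _ n) k :: (f n).code K halt (n + 1) (base + 1)
  | loadSqrt f, n, base => .loadSqrt (Fin.ofNat _ n) :: (f n).code K halt (n + 1) (base + 1)
  | op o a b f, n, base =>
      .op o (Fin.ofNat _ n) (Fin.ofNat _ a) (Fin.ofNat _ b) ::
        (f n).code K halt (n + 1) (base + 1)
  | load a f, n, base =>
      .load (Fin.ofNat _ n) (Fin.ofNat _ a) :: (f n).code K halt (n + 1) (base + 1)
  | store a b p, n, base =>
      .store (Fin.ofNat _ a) (Fin.ofNat _ b) :: p.code K halt n (base + 1)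
  | ifEq a b p q, n, base =>
      .jumpEq (Fin.ofNat _ a) (Fin.ofNat _ b) (base + 1 + q.size n) ::
        (q.code K halt n (base + 1) ++ p.code K halt n (base + 1 + q.size n))
  | ifLt a b p q, n, base =>
      .jumpLt (Fin.ofNat _ a) (Fin.ofNat _ b) (base + 1 + q.size n) ::
        (q.code K halt n (base + 1) ++ p.code K halt n (base + 1 + q.size n))

theorem length_code (K halt : ℕ) (p : Prog ℕ ℕ) (n base : ℕ) :
    (p.code K halt n base).length = p.size n := by
  induction p generalizing n base <;> simp_all [code, size]

theorem le_regsNeeded (p : Prog ℕ ℕ) (n : ℕ) : n ≤ p.regsNeeded n := by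
  induction p generalizing n with
  | ret a => exact le_rfl
  | const k f ih => exact (Nat.le_succ n).trans (ih _ _)
  | loadSqrt f ih => exact (Nat.le_succ n).trans (ih _ _)
  | op o a b f ih => exact (Nat.le_succ n).trans (ih _ _)
  | load a f ih => exact (Nat.le_succ n).trans (ih _ _)
  | store a b p ih => exact ih _
  | ifEq a b p q ih₁ ih₂ => exact (ih₁ _).trans (le_max_left _ _)
  | ifLt a b p q ih₁ ih₂ => exact (ih₁ _).trans (le_max_left _ _)

end Prog

open Prog

theorem run_of_getElem?_eq_none {w R : ℕ} (σ : BitVec w) (acc : ℕ → Prop) [DecidablePred acc]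
    (P : Program R) (T : ℕ) (c : Config w R) (h : P[c.pc]? = none) :
    run σ acc P T c = some c := by
  cases T <;> simp only [run, h]

theorem run_succ {w R : ℕ} (σ : BitVec w) (acc : ℕ → Prop) [DecidablePred acc]
    (P : Program R) (T : ℕ) (c : Config w R) (i : Instr R) (h : P[c.pc]? = some i) :
    run σ acc P (T + 1) c = (i.exec σ acc c).bind (run σ acc P T) := by
  simp only [run, h]

/-- The program `q` results from `p` by replacing each of the registers below `n` by its value. -/
def Holds {w K : ℕ} (c : Config w (K + 3)) (n : ℕ) (p : Prog ℕ ℕ) (q : Prog ℕ ℕ) : Prop :=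
  ∀ G : ℕ → ℕ → Prop, (∀ i < n, G i (c.regs (Fin.ofNat _ i)).toNat) → Related G G p q

/-- Here it matters that `Holds` ranges over all relations `G`: one that is admissible after
register `n` has been assigned is also admissible before, because the registers below `n` keep their
values, and it relates the new variable to the new value. The bound on `n` keeps register numbers
from wrapping around in `Fin (K + 3)`. -/
theorem Holds.step {w K : ℕ} {c : Config w (K + 3)} {n : ℕ} {f g : ℕ → Prog ℕ ℕ}
    (h : ∀ G : ℕ → ℕ → Prop, (∀ i < n, G i (c.regs (Fin.ofNat _ i)).toNat) →
      ∀ x y, G x y → Related G G (f x) (g y)) (hn : n < K + 3) (v : BitVec w) :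
    Holds (c.setReg (Fin.ofNat _ n) v) (n + 1) (f n) (g v.toNat) := by
  intro G hG
  refine h G (fun i hi => ?_) n _ ?_
  · have := hG i (by omega)
    have hne : (Fin.ofNat (K + 3) i) ≠ Fin.ofNat (K + 3) n := by
      intro e
      have := congrArg Fin.val e
      simp only [Fin.val_ofNat] at this
      rw [Nat.mod_eq_of_lt (by omega), Nat.mod_eq_of_lt hn] at this
      omega
    simpa only [Config.setReg, Function.update_of_ne hne] using this
  · simpa [Config.setReg] using hG n (by omega)

/-- Every variable gets a register of its own, so registers in use are never overwritten before the
final move of the result to register 1, and the program on values can be followed instruction by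
instruction. The context `pre`, `post` carries the absolute jump targets through the induction. The
last clause records that only accessible words can change. -/
theorem run_code {w K : ℕ} (σ : BitVec w) (acc : ℕ → Prop) [DecidablePred acc]
    (P : Program (K + 3)) (halt : ℕ) (hhalt : P[halt]? = none)
    (Q : ℕ → (ℕ → BitVec w) → Prop) (p : Prog ℕ ℕ) :
    ∀ (q : Prog ℕ ℕ) (n T : ℕ) (pre post : Program (K + 3)) (c : Config w (K + 3)),
      P = pre ++ (p.code K halt n pre.length ++ post) → c.pc = pre.length →
      p.regsNeeded n ≤ K + 3 → Holds c n p q → wp σ acc q Q c.mem → p.size n ≤ T →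
      ∃ c', run σ acc P T c = some c' ∧ Q (c'.regs 1).toNat c'.mem ∧
        ∀ a, ¬ acc a → c'.mem a = c.mem a := by
  -- Taking for `G` the graph of the register contents extracts the values of the operands.
  have reg (c : Config w (K + 3)) (n : ℕ) (p q : Prog ℕ ℕ) (h : Holds c n p q) :
      Related (fun i x => x = (c.regs (Fin.ofNat _ i)).toNat)
        (fun i x => x = (c.regs (Fin.ofNat _ i)).toNat) p q :=
    h _ fun i _ => rfl
  induction p with
  | ret a =>
    intro q n T pre post c hP hc hn hq hwp hT
    have hr := reg _ _ _ _ hq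
    cases hr with | ret hr =>
    obtain ⟨T, rfl⟩ : ∃ T', T = T' + 1 + 1 := ⟨T - 2, by simp only [size] at hT; omega⟩
    have h1 : P[c.pc]? = some (.op .or 1 (Fin.ofNat _ a) (Fin.ofNat _ a)) := by
      simp [hP, hc, code]
    refine ⟨{ c.setReg 1 (c.regs (Fin.ofNat _ a)) with pc := halt }, ?_, ?_, ?_⟩
    · rw [run_succ _ _ _ _ _ _ h1]
      simp only [Instr.exec, BinOp.eval, Option.map_some, Option.bind_some, BitVec.or_self]
      rw [run_succ _ _ _ _ _ (.jumpEq 0 0 halt) (by simp [hP, hc, code, Config.setReg])]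
      simp only [Instr.exec, Option.bind_some, if_true]
      exact run_of_getElem?_eq_none _ _ _ _ _ hhalt
    · simpa only [Config.setReg, Function.update_self, ← hr, wp] using hwp
    · simp [Config.setReg]
  | const k f ih =>
    intro q n T pre post c hP hc hn hq hwp hT
    have hr := reg _ _ _ _ hq
    cases hr with | const hr =>
    rename_i g
    obtain ⟨T, rfl⟩ : ∃ T', T = T' + 1 := ⟨T - 1, by simp only [size] at hT; omega⟩
    rw [run_succ _ _ _ _ _ (.const (Fin.ofNat _ n) k) (by simp [hP, hc, code])]
    simp only [Instr.exec, Option.bind_some]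
    refine ih n _ (n + 1) T (pre ++ [.const (Fin.ofNat _ n) k]) post _ (by simp [hP, code])
      (by simp [Config.setReg, hc]) hn (Holds.step (g := g) (fun G hG x y h => ?_) ?_ _) ?_ ?_
    · have := hq G hG
      cases this with | const h' => exact h' _ _ h
    · exact (le_regsNeeded (f n) (n + 1)).trans hn
    · simpa [wp, Config.setReg] using hwp
    · simp only [size] at hT; omega
  | loadSqrt f ih =>
    intro q n T pre post c hP hc hn hq hwp hT
    have hr := reg _ _ _ _ hq
    cases hr with | loadSqrt hr =>
    rename_i g
    obtain ⟨T, rfl⟩ : ∃ T', T = T' + 1 := ⟨T - 1, by simp only [size] at hT; omega⟩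
    rw [run_succ _ _ _ _ _ (.loadSqrt (Fin.ofNat _ n)) (by simp [hP, hc, code])]
    simp only [Instr.exec, Option.bind_some]
    refine ih n _ (n + 1) T (pre ++ [.loadSqrt (Fin.ofNat _ n)]) post _ (by simp [hP, code])
      (by simp [Config.setReg, hc]) hn (Holds.step (g := g) (fun G hG x y h => ?_) ?_ _) ?_ ?_
    · have := hq G hG
      cases this with | loadSqrt h' => exact h' _ _ h
    · exact (le_regsNeeded (f n) (n + 1)).trans hn
    · simpa [wp, Config.setReg] using hwp
    · simp only [size] at hT; omega
  | op o a b f ih =>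
    intro q n T pre post c hP hc hn hq hwp hT
    have hr := reg _ _ _ _ hq
    cases hr with | op ha hb hr =>
    rename_i g
    obtain ⟨T, rfl⟩ : ∃ T', T = T' + 1 := ⟨T - 1, by simp only [size] at hT; omega⟩
    rw [run_succ _ _ _ _ _ (.op o (Fin.ofNat _ n) (Fin.ofNat _ a) (Fin.ofNat _ b))
      (by simp [hP, hc, code])]
    obtain ⟨v, hv, hwp⟩ := hwp
    simp only [ha, hb, BitVec.ofNat_toNat, BitVec.setWidth_eq] at hv
    simp only [Instr.exec, hv, Option.map_some, Option.bind_some]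
    refine ih n _ (n + 1) T (pre ++ [.op o (Fin.ofNat _ n) (Fin.ofNat _ a) (Fin.ofNat _ b)]) post _
      (by simp [hP, code])
      (by simp [Config.setReg, hc]) hn (Holds.step (g := g) (fun G hG x y h => ?_) ?_ _) ?_ ?_
    · have := hq G hG
      cases this with | op _ _ h' => exact h' _ _ h
    · exact (le_regsNeeded (f n) (n + 1)).trans hn
    · simpa [wp, Config.setReg] using hwp
    · simp only [size] at hT; omega
  | load a f ih =>
    intro q n T pre post c hP hc hn hq hwp hT
    have hr := reg _ _ _ _ hq
    cases hr with | load ha hr =>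
    rename_i g
    obtain ⟨T, rfl⟩ : ∃ T', T = T' + 1 := ⟨T - 1, by simp only [size] at hT; omega⟩
    rw [run_succ _ _ _ _ _ (.load (Fin.ofNat _ n) (Fin.ofNat _ a)) (by simp [hP, hc, code])]
    obtain ⟨hacc, hwp⟩ := hwp
    rw [ha] at hacc hwp
    simp only [Instr.exec, if_pos hacc, Option.bind_some]
    refine ih n _ (n + 1) T (pre ++ [.load (Fin.ofNat _ n) (Fin.ofNat _ a)]) post _
      (by simp [hP, code])
      (by simp [Config.setReg, hc]) hn (Holds.step (g := g) (fun G hG x y h => ?_) ?_ _) ?_ ?_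
    · have := hq G hG
      cases this with | load _ h' => exact h' _ _ h
    · exact (le_regsNeeded (f n) (n + 1)).trans hn
    · simpa [wp, Config.setReg] using hwp
    · simp only [size] at hT; omega
  | store a b p ih =>
    intro q n T pre post c hP hc hn hq hwp hT
    have hr := reg _ _ _ _ hq
    cases hr with | store ha hb hr =>
    obtain ⟨T, rfl⟩ : ∃ T', T = T' + 1 := ⟨T - 1, by simp only [size] at hT; omega⟩
    rw [run_succ _ _ _ _ _ (.store (Fin.ofNat _ a) (Fin.ofNat _ b)) (by simp [hP, hc, code])]
    obtain ⟨hacc, hwp⟩ := hwp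
    rw [ha] at hacc hwp
    rw [hb, BitVec.ofNat_toNat, BitVec.setWidth_eq] at hwp
    simp only [Instr.exec, if_pos hacc, Option.bind_some]
    obtain ⟨c', h1, h2, h3⟩ := ih _ n T (pre ++ [.store (Fin.ofNat _ a) (Fin.ofNat _ b)]) post
      { c with
          pc := c.pc + 1
          mem := Function.update c.mem (c.regs (Fin.ofNat _ a)).toNat (c.regs (Fin.ofNat _ b)) }
      (by simp [hP, code]) (by simp [hc]) hn (fun G hG => by
        have := hq G hG
        cases this with | store _ _ h' => exact h') hwp (by simp only [size] at hT; omega)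
    refine ⟨c', h1, h2, fun x hx => ?_⟩
    rw [h3 x hx]
    exact Function.update_of_ne (fun e : x = _ => hx (by rwa [e])) _ _
  | ifEq a b p q ih₁ ih₂ =>
    intro q' n T pre post c hP hc hn hq hwp hT
    have hr := reg _ _ _ _ hq
    cases hr with | ifEq ha hb hr₁ hr₂ =>
    obtain ⟨T, rfl⟩ : ∃ T', T = T' + 1 := ⟨T - 1, by simp only [size] at hT; omega⟩
    set i : Instr (K + 3) := .jumpEq (Fin.ofNat _ a) (Fin.ofNat _ b) (pre.length + 1 + q.size n)
      with hi
    rw [run_succ _ _ _ _ _ i (by simp [hP, hc, code, hi])]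
    simp only [regsNeeded, sup_le_iff] at hn
    simp only [size] at hT
    by_cases hab : c.regs (Fin.ofNat _ a) = c.regs (Fin.ofNat _ b)
    · simp only [hi, Instr.exec, if_pos hab, Option.bind_some]
      exact ih₁ _ n T (pre ++ i :: q.code K halt n (pre.length + 1)) post
        { c with pc := pre.length + 1 + q.size n }
        (by simp [hP, code, hi, length_code, add_assoc, add_comm 1])
        (by simp [length_code]; omega) hn.1 (fun G hG => by
          have := hq G hG
          cases this with | ifEq _ _ h' _ => exact h') (hwp.1 (by rw [ha, hb, hab])) (by omega)
    · simp only [hi, Instr.exec, if_neg hab, Option.bind_some]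
      exact ih₂ _ n T (pre ++ [i]) (p.code K halt n (pre.length + 1 + q.size n) ++ post)
        { c with pc := c.pc + 1 }
        (by simp [hP, code, hi])
        (by simp [hc]) hn.2 (fun G hG => by
          have := hq G hG
          cases this with | ifEq _ _ _ h' => exact h')
        (hwp.2 (by rw [ha, hb]; exact fun h => hab (BitVec.eq_of_toNat_eq h))) (by omega)
  | ifLt a b p q ih₁ ih₂ =>
    intro q' n T pre post c hP hc hn hq hwp hT
    have hr := reg _ _ _ _ hq
    cases hr with | ifLt ha hb hr₁ hr₂ =>
    obtain ⟨T, rfl⟩ : ∃ T', T = T' + 1 := ⟨T - 1, by simp only [size] at hT; omega⟩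
    set i : Instr (K + 3) := .jumpLt (Fin.ofNat _ a) (Fin.ofNat _ b) (pre.length + 1 + q.size n)
      with hi
    rw [run_succ _ _ _ _ _ i (by simp [hP, hc, code, hi])]
    simp only [regsNeeded, sup_le_iff] at hn
    simp only [size] at hT
    by_cases hab : (c.regs (Fin.ofNat _ a)).toNat < (c.regs (Fin.ofNat _ b)).toNat
    · simp only [hi, Instr.exec, if_pos hab, Option.bind_some]
      exact ih₁ _ n T (pre ++ i :: q.code K halt n (pre.length + 1)) post
        { c with pc := pre.length + 1 + q.size n }
        (by simp [hP, code, hi, length_code, add_assoc, add_comm 1])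
        (by simp [length_code]; omega) hn.1 (fun G hG => by
          have := hq G hG
          cases this with | ifLt _ _ h' _ => exact h') (hwp.1 (by rwa [ha, hb])) (by omega)
    · simp only [hi, Instr.exec, if_neg hab, Option.bind_some]
      exact ih₂ _ n T (pre ++ [i]) (p.code K halt n (pre.length + 1 + q.size n) ++ post)
        { c with pc := c.pc + 1 }
        (by simp [hP, code, hi])
        (by simp [hc]) hn.2 (fun G hG => by
          have := hq G hG
          cases this with | ifLt _ _ _ h' => exact h')
        (hwp.2 (by rw [ha, hb]; exact not_lt.1 hab)) (by omega)

end WordRAM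

/-! ### Single operations, and programs for the binary logarithm. -/

namespace WordRAM

open Prog

namespace Prog

variable {V : Type}

/-- The constant `k`. -/
def lit (k : ℕ) : Prog V V := .const k .ret

/-- The built-in approximation of the square root of the word length. -/
def sqrtLength : Prog V V := .loadSqrt .ret

/-- A single arithmetic or bitwise operation. -/
def bin (o : BinOp) (a b : V) : Prog V V := .op o a b .ret

/-- The remainder of `a` modulo `b`. -/
def mod (a b : V) : Prog V V := do
  let q ← bin .div a b
  let t ← bin .mul q b
  bin .sub a t

section wp

variable {w : ℕ} {σ : BitVec w} {acc : ℕ → Prop} {α β : Type} {a b k : ℕ} {m : ℕ → BitVec w}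
  {Q : ℕ → (ℕ → BitVec w) → Prop}

theorem wp.bind {p : Prog ℕ α} {f : α → Prog ℕ β} {Q : β → (ℕ → BitVec w) → Prop}
    (h : wp σ acc p (fun a m' => wp σ acc (f a) Q m') m) : wp σ acc (p >>= f) Q m :=
  (wp_bind p f Q m).2 h

theorem wp.ifEq {p q : Prog ℕ α} {Q : α → (ℕ → BitVec w) → Prop} (h₁ : a = b → wp σ acc p Q m)
    (h₂ : a ≠ b → wp σ acc q Q m) : wp σ acc (.ifEq a b p q) Q m := ⟨h₁, h₂⟩

theorem wp.ifLt {p q : Prog ℕ α} {Q : α → (ℕ → BitVec w) → Prop} (h₁ : a < b → wp σ acc p Q m)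
    (h₂ : b ≤ a → wp σ acc q Q m) : wp σ acc (.ifLt a b p q) Q m := ⟨h₁, h₂⟩

theorem wp.lit (hk : k < 2 ^ w) (h : Q k m) : wp σ acc (lit k) Q m := by
  simpa [Prog.lit, Prog.wp, Nat.mod_eq_of_lt hk] using h

theorem wp.sqrtLength (h : Q σ.toNat m) : wp σ acc sqrtLength Q m := h

theorem wp.add (hab : a + b < 2 ^ w) (h : Q (a + b) m) : wp σ acc (bin .add a b) Q m :=
  ⟨_, rfl, by simpa [Prog.wp, Nat.mod_eq_of_lt hab] using h⟩

theorem wp.sub (ha : a < 2 ^ w) (hab : b ≤ a) (h : Q (a - b) m) :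
    wp σ acc (bin .sub a b) Q m := by
  refine ⟨_, rfl, ?_⟩
  have : (BitVec.ofNat w a - BitVec.ofNat w b).toNat = a - b := by
    rw [BitVec.toNat_sub_of_le (by
      rw [BitVec.le_def, BitVec.toNat_ofNat, BitVec.toNat_ofNat, Nat.mod_eq_of_lt ha,
        Nat.mod_eq_of_lt (by omega)]; exact hab)]
    rw [BitVec.toNat_ofNat, BitVec.toNat_ofNat, Nat.mod_eq_of_lt ha, Nat.mod_eq_of_lt (by omega)]
  simpa [Prog.wp, this] using h

/-- The wraparound is intended here, as the all-ones word is what reveals the word length. The rules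
for sums, differences, products and left shifts otherwise exclude overflow. -/
theorem wp.zero_sub_one (hw : 0 < w) (h : Q (2 ^ w - 1) m) : wp σ acc (bin .sub 0 1) Q m := by
  refine ⟨_, rfl, ?_⟩
  have h1 : 1 % 2 ^ w = 1 := Nat.mod_eq_of_lt (Nat.one_lt_two_pow hw.ne')
  have : (BitVec.ofNat w 0 - BitVec.ofNat w 1).toNat = 2 ^ w - 1 := by
    rw [BitVec.toNat_sub, BitVec.toNat_ofNat, BitVec.toNat_ofNat, h1, Nat.zero_mod, add_zero]
    exact Nat.mod_eq_of_lt (by have := Nat.one_le_two_pow (n := w); omega)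
  rw [this]
  exact h

theorem wp.mul (hab : a * b < 2 ^ w) (h : Q (a * b) m) : wp σ acc (bin .mul a b) Q m := by
  refine ⟨_, rfl, ?_⟩
  have : (BitVec.ofNat w a * BitVec.ofNat w b).toNat = a * b := by
    rw [BitVec.toNat_mul, BitVec.toNat_ofNat, BitVec.toNat_ofNat, ← Nat.mul_mod,
      Nat.mod_eq_of_lt hab]
  simpa [Prog.wp, this] using h

theorem wp.div (ha : a < 2 ^ w) (hb : b < 2 ^ w) (hb0 : 0 < b) (h : Q (a / b) m) :
    wp σ acc (bin .div a b) Q m := by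
  refine ⟨BitVec.ofNat w (a / b), ?_, ?_⟩
  · have : ¬ BitVec.ofNat w b = 0 := by
      intro e
      have := congrArg BitVec.toNat e
      rw [BitVec.toNat_ofNat, Nat.mod_eq_of_lt hb] at this
      simp at this
      omega
    simp only [BinOp.eval, if_neg this, BitVec.toNat_ofNat, Nat.mod_eq_of_lt ha,
      Nat.mod_eq_of_lt hb]
  · simpa [Prog.wp, Nat.mod_eq_of_lt ((Nat.div_le_self a b).trans_lt ha)] using h

theorem wp.shl (hb : b < 2 ^ w) (hab : a * 2 ^ b < 2 ^ w) (h : Q (a * 2 ^ b) m) :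
    wp σ acc (bin .shl a b) Q m := by
  refine ⟨_, rfl, ?_⟩
  have ha : a < 2 ^ w := lt_of_le_of_lt (Nat.le_mul_of_pos_right _ (by positivity)) hab
  simpa [Prog.wp, Nat.mod_eq_of_lt hb, Nat.mod_eq_of_lt ha, Nat.mod_eq_of_lt hab,
    Nat.shiftLeft_eq] using h

theorem wp.one_shl (hb : b < w) (h : Q (2 ^ b) m) : wp σ acc (bin .shl 1 b) Q m :=
  .shl (hb.trans Nat.lt_two_pow_self)
    (by rw [one_mul]; exact Nat.pow_lt_pow_right (by norm_num) hb) (by rwa [one_mul])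

theorem wp.shr (ha : a < 2 ^ w) (hb : b < 2 ^ w) (h : Q (a / 2 ^ b) m) :
    wp σ acc (bin .shr a b) Q m := by
  refine ⟨_, rfl, ?_⟩
  simpa [Prog.wp, Nat.mod_eq_of_lt hb, Nat.mod_eq_of_lt ha, Nat.shiftRight_eq_div_pow] using h

theorem wp.and (ha : a < 2 ^ w) (hb : b < 2 ^ w) (h : Q (a &&& b) m) :
    wp σ acc (bin .and a b) Q m := by
  refine ⟨_, rfl, ?_⟩
  simpa [Prog.wp, Nat.mod_eq_of_lt hb, Nat.mod_eq_of_lt ha] using h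

theorem wp.or (ha : a < 2 ^ w) (hb : b < 2 ^ w) (h : Q (a ||| b) m) :
    wp σ acc (bin .or a b) Q m := by
  refine ⟨_, rfl, ?_⟩
  simpa [Prog.wp, Nat.mod_eq_of_lt hb, Nat.mod_eq_of_lt ha] using h

theorem wp.xor (ha : a < 2 ^ w) (hb : b < 2 ^ w) (h : Q (a ^^^ b) m) :
    wp σ acc (bin .xor a b) Q m := by
  refine ⟨_, rfl, ?_⟩
  simpa [Prog.wp, Nat.mod_eq_of_lt hb, Nat.mod_eq_of_lt ha] using h

theorem wp.mod (ha : a < 2 ^ w) (hb : b < 2 ^ w) (hb0 : 0 < b) (h : Q (a % b) m) :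
    wp σ acc (mod a b) Q m := by
  have h1 : a / b * b ≤ a := Nat.div_mul_le_self a b
  refine .bind (.div ha hb hb0 (.bind (.mul (by omega) (.sub ha h1 ?_))))
  rwa [mul_comm, ← Nat.mod_eq_sub]

end wp

/-! ### The binary logarithm of a power of two -/

/-- The exponent `q` of a power `v = (e + 1) ^ q`, where `q < e`. -/
def exponent (e v : V) : Prog V V := do
  let one ← lit 1
  let ee ← bin .mul e e
  let d ← mod v ee
  let d ← bin .sub d one
  bin .div d e

/-- The exponent `i` of a power of two `x = 2 ^ i` in a sufficiently long word. -/
def logLarge (c : ℕ) (x : V) : Prog V V := do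
  let σ ← sqrtLength
  let c ← lit c
  let s ← bin .div σ c
  let one ← lit 1
  let y ← bin .shl one s
  let y ← bin .sub y one
  let xr ← mod x y
  let yq ← bin .div x xr
  let q ← exponent y yq
  let s' ← bin .add s one
  let z ← bin .shl one s'
  let z ← bin .sub z one
  let t ← bin .mul s s
  let t ← bin .shl one t
  let t ← bin .sub t one
  let col ← bin .div t y
  let t ← bin .mul s s'
  let t ← bin .shl one t
  let t ← bin .sub t one
  let diag ← bin .div t z
  let t ← bin .mul xr col
  let t ← bin .and t diag
  let r ← exponent z t
  let t ← bin .mul q s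
  bin .add t r

/-- The exponent `i` of a power of two `x = 2 ^ i`, found by comparison if `i < W`. -/
def log (c : ℕ) (x : V) : ℕ → Prog V V
  | 0 => logLarge c x
  | W + 1 => do
    let y ← lit (2 ^ W)
    let i ← lit W
    ifEq x y (pure i) (log c x W)

/-- The word length. -/
def wordLength (W c : ℕ) : Prog V V := do
  let zero ← lit 0
  let one ← lit 1
  let a ← bin .sub zero one
  let b ← bin .shr a one
  let x ← bin .sub a b
  let i ← log c x W
  bin .add i one

/-- The position of some bit `1` in a nonzero word. -/
def bitIndex (W c : ℕ) (x : V) : Prog V V := do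
  let one ← lit 1
  let y ← bin .sub x one
  let z ← bin .and x y
  let d ← bin .sub x z
  log c d W

end Prog

/-! ### The arithmetic behind the binary logarithm. -/

theorem two_pow_mod_two_pow_sub_one {q r s : ℕ} (hr : r < s) (hs : 2 ≤ s) :
    2 ^ (q * s + r) % (2 ^ s - 1) = 2 ^ r := by
  have h1 : 2 ^ s ≡ 1 [MOD 2 ^ s - 1] := (Nat.modEq_iff_dvd' Nat.one_le_two_pow).2 dvd_rfl |>.symm
  have h2 : 2 ^ (q * s + r) ≡ 2 ^ r [MOD 2 ^ s - 1] := by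
    have := (h1.pow q).mul_right (2 ^ r)
    rwa [one_pow, one_mul, ← pow_mul, ← pow_add, mul_comm s q] at this
  -- It remains to see that `2 ^ r ≤ 2 ^ (s - 1) < 2 ^ s - 1`; the second inequality needs `s ≥ 2`.
  rw [h2, Nat.mod_eq_of_lt]
  obtain ⟨t, rfl⟩ : ∃ t, s = t + 2 := ⟨s - 2, by omega⟩
  have : 2 ^ r ≤ 2 ^ (t + 1) := Nat.pow_le_pow_right (by norm_num) (by omega)
  have : 2 ≤ 2 ^ (t + 1) := by rw [pow_succ]; have := Nat.one_le_two_pow (n := t); omega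
  have : 2 ^ (t + 2) = 2 * 2 ^ (t + 1) := by ring
  omega

/-- By the binomial theorem, all terms of `(e + 1) ^ q` beyond the linear one vanish modulo `e ^ 2`;
for `q < e` the linear part is already reduced. Subtracting 1 and dividing by `e` then yields the
exponent. -/
theorem succ_pow_mod_sq {e q : ℕ} (h : q < e) (he : 2 ≤ e) :
    (e + 1) ^ q % (e * e) = 1 + q * e := by
  have h1 : (e + 1) ^ q ≡ 1 + q * e [MOD e * e] := by
    clear h
    induction q with
    | zero => simp [Nat.ModEq]
    | succ q ih =>
      rw [pow_succ]
      refine (ih.mul_right _).trans ?_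
      have : (1 + q * e) * (e + 1) = 1 + (q + 1) * e + q * (e * e) := by ring
      rw [this]
      exact Nat.ModEq.symm (by simp [Nat.ModEq])
  rw [h1, Nat.mod_eq_of_lt]
  obtain ⟨d, rfl⟩ : ∃ d, e = q + 1 + d := ⟨e - q - 1, by omega⟩
  nlinarith

theorem sum_two_pow_lt {f : ℕ → ℕ} (hf : StrictMono f) (N : ℕ) :
    ∑ j ∈ Finset.range N, 2 ^ f j < 2 ^ f N := by
  induction N with
  | zero => simp
  | succ N ih =>
    rw [Finset.sum_range_succ]
    have : 2 ^ (f N + 1) ≤ 2 ^ f (N + 1) :=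
      Nat.pow_le_pow_right (by norm_num) (hf (Nat.lt_succ_self N))
    rw [pow_succ] at this
    omega

/-- The exponents are distinct, so the addition has no carries. -/
theorem testBit_sum_two_pow {f : ℕ → ℕ} (hf : StrictMono f) (N e : ℕ) :
    (∑ j ∈ Finset.range N, 2 ^ f j).testBit e = true ↔ ∃ j < N, f j = e := by
  induction N with
  | zero => simp
  | succ N ih =>
    have h1 := Nat.two_pow_add_eq_or_of_lt (sum_two_pow_lt hf N) 1
    rw [mul_one] at h1
    rw [Finset.sum_range_succ, add_comm, h1,
      Nat.testBit_or, Bool.or_eq_true, ih, Nat.testBit_two_pow]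
    constructor
    · rintro (h | ⟨j, hj, h⟩)
      · exact ⟨N, by omega, by simpa using h⟩
      · exact ⟨j, by omega, h⟩
    · rintro ⟨j, hj, h⟩
      rcases Nat.lt_succ_iff_lt_or_eq.1 hj with hj | rfl
      · exact .inr ⟨j, hj, h⟩
      · exact .inl (by simpa using h)

/-- The product has its ones at the positions `s * j + r`, the mask at the positions `(s + 1) * k`.
A common position satisfies `s * j + r = s * k + k`, hence `k = r` by reduction modulo `s`, and then
`j = r`. A single bit survives, at a position proportional to `r`. -/
theorem mul_sum_land_sum {r s : ℕ} (hr : r < s) :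
    (2 ^ r * ∑ j ∈ Finset.range s, (2 ^ s) ^ j) &&& (∑ j ∈ Finset.range s, (2 ^ (s + 1)) ^ j) =
      (2 ^ (s + 1)) ^ r := by
  have e1 : 2 ^ r * ∑ j ∈ Finset.range s, (2 ^ s) ^ j = ∑ j ∈ Finset.range s, 2 ^ (s * j + r) := by
    rw [Finset.mul_sum]
    exact Finset.sum_congr rfl fun j _ => by rw [← pow_mul, ← pow_add, add_comm]
  have e2 : ∑ j ∈ Finset.range s, (2 ^ (s + 1)) ^ j = ∑ j ∈ Finset.range s, 2 ^ ((s + 1) * j) :=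
    Finset.sum_congr rfl fun j _ => by rw [← pow_mul]
  have m1 : StrictMono fun j => s * j + r := by
    intro a b h
    have := Nat.mul_lt_mul_of_pos_left h (show 0 < s by omega)
    simp only
    omega
  have m2 : StrictMono fun j => (s + 1) * j := by
    intro a b h
    exact Nat.mul_lt_mul_of_pos_left h (by omega)
  rw [e1, e2, ← pow_mul]
  apply Nat.eq_of_testBit_eq
  intro e
  rw [Bool.eq_iff_iff, Nat.testBit_and, Bool.and_eq_true, testBit_sum_two_pow m1,
    testBit_sum_two_pow m2, Nat.testBit_two_pow]
  constructor
  · rintro ⟨⟨j, hj, h⟩, ⟨k, hk, h'⟩⟩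
    have h2 : s * j + r = s * k + k := by rw [h, ← h']; ring
    have h3 : k = r := by
      have := congrArg (· % s) h2
      simpa [Nat.mul_add_mod, Nat.mod_eq_of_lt hr, Nat.mod_eq_of_lt hk] using this.symm
    subst h3
    simpa using h'
  · intro h
    have h : (s + 1) * r = e := by simpa using h
    exact ⟨⟨r, hr, by rw [← h]; ring⟩, ⟨r, hr, h⟩⟩

theorem geomSum_eq_div {y : ℕ} (hy : 2 ≤ y) (N : ℕ) :
    (y ^ N - 1) / (y - 1) = ∑ j ∈ Finset.range N, y ^ j :=
  (Nat.geomSum_eq hy N).symm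

/-- `x &&& (x - 1)` is `x` without its lowest one. The induction halves `x`: if `x` is even, halving
`x - 1` gives the predecessor of the half of `x`; if `x` is odd, both have the same half. -/
theorem exists_sub_land_pred {x : ℕ} (hx : x ≠ 0) :
    ∃ i, x.testBit i = true ∧ x - (x &&& (x - 1)) = 2 ^ i := by
  induction x using Nat.strong_induction_on with
  | _ x ih =>
    have hdiv := Nat.and_div_two (a := x) (b := x - 1)
    have hmod : (x &&& (x - 1)) % 2 = 0 := by
      have := Nat.testBit_and x (x - 1) 0
      simp only [Nat.testBit_zero] at this
      rcases Nat.mod_two_eq_zero_or_one (x &&& (x - 1)) with h | h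
      · exact h
      · exfalso
        simp only [h, decide_true] at this
        have := this.symm
        simp only [Bool.and_eq_true, decide_eq_true_eq] at this
        omega
    rcases Nat.even_or_odd' x with ⟨y, rfl | rfl⟩
    · obtain ⟨i, h1, h2⟩ := ih y (by omega) (by omega)
      refine ⟨i + 1, ?_, ?_⟩
      · rw [Nat.testBit_succ]
        simpa using h1
      · rw [show (2 * y - 1) / 2 = y - 1 by omega, show 2 * y / 2 = y by omega] at hdiv
        have : (y &&& (y - 1)) ≤ y := Nat.and_le_left
        rw [pow_succ, ← h2]
        omega
    · refine ⟨0, by simp, ?_⟩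
      rw [show (2 * y + 1 - 1) / 2 = y by omega, show (2 * y + 1) / 2 = y by omega,
        Nat.and_self] at hdiv
      omega

/-- The constants `W` and `c` are suitable for computing binary logarithms in words of length `w`
with the approximation `σ` of `√w`. -/
def LogConstants {w : ℕ} (σ : BitVec w) (W c : ℕ) : Prop :=
  W < w → 0 < c ∧ c < 2 ^ w ∧ 2 ≤ σ.toNat / c ∧
    (σ.toNat / c) * (σ.toNat / c + 1) < w ∧ w ≤ (σ.toNat / c) * (2 ^ (σ.toNat / c) - 1)

section wp

variable {w : ℕ} {σ : BitVec w} {acc : ℕ → Prop} {m : ℕ → BitVec w}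
  {Q : ℕ → (ℕ → BitVec w) → Prop}

theorem wp_exponent {e v q : ℕ} (hv : v = (e + 1) ^ q) (hvw : v < 2 ^ w) (hq : q < e)
    (he : 2 ≤ e) (hew : e * e < 2 ^ w) (h : Q q m) : wp σ acc (exponent e v) Q m := by
  have h1 : e < 2 ^ w := by nlinarith
  have h2 := succ_pow_mod_sq hq he
  have h3 : (e + 1) ^ q % (e * e) < e * e := Nat.mod_lt _ (by positivity)
  subst hv
  refine .bind (.lit (by omega) (.bind (.mul hew (.bind (.mod hvw hew (by positivity)
    (.bind (.sub (by omega) (by omega) (.div (by omega) h1 (by omega) ?_))))))))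
  rwa [h2, Nat.add_sub_cancel_left, Nat.mul_div_cancel _ (by omega)]

/-- The conditions on `s` in `LogConstants` serve two purposes: `s * (s + 1) < w` makes all
intermediate results fit into a word, and `w ≤ s * (2 ^ s - 1)` makes the quotient `q` of `i` by `s`
small enough for `exponent`. -/
theorem wp_logLarge {W c : ℕ} (hc : LogConstants σ W c) (hW : W < w) {i : ℕ} (hi : i < w)
    (h : Q i m) : wp σ acc (logLarge c (2 ^ i)) Q m := by
  obtain ⟨hc0, hcw, hs, hsw, hws⟩ := hc hW
  have hσw : σ.toNat < 2 ^ w := σ.isLt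
  have hww : w < 2 ^ w := Nat.lt_two_pow_self
  generalize hsd : σ.toNat / c = s at *
  have hlt : ∀ {a}, a < w → 2 ^ a < 2 ^ w := fun ha => Nat.pow_lt_pow_right (by norm_num) ha
  have hss : s * s < w := by nlinarith
  have hs2 : 2 * (s + 1) ≤ s * (s + 1) := Nat.mul_le_mul_right _ hs
  have h2s := hlt (show s < w by nlinarith)
  have h2s1 := hlt (show s + 1 < w by nlinarith)
  have h2ss := hlt hss
  have h2ss1 := hlt hsw
  have h1ss := Nat.one_le_two_pow (n := s * s)
  have h1ss1 := Nat.one_le_two_pow (n := s * (s + 1))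
  -- Both bases of `exponent` exceed 2 because of `s ≥ 2`.
  have h4 : 4 ≤ 2 ^ s := Nat.pow_le_pow_right (n := 2) (by norm_num) hs
  have h8 : 2 ^ (s + 1) = 2 * 2 ^ s := by ring
  have hsq (a : ℕ) (ha : 2 * a < w) : (2 ^ a - 1) * (2 ^ a - 1) < 2 ^ w := by
    refine lt_of_le_of_lt (Nat.mul_le_mul (Nat.sub_le _ _) (Nat.sub_le _ _)) ?_
    rw [← pow_add]
    exact hlt (by omega)
  set q := i / s with hq
  set r := i % s with hr
  have hrs : r < s := Nat.mod_lt _ (by omega)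
  have hir : i = q * s + r := (Nat.div_add_mod' i s).symm
  have hqs : q < 2 ^ s - 1 := by
    rw [hq, Nat.div_lt_iff_lt_mul (by omega), mul_comm]
    omega
  have hmod : 2 ^ i % (2 ^ s - 1) = 2 ^ r := by rw [hir]; exact two_pow_mod_two_pow_sub_one hrs hs
  have hrw : 2 ^ r < 2 ^ w := hlt (by omega)
  have hiw := hlt hi
  have hdiv : 2 ^ i / 2 ^ r = (2 ^ s) ^ q := by
    rw [hir, pow_add, Nat.mul_div_cancel _ (by positivity), ← pow_mul, mul_comm]
  have hcol : (2 ^ (s * s) - 1) / (2 ^ s - 1) = ∑ j ∈ Finset.range s, (2 ^ s) ^ j := by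
    rw [← geomSum_eq_div (by omega), ← pow_mul]
  have hdiag : (2 ^ (s * (s + 1)) - 1) / (2 ^ (s + 1) - 1) =
      ∑ j ∈ Finset.range s, (2 ^ (s + 1)) ^ j := by
    rw [← geomSum_eq_div (by omega), ← pow_mul, mul_comm]
  have hland := mul_sum_land_sum hrs
  -- Since `2 ^ r ≤ 2 ^ s - 1`, the product is at most `2 ^ (s * s) - 1`.
  have hmul : 2 ^ r * ∑ j ∈ Finset.range s, (2 ^ s) ^ j < 2 ^ w := by
    rw [← hcol]
    have h1 := Nat.div_mul_le_self (2 ^ (s * s) - 1) (2 ^ s - 1)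
    have h2 : 2 ^ r ≤ 2 ^ s - 1 := by
      have := Nat.pow_lt_pow_right (a := 2) (by norm_num) hrs
      omega
    have h3 := Nat.mul_le_mul_left ((2 ^ (s * s) - 1) / (2 ^ s - 1)) h2
    rw [mul_comm]
    omega
  rw [← hsd] at h2s
  refine .bind (.sqrtLength (.bind (.lit hcw (.bind (.div hσw hcw hc0 ?_)))))
  rw [hsd] at h2s ⊢
  refine .bind (.lit (by omega) (.bind (.one_shl (by omega) (.bind (.sub h2s (by omega)
    (.bind (.mod hiw (by omega) (by omega) ?_)))))))
  rw [hmod]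
  refine .bind (.div hiw hrw (by positivity) ?_)
  rw [hdiv]
  refine .bind (wp_exponent (by rw [Nat.sub_add_cancel (by omega)])
    (by rw [← hdiv]; exact (Nat.div_le_self _ _).trans_lt hiw) hqs (by omega)
    (hsq s (by omega)) ?_)
  refine .bind (.add (by omega) (.bind (.one_shl (by omega) (.bind (.sub h2s1 (by omega)
    (.bind (.mul (by omega) (.bind (.one_shl hss (.bind (.sub h2ss (by omega)
    (.bind (.div (by omega) (by omega) (by omega) ?_)))))))))))))
  refine .bind (.mul (by omega) (.bind (.one_shl hsw (.bind (.sub h2ss1 (by omega)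
    (.bind (.div (by omega) (by omega) (by omega) ?_)))))))
  rw [hcol, hdiag]
  refine .bind (.mul hmul (.bind (.and hmul ?_ ?_)))
  · rw [← hdiag]
    exact (Nat.div_le_self _ _).trans_lt (by omega)
  rw [hland]
  have hrlt : r < 2 ^ (s + 1) - 1 := by
    have : r < 2 ^ r := Nat.lt_two_pow_self
    have : 2 ^ r ≤ 2 ^ s := Nat.pow_le_pow_right (by norm_num) hrs.le
    omega
  refine .bind (wp_exponent (by rw [Nat.sub_add_cancel (by omega)])
    (by rw [← pow_mul]
        exact hlt (lt_of_le_of_lt (Nat.mul_le_mul_left _ hrs.le) (by rwa [mul_comm])))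
    hrlt (by omega) (hsq (s + 1) (by omega)) ?_)
  exact .bind (.mul (by omega) (.add (by omega) (by rwa [← hir])))

theorem wp_log {W c : ℕ} (hc : LogConstants σ W c) {i : ℕ} (hi : i < w) (h : Q i m) :
    wp σ acc (log c (2 ^ i) W) Q m := by
  have hiw : 2 ^ i < 2 ^ w := Nat.pow_lt_pow_right (by norm_num) hi
  have hww : w < 2 ^ w := Nat.lt_two_pow_self
  -- Comparisons with `2 ^ U` for `U < W` have failed once `logLarge` is reached, so there `W ≤ i <
  -- w` and the conditions of `LogConstants` apply. In short words, `i < W` holds and some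
  -- comparison succeeds.
  have key : ∀ U, (i < U ∨ W ≤ i) → wp σ acc (log c (2 ^ i) U) Q m := by
    intro U
    induction U with
    | zero => exact fun h' => wp_logLarge hc (by omega) hi h
    | succ U ih =>
      intro h'
      refine .bind ?_
      by_cases hU : i = U
      · subst hU
        exact .lit hiw (.bind (.lit (by omega) (.ifEq (fun _ => h) (fun e => absurd rfl e))))
      · have hne : 2 ^ i ≠ 2 ^ U % 2 ^ w := by
          rcases lt_or_ge U w with h1 | h1
          · rw [Nat.mod_eq_of_lt (Nat.pow_lt_pow_right (by norm_num) h1)]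
            exact fun e => hU (Nat.pow_right_injective le_rfl e)
          · rw [Nat.mod_eq_zero_of_dvd (pow_dvd_pow 2 h1)]
            positivity
        change wp σ acc (Prog.ifEq (2 ^ i) (2 ^ U % 2 ^ w) _ _) Q m
        exact .ifEq (fun e => absurd e hne) (fun _ => ih (by omega))
  exact key W (lt_or_ge i W)

/-- With `A ≥ C ^ 2`, the integer `σ` satisfies `w ≤ A * σ ^ 2` and `σ ^ 2 ≤ A * w`. Dividing `σ` by
`2 * A` gives `4 * A * s ^ 2 ≤ w`, hence `s * (s + 1) < w`. Conversely `w` is at most a constant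
times `s ^ 2`, which is below `2 ^ s` once `s`, and therefore `w`, is large. -/
theorem exists_logConstants (C : ℝ) : ∃ W c : ℕ, ∀ (w : ℕ) (σ : BitVec w),
    Real.sqrt (w : ℝ) ≤ C * (σ.toNat : ℝ) → (σ.toNat : ℝ) ≤ C * Real.sqrt (w : ℝ) →
    LogConstants σ W c := by
  obtain ⟨A, hA, hCA⟩ : ∃ A : ℕ, 0 < A ∧ C ^ 2 ≤ A :=
    ⟨⌈C ^ 2⌉₊ + 1, by omega, (Nat.le_ceil _).trans (by push_cast; linarith)⟩
  obtain ⟨s₀, hs₀⟩ : ∃ s₀ : ℕ, ∀ s ≥ s₀, (16 * A * (2 * A) ^ 2) * s ^ 2 ≤ 2 ^ s := by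
    have := tendsto_pow_const_div_const_pow_of_one_lt 2 (r := (2 : ℝ)) (by norm_num)
    have hpos : (0 : ℝ) < 1 / (16 * A * (2 * A) ^ 2 : ℕ) := by positivity
    obtain ⟨s₀, h⟩ := Filter.eventually_atTop.1 (this.eventually (gt_mem_nhds hpos))
    refine ⟨s₀, fun s hs => ?_⟩
    have h1 := h s hs
    rw [div_lt_div_iff₀ (by positivity) (by positivity)] at h1
    have h2 : ((16 * A * (2 * A) ^ 2 * s ^ 2 : ℕ) : ℝ) ≤ ((2 ^ s : ℕ) : ℝ) := by
      push_cast at h1 ⊢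
      linarith
    exact_mod_cast h2
  -- The first summand of the threshold forces `s ≥ s₀ + 2`; the second makes the divisor `2 * A`
  -- smaller than `w`, so that it fits into a word.
  refine ⟨A * ((2 * A) * (s₀ + 2)) ^ 2 + 2 * A, 2 * A, fun w σ h1 h2 hW => ?_⟩
  have hw0 : (0 : ℝ) ≤ w := Nat.cast_nonneg w
  have hwσ : w ≤ A * σ.toNat ^ 2 := by
    have : (w : ℝ) ≤ A * (σ.toNat : ℝ) ^ 2 := by
      calc (w : ℝ) = Real.sqrt w ^ 2 := (Real.sq_sqrt hw0).symm
        _ ≤ (C * σ.toNat) ^ 2 := pow_le_pow_left₀ (Real.sqrt_nonneg _) h1 2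
        _ = C ^ 2 * (σ.toNat : ℝ) ^ 2 := by ring
        _ ≤ A * (σ.toNat : ℝ) ^ 2 := by gcongr
    exact_mod_cast this
  have hσw : σ.toNat ^ 2 ≤ A * w := by
    have : (σ.toNat : ℝ) ^ 2 ≤ A * w := by
      calc (σ.toNat : ℝ) ^ 2 ≤ (C * Real.sqrt w) ^ 2 := pow_le_pow_left₀ (by positivity) h2 2
        _ = C ^ 2 * Real.sqrt w ^ 2 := by ring
        _ = C ^ 2 * w := by rw [Real.sq_sqrt hw0]
        _ ≤ A * w := by gcongr
    exact_mod_cast this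
  generalize σ.toNat = t at *
  set s := t / (2 * A) with hs
  have hst : s * (2 * A) ≤ t := Nat.div_mul_le_self _ _
  have hts : t < (s + 1) * (2 * A) := by
    rw [hs]
    exact Nat.lt_mul_of_div_lt (Nat.lt_succ_self _) (by omega)
  have hs2 : s₀ + 2 ≤ s := by
    by_contra hlt
    have h3 : t ≤ 2 * A * (s₀ + 2) := by
      refine hts.le.trans ?_
      rw [mul_comm]
      exact Nat.mul_le_mul_left _ (by omega)
    have h4 : A * t ^ 2 ≤ A * (2 * A * (s₀ + 2)) ^ 2 :=
      Nat.mul_le_mul_left _ (Nat.pow_le_pow_left h3 2)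
    omega
  refine ⟨by omega, (show 2 * A < w by omega).trans Nat.lt_two_pow_self, by omega, ?_, ?_⟩
  · have h3 : (s * (2 * A)) ^ 2 ≤ A * w := (Nat.pow_le_pow_left hst 2).trans hσw
    have h4 : A * (4 * A * s ^ 2) ≤ A * w := by
      calc A * (4 * A * s ^ 2) = (s * (2 * A)) ^ 2 := by ring
        _ ≤ _ := h3
    have h5 := Nat.le_of_mul_le_mul_left h4 hA
    have h6 : 4 * s ^ 2 ≤ 4 * A * s ^ 2 := Nat.mul_le_mul_right _ (by omega)
    nlinarith
  · have h3 : w ≤ A * ((s + 1) * (2 * A)) ^ 2 :=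
      hwσ.trans (Nat.mul_le_mul_left _ (Nat.pow_le_pow_left hts.le 2))
    have h4 : A * ((s + 1) * (2 * A)) ^ 2 ≤ A * ((2 * s) * (2 * A)) ^ 2 :=
      Nat.mul_le_mul_left _ (Nat.pow_le_pow_left (Nat.mul_le_mul_right _ (by omega)) 2)
    have h5 := hs₀ s (by omega)
    -- The factor 4 is slack: it gives `w ≤ 2 ^ s / 4`, which is at most `2 ^ s - 1`.
    have h6 : A * ((2 * s) * (2 * A)) ^ 2 * 4 = 16 * A * (2 * A) ^ 2 * s ^ 2 := by ring
    have h7 : 2 ^ s - 1 ≤ s * (2 ^ s - 1) := Nat.le_mul_of_pos_left _ (by omega)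
    have h8 : 4 ≤ 2 ^ s := Nat.pow_le_pow_right (n := 2) (by norm_num) (show 2 ≤ s by omega)
    omega

theorem wp_wordLength {W c : ℕ} (hc : LogConstants σ W c) (hw : 0 < w) (h : Q w m) :
    wp σ acc (wordLength W c) Q m := by
  have h1 := Nat.one_lt_two_pow hw.ne'
  obtain ⟨v, rfl⟩ : ∃ v, w = v + 1 := ⟨w - 1, by omega⟩
  have h2 : 2 ^ (v + 1) = 2 * 2 ^ v := by ring
  have h3 : v + 1 < 2 ^ (v + 1) := Nat.lt_two_pow_self
  refine .bind (.lit (by omega) (.bind (.lit h1 (.bind (.zero_sub_one hw (.bind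
    (.shr (by omega) h1 (.bind (.sub (by omega) (Nat.div_le_self _ _) (.bind ?_))))))))))
  -- All ones minus all ones shifted right leaves the top bit, whose logarithm is `w - 1`.
  rw [show 2 ^ (v + 1) - 1 - (2 ^ (v + 1) - 1) / 2 ^ 1 = 2 ^ v by omega]
  exact wp_log hc (by omega) (.add h3 h)

theorem wp_bitIndex {W c : ℕ} (hc : LogConstants σ W c) {x : ℕ} (hx : x ≠ 0) (hxw : x < 2 ^ w)
    (h : ∀ i < w, x.testBit i = true → Q i m) : wp σ acc (bitIndex W c x) Q m := by
  obtain ⟨i, h1, h2⟩ := exists_sub_land_pred hx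
  have hi : i < w := by
    by_contra hi
    rw [Nat.testBit_lt_two_pow (hxw.trans_le (Nat.pow_le_pow_right (by norm_num) (not_lt.1 hi)))]
      at h1
    simp at h1
  have h3 : x &&& (x - 1) ≤ x := Nat.and_le_left
  refine .bind (.lit (by omega) (.bind (.sub hxw (by omega) (.bind (.and hxw (by omega)
    (.bind (.sub hxw h3 ?_)))))))
  rw [h2]
  exact wp_log hc hi (h i hi h1)

end wp

end WordRAM

/-! ### Matchings of blocks across a barrier. -/

namespace WordRAM

/-- The block matched with block `j`, or the number `N` of blocks if `j` is unmatched. Blocks to the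
left of the barrier `k` are matched only with blocks to the right of it, and conversely. Matched
blocks point to each other with their first words. -/
def partner (N k : ℕ) (B : ℕ → Fin 3 → ℕ) (j : ℕ) : ℕ :=
  if j < k then
    if k ≤ B j 0 ∧ B j 0 < N ∧ B (B j 0) 0 = j then B j 0 else N
  else
    if B j 0 < k ∧ B (B j 0) 0 = j then B j 0 else N

/-- The words represented by block `j`. They are stored in the block itself if it is to the left of
the barrier and unmatched, and in the block and its partner if it is to the right of the barrier and
matched; otherwise they are zero. -/
def content (N k : ℕ) (B : ℕ → Fin 3 → ℕ) (j : ℕ) : Fin 3 → ℕ :=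
  if partner N k B j = N then
    if j < k then B j else 0
  else
    if j < k then 0 else ![B (partner N k B j) 1, B (partner N k B j) 2, B j 2]

/-- Assign `v` to word `t` of block `x`. -/
def setWord (B : ℕ → Fin 3 → ℕ) (x : ℕ) (t : Fin 3) (v : ℕ) : ℕ → Fin 3 → ℕ :=
  fun j s => if j = x ∧ s = t then v else B j s

/-- Replace the words of block `x` by `v`. If this creates a matching by accident, destroy it by
letting the other block point to itself. -/
def setBlock (N k : ℕ) (B : ℕ → Fin 3 → ℕ) (x : ℕ) (v : Fin 3 → ℕ) : ℕ → Fin 3 → ℕ :=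
  if k ≤ v 0 ∧ v 0 < N ∧ B (v 0) 0 = x then setWord (Function.update B x v) (v 0) 0 (v 0)
  else Function.update B x v

/-- Match block `f` with block `r` and let `r` represent `v`. -/
def link (B : ℕ → Fin 3 → ℕ) (f r : ℕ) (v : Fin 3 → ℕ) : ℕ → Fin 3 → ℕ :=
  setWord (setWord (setWord (setWord (setWord B f 0 r) r 0 f) f 1 (v 0)) f 2 (v 1)) r 2 (v 2)

section

variable {N k : ℕ} {B : ℕ → Fin 3 → ℕ}

/-- The condition for a matching, mutual pointers across the barrier, is symmetric in the two
blocks. -/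
theorem partner_partner (hk : k ≤ N) {j : ℕ} (hj : j < N) (h : partner N k B j ≠ N) :
    partner N k B j < N ∧ (j < k ↔ k ≤ partner N k B j) ∧
      partner N k B (partner N k B j) = j := by
  unfold partner at *; grind

theorem setBlock_apply {x : ℕ} (hx : x < k) (v : Fin 3 → ℕ) (j : ℕ) (t : Fin 3) :
    setBlock N k B x v j t = if j = x then v t else
      if k ≤ v 0 ∧ v 0 < N ∧ B (v 0) 0 = x ∧ j = v 0 ∧ t = 0 then v 0 else B j t := by
  have hu : Function.update B x v j t = if j = x then v t else B j t := by
    rw [Function.update_apply]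
    split_ifs <;> rfl
  unfold setBlock setWord
  by_cases h : k ≤ v 0 ∧ v 0 < N ∧ B (v 0) 0 = x
  · rw [if_pos h]
    simp only [hu]
    grind
  · rw [if_neg h, hu]
    grind

/-- The old pointer of `x` was not part of a matching, so no matching is lost. A new one could only
join `x` with `v 0`; in that case `v 0` pointed to the unmatched block `x`, so it was itself
unmatched and its pointer may be changed. -/
theorem partner_setBlock {x : ℕ} (hx : x < k) (h : partner N k B x = N)
    (v : Fin 3 → ℕ) {j : ℕ} (hj : j < N) :
    partner N k (setBlock N k B x v) j = partner N k B j := by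
  unfold partner at *
  simp only [setBlock_apply hx]
  grind

/-- The words of the memory that matter for the contents of block `j`. -/
theorem content_congr {k' : ℕ} {B' : ℕ → Fin 3 → ℕ} {j : ℕ}
    (hp : partner N k' B' j = partner N k B j) (hk : j < k' ↔ j < k)
    (h₁ : partner N k B j = N → j < k → B' j = B j)
    (h₂ : partner N k B j ≠ N → k ≤ j → B' (partner N k B j) 1 = B (partner N k B j) 1 ∧
      B' (partner N k B j) 2 = B (partner N k B j) 2 ∧ B' j 2 = B j 2) :
    content N k' B' j = content N k B j := by
  unfold content
  rw [hp]
  simp only [hk]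
  grind

variable {j : ℕ}

theorem content_left (h : partner N k B j = N) (hj : j < k) : content N k B j = B j := by
  unfold content; grind

theorem content_left_matched (h : partner N k B j ≠ N) (hj : j < k) : content N k B j = 0 := by
  unfold content; grind

theorem content_right (h : partner N k B j = N) (hj : k ≤ j) : content N k B j = 0 := by
  unfold content; grind

theorem content_right_matched (h : partner N k B j ≠ N) (hj : k ≤ j) :
    content N k B j = ![B (partner N k B j) 1, B (partner N k B j) 2, B j 2] := by
  unfold content; grind

theorem content_setBlock (hk : k ≤ N) {x : ℕ} (hx : x < k) (h : partner N k B x = N)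
    (v : Fin 3 → ℕ) {j : ℕ} (hj : j < N) :
    content N k (setBlock N k B x v) j = if j = x then v else content N k B j := by
  have hp := partner_setBlock hx h v hj
  split_ifs with hjx
  · subst hjx
    rw [content_left (hp.trans h) hx]
    ext t
    simp [setBlock_apply hx]
  · refine content_congr hp Iff.rfl (fun h1 h2 => ?_) (fun h1 h2 => ?_)
    · ext t
      rw [setBlock_apply hx]
      grind
    · have := partner_partner hk hj h1
      simp only [setBlock_apply hx]
      grind

/-- No third block is affected: a block pointing to `f` or `r` was not matched with it before and is
not now, since `f` and `r` point to each other. -/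
theorem partner_link {f r : ℕ} (hf : f < k) (hr : k ≤ r) (hrN : r < N)
    (h : partner N k B f = N) (h' : partner N k B r = N) (v : Fin 3 → ℕ) {j : ℕ} (hj : j < N) :
    partner N k (link B f r v) j = if j = f then r else if j = r then f else partner N k B j := by
  unfold partner link setWord at *; grind

theorem content_link (hk : k ≤ N) {f r : ℕ} (hf : f < k) (hr : k ≤ r) (hrN : r < N)
    (h : partner N k B f = N) (h' : partner N k B r = N) (v : Fin 3 → ℕ) {j : ℕ} (hj : j < N) :
    content N k (link B f r v) j = if j = f then 0 else if j = r then v else content N k B j := by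
  have hp := partner_link hf hr hrN h h' v hj
  split_ifs with h1 h2
  · rw [content_left_matched (by grind) (by grind)]
  · rw [content_right_matched (by grind) (by grind), hp]
    ext t
    fin_cases t <;> simp [link, setWord] <;> grind
  · refine content_congr (by grind) Iff.rfl (fun h3 h4 => ?_) (fun h3 h4 => ?_)
    · ext t
      unfold link setWord
      grind
    · have := partner_partner hk hj h3
      unfold link setWord
      grind

/-- Letting a block to the right of the barrier point to itself breaks its matching. -/
theorem partner_setWord_self {r : ℕ} (hr : k ≤ r) (hrN : r < N) (j : ℕ) :
    partner N k (setWord B r 0 r) j =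
      if j = r ∨ partner N k B j = r then N else partner N k B j := by
  unfold partner setWord at *; grind

/-- The old partner of `r` is excluded: it becomes an unmatched left block, and its three words
suddenly count as its contents. -/
theorem content_setWord_self (hk : k ≤ N) {r : ℕ} (hr : k ≤ r) (hrN : r < N) {j : ℕ}
    (hj : j < N) (hjr : partner N k B j ≠ r) :
    content N k (setWord B r 0 r) j = if j = r then 0 else content N k B j := by
  have hp := partner_setWord_self (B := B) hr hrN j
  split_ifs with h1
  · rw [content_right (by grind) (by grind)]
  · refine content_congr (by grind) Iff.rfl (fun h3 h4 => ?_) (fun h3 h4 => ?_)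
    · ext t
      unfold setWord
      grind
    · have := partner_partner hk hj h3
      unfold setWord
      grind

/-- The second word of a block to the right of the barrier is not used. -/
theorem partner_setWord_one {x v : ℕ} (j : ℕ) :
    partner N k (setWord B x 1 v) j = partner N k B j := by
  unfold partner setWord; grind

theorem content_setWord_one (hk : k ≤ N) {x : ℕ} (hx : k ≤ x) (v : ℕ) {j : ℕ} (hj : j < N) :
    content N k (setWord B x 1 v) j = content N k B j := by
  refine content_congr (partner_setWord_one j) Iff.rfl (fun h3 h4 => ?_) (fun h3 h4 => ?_)
  · ext t
    unfold setWord
    grind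
  · have := partner_partner hk hj h3
    unfold setWord
    grind

/-- The barrier may pass a block that points to itself. -/
theorem partner_succ {c : ℕ} (hc : B c 0 = c) (j : ℕ) :
    partner N (c + 1) B j = partner N c B j := by
  unfold partner; grind

/-- Block `c` itself is excluded, as it turns from an unmatched right block, which represents zero,
into an unmatched left block, which represents its own words. -/
theorem content_succ {c : ℕ} (hc : B c 0 = c) {j : ℕ} (hjc : j ≠ c) :
    content N (c + 1) B j = content N c B j := by
  refine content_congr (partner_succ hc j) (by omega) ?_ ?_ <;> grind

theorem partner_of_self {c : ℕ} (hc : B c 0 = c) : partner N k B c = N := by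
  unfold partner; grind

theorem partner_setWord_left {x : ℕ} (hx : x < k) (h : partner N k B x = N) {j : ℕ}
    (hj : j < N) : partner N k (setWord B x 0 x) j = partner N k B j := by
  unfold partner setWord at *; grind

theorem content_setWord_left (hk : k ≤ N) {x : ℕ} (hx : x < k) (h : partner N k B x = N) {j : ℕ}
    (hj : j < N) (hjx : j ≠ x) :
    content N k (setWord B x 0 x) j = content N k B j := by
  refine content_congr (partner_setWord_left hx h hj) Iff.rfl (fun h3 h4 => ?_) (fun h3 h4 => ?_)
  · ext t
    unfold setWord
    grind
  · have := partner_partner hk hj h3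
    unfold setWord
    grind

end

end WordRAM

/-! ### The programs of the choice dictionary. -/

namespace WordRAM

open Prog

namespace Prog

variable {V : Type}

/-- Load the word at offset `g` from `p`. -/
def readAt (p g : V) : Prog V V := do
  let a ← bin .add p g
  .load a .ret

/-- Store `v` into the word at offset `g` from `p`. -/
def writeAt (p g v : V) : Prog V Unit := do
  let a ← bin .add p g
  .store a v (.ret ())

/-- The offset of word `t` of block `j`. -/
def offset (j : V) (t : ℕ) : Prog V V := do
  let three ← lit 3
  let a ← bin .mul three j
  let t ← lit t
  bin .add a t

def readWord (p j : V) (t : ℕ) : Prog V V := do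
  let g ← offset j t
  readAt p g

def writeWord (p j : V) (t : ℕ) (v : V) : Prog V Unit := do
  let g ← offset j t
  writeAt p g v

/-- The number of blocks. -/
def numBlocks (n w : V) : Prog V V :=
  .ifLt w n
    (do let q ← bin .div n w
        let three ← lit 3
        bin .div q three)
    (lit 0)

/-- Compute `WordRAM.partner`. -/
def getPartner (p N k j : V) : Prog V V := do
  let r ← readWord p j 0
  .ifLt j k
    (.ifLt r k (pure N)
      (.ifLt r N
        (do let s ← readWord p r 0
            .ifEq s j (pure r) (pure N))
        (pure N)))
    (.ifLt r k
      (do let s ← readWord p r 0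
          .ifEq s j (pure r) (pure N))
      (pure N))

/-- Compute `WordRAM.content`. -/
def getContent (p N k j : V) : Prog V (Fin 3 → V) := do
  let r ← getPartner p N k j
  .ifEq r N
    (.ifLt j k
      (do let a ← readWord p j 0
          let b ← readWord p j 1
          let c ← readWord p j 2
          pure ![a, b, c])
      (do let zero ← lit 0
          pure fun _ => zero))
    (.ifLt j k
      (do let zero ← lit 0
          pure fun _ => zero)
      (do let a ← readWord p r 1
          let b ← readWord p r 2
          let c ← readWord p j 2
          pure ![a, b, c]))

/-- Perform `WordRAM.setBlock`. -/
def putBlock (p N k x : V) (v : Fin 3 → V) : Prog V Unit := do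
  writeWord p x 0 (v 0)
  writeWord p x 1 (v 1)
  writeWord p x 2 (v 2)
  .ifLt (v 0) k (pure ())
    (.ifLt (v 0) N
      (do let s ← readWord p (v 0) 0
          .ifEq s x (writeWord p (v 0) 0 (v 0)) (pure ()))
      (pure ()))

/-- Perform `WordRAM.link`. -/
def putLink (p f r : V) (v : Fin 3 → V) : Prog V Unit := do
  writeWord p f 0 r
  writeWord p r 0 f
  writeWord p f 1 (v 0)
  writeWord p f 2 (v 1)
  writeWord p r 2 (v 2)

/-- Bit `s` of the word `x`. -/
def getBit (x s : V) : Prog V V := do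
  let one ← lit 1
  let y ← bin .shr x s
  bin .and y one

def setBit (x s : V) : Prog V V := do
  let one ← lit 1
  let b ← bin .shl one s
  bin .or x b

def clearBit (x s : V) : Prog V V := do
  let one ← lit 1
  let b ← bin .shl one s
  let y ← bin .and x b
  bin .xor x y

/-- Apply `f` to the bit of the data structure that tells if the barrier is at the right end. -/
def modifyFlag (p n w : V) (f : V → V → Prog V V) : Prog V Unit := do
  let g ← bin .div n w
  let s ← mod n w
  let x ← readAt p g
  let x ← f x s
  writeAt p g x

/-- The position of the barrier. -/
def getBarrier (p n w N : V) : Prog V V := do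
  let zero ← lit 0
  .ifEq N zero (pure N) do
    let g ← bin .div n w
    let s ← mod n w
    let x ← readAt p g
    let b ← getBit x s
    .ifEq b zero
      (do let one ← lit 1
          let last ← bin .sub N one
          readWord p last 1)
      (pure N)

def putBarrier (p n w N k : V) : Prog V Unit :=
  .ifEq k N
    (modifyFlag p n w setBit)
    (do modifyFlag p n w clearBit
        let one ← lit 1
        let last ← bin .sub N one
        writeWord p last 1 k)

/-- Move the barrier to the right. The result is an unmatched block to the left of the new barrier
that represents zero. -/
def raise (p n w N k : V) : Prog V V := do
  let one ← lit 1
  let zero ← lit 0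
  let r ← getPartner p N k k
  let v ← getContent p N k k
  writeWord p k 0 k
  let k' ← bin .add k one
  putBarrier p n w N k'
  putBlock p N k' k v
  .ifEq r N (pure k) do
    putBlock p N k' r fun _ => zero
    pure r

/-- Move the barrier to the left, where `f` is an unmatched block to the left of the barrier that
represents zero. -/
def lower (p n w N k f : V) : Prog V Unit := do
  let one ← lit 1
  let c ← bin .sub k one
  .ifEq f c
    (do writeWord p c 0 c
        putBarrier p n w N c)
    (do let r ← getPartner p N k c
        .ifEq r N
          (do let v ← getContent p N k c
              writeWord p c 0 c
              putBarrier p n w N c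
              putLink p f c v)
          (do let v ← getContent p N k r
              writeWord p r 0 r
              writeWord p c 0 c
              putBarrier p n w N c
              putLink p f r v))

/-- Change the contents of block `x` from zero to `v`. -/
def fillBlock (p n w N k x : V) (v : Fin 3 → V) : Prog V Unit := do
  let f ← raise p n w N k
  let one ← lit 1
  let k' ← bin .add k one
  .ifLt x k'
    (do let r ← getPartner p N k' x
        .ifEq r N
          (putBlock p N k' x v)
          (do let u ← getContent p N k' r
              writeWord p r 0 r
              putLink p f r u
              putBlock p N k' x v))
    (putLink p f x v)

/-- Change the contents of block `x` from a nonzero value to zero. -/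
def emptyBlock (p n w N k x : V) : Prog V Unit := do
  let zero ← lit 0
  .ifLt x k
    (do putBlock p N k x fun _ => zero
        lower p n w N k x)
    (do let r ← getPartner p N k x
        writeWord p x 0 x
        putBlock p N k r fun _ => zero
        lower p n w N k r)

/-- Change the contents of block `x` from a nonzero value to a nonzero value `v`. -/
def updateBlock (p N k x : V) (v : Fin 3 → V) : Prog V Unit :=
  .ifLt x k
    (putBlock p N k x v)
    (do let r ← getPartner p N k x
        writeWord p x 0 x
        putLink p r x v)

/-- The bitwise disjunction of the words of `v`. -/
def disjunction (v : Fin 3 → V) : Prog V V := do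
  let a ← bin .or (v 0) (v 1)
  bin .or a (v 2)

/-- Apply `f` to word number `t`. -/
def modifyWord (t : V) (v : Fin 3 → V) (f : V → Prog V V) : Prog V (Fin 3 → V) := do
  let zero ← lit 0
  let one ← lit 1
  .ifEq t zero
    (do let a ← f (v 0)
        pure ![a, v 1, v 2])
    (.ifEq t one
      (do let b ← f (v 1)
          pure ![v 0, b, v 2])
      (do let c ← f (v 2)
          pure ![v 0, v 1, c]))

/-- Word number `t`. -/
def selectWord (t : V) (v : Fin 3 → V) : Prog V V := do
  let zero ← lit 0
  let one ← lit 1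
  .ifEq t zero (pure (v 0)) (.ifEq t one (pure (v 1)) (pure (v 2)))

/-- Perform a bit operation on the bit for `ℓ`, by `direct` if it belongs to word `g` outside of the
blocks and by `block` if it belongs to word `t` of block `j`, and `s` is its position in the
word. -/
def dispatch {α : Type} (W c : ℕ) (n ℓ p : V) (direct : (g s : V) → Prog V α)
    (block : (w N k j t s : V) → Prog V α) : Prog V α := do
  let w ← wordLength W c
  let N ← numBlocks n w
  let one ← lit 1
  let e ← bin .sub ℓ one
  let g ← bin .div e w
  let s ← mod e w
  let zero ← lit 0
  .ifEq N zero (direct g s) do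
    let three ← lit 3
    let j ← bin .div g three
    .ifLt j N
      (do let t ← mod g three
          let k ← getBarrier p n w N
          block w N k j t s)
      (direct g s)

/-- The operation `insert`. -/
def insert (W c : ℕ) (n ℓ p : V) : Prog V V := do
  dispatch W c n ℓ p
    (fun g s => do
      let x ← readAt p g
      let x ← setBit x s
      writeAt p g x)
    (fun w N k j t s => do
      let v ← getContent p N k j
      let v' ← modifyWord t v fun x => setBit x s
      let a ← disjunction v
      let zero ← lit 0
      .ifEq a zero (fillBlock p n w N k j v') (updateBlock p N k j v'))
  pure n

/-- The operation `delete`. -/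
def delete (W c : ℕ) (n ℓ p : V) : Prog V V := do
  dispatch W c n ℓ p
    (fun g s => do
      let x ← readAt p g
      let x ← clearBit x s
      writeAt p g x)
    (fun w N k j t s => do
      let v ← getContent p N k j
      let v' ← modifyWord t v fun x => clearBit x s
      let a ← disjunction v
      let b ← disjunction v'
      let zero ← lit 0
      .ifEq a zero (pure ())
        (.ifEq b zero (emptyBlock p n w N k j) (updateBlock p N k j v')))
  pure n

/-- The operation `contains`. -/
def contains (W c : ℕ) (n ℓ p : V) : Prog V V :=
  dispatch W c n ℓ p
    (fun g s => do
      let x ← readAt p g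
      getBit x s)
    (fun _ N k j t s => do
      let v ← getContent p N k j
      let x ← selectWord t v
      getBit x s)

/-- The element represented by some bit `1` of the nonzero word `x` number `g`. -/
def element (W c : ℕ) (w g x : V) : Prog V V := do
  let i ← bitIndex W c x
  let one ← lit 1
  let a ← bin .mul g w
  let a ← bin .add a i
  bin .add a one

/-- An element represented by one of the words number `g, …, last` outside of the blocks, of which
at most `d` are considered, or zero. The last word is restricted to the bits below position `s`. -/
def search (W c : ℕ) (p w last s : V) : ℕ → V → Prog V V
  | 0, _ => lit 0
  | d + 1, g => do
    let zero ← lit 0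
    let one ← lit 1
    let x ← readAt p g
    .ifEq g last
      (do let b ← bin .shl one s
          let x ← mod x b
          .ifEq x zero (pure zero) (element W c w g x))
      (.ifEq x zero
        (do let g' ← bin .add g one
            search W c p w last s d g')
        (element W c w g x))

/-- The operation `choice`. -/
def choice (W c : ℕ) (n p : V) : Prog V V := do
  let w ← wordLength W c
  let N ← numBlocks n w
  let zero ← lit 0
  let last ← bin .div n w
  let s ← mod n w
  .ifEq N zero (search W c p w last s 3 zero) do
    let k ← getBarrier p n w N
    .ifEq k zero
      (do let g ← offset N 0
          search W c p w last s 3 g)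
      (do let r ← getPartner p N k zero
          let j ← Prog.ifEq r N (pure zero) (pure r)
          let v ← getContent p N k j
          .ifEq (v 0) zero
            (.ifEq (v 1) zero
              (do let g ← offset j 2
                  element W c w g (v 2))
              (do let g ← offset j 1
                  element W c w g (v 1)))
            (do let g ← offset j 0
                element W c w g (v 0)))

/-- Clear the words number `g, …, last`, where at most `d` are considered. In the last word, only
the bits up to position `s` are cleared. -/
def clear (p last s : V) : ℕ → V → Prog V Unit
  | 0, _ => pure ()
  | d + 1, g => do
    let zero ← lit 0
    let one ← lit 1
    .ifEq g last
      (do let x ← readAt p g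
          let x ← bin .shr x s
          let x ← bin .shr x one
          let x ← bin .shl x one
          let x ← bin .shl x s
          writeAt p g x)
      (do writeAt p g zero
          let g' ← bin .add g one
          clear p last s d g')

/-- The initialization. -/
def init (W c : ℕ) (n p : V) : Prog V V := do
  let w ← wordLength W c
  let N ← numBlocks n w
  let zero ← lit 0
  let last ← bin .div n w
  let s ← mod n w
  Prog.ifEq N zero
    (clear p last s 3 zero)
    (do let g ← offset N 0
        clear p last s 3 g
        putBarrier p n w N zero)
  pure n

end Prog

end WordRAM

/-! ### Access to words, blocks and the stored barrier. -/

namespace WordRAM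

open Prog

/-- A data structure of `n + 1` bits for universe size `n` fits into the memory at address `P`. -/
structure Fits (w n P : ℕ) : Prop where
  pos : 0 < n
  lt : n < 2 ^ w
  fit : w * P + (n + 1) ≤ w * 2 ^ w

namespace Fits

variable {w n P : ℕ}

theorem w_pos (h : Fits w n P) : 0 < w := by
  rcases Nat.eq_zero_or_pos w with rfl | hw
  · have := h.lt; have := h.pos; simp at *; omega
  · exact hw

theorem one_lt (h : Fits w n P) : 1 < 2 ^ w := Nat.one_lt_two_pow h.w_pos.ne'

theorem div_lt (h : Fits w n P) : n / w < 2 ^ w := (Nat.div_le_self _ _).trans_lt h.lt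

theorem mod_lt (h : Fits w n P) : n % w < w := Nat.mod_lt _ h.w_pos

theorem w_lt (_h : Fits w n P) : w < 2 ^ w := Nat.lt_two_pow_self

theorem blocks_le (_ : Fits w n P) : 3 * (n / w / 3) ≤ n / w := Nat.mul_div_le _ _

/-- The constant 3 may be loaded faithfully only in words of at least two bits; the presence of a
block guarantees this, as then `n ≥ 3`. -/
theorem three_lt (h : Fits w n P) (hN : 0 < n / w / 3) : 3 < 2 ^ w := by
  have h1 : 3 ≤ n / w := by omega
  have h2 : n / w ≤ n := Nat.div_le_self _ _
  have := h.lt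
  omega

theorem inBlock (_h : Fits w n P) {g : ℕ} (hg : g ≤ n / w) : InBlock w P (n + 1) (P + g) := by
  refine ⟨by omega, ?_⟩
  have h1 : w * g ≤ w * (n / w) := Nat.mul_le_mul_left _ hg
  have h2 : w * (n / w) ≤ n := Nat.mul_div_le _ _
  rw [mul_add]
  omega

theorem add_lt (h : Fits w n P) {g : ℕ} (hg : g ≤ n / w) : P + g < 2 ^ w := by
  have h1 := (h.inBlock hg).2
  exact Nat.lt_of_mul_lt_mul_left (h1.trans_le h.fit)

end Fits

/-- The word number `g` from address `P`. -/
def word {w : ℕ} (P : ℕ) (m : ℕ → BitVec w) (g : ℕ) : ℕ := (m (P + g)).toNat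

/-- The memory from address `P` as a sequence of blocks of three words. -/
def blocks {w : ℕ} (n P : ℕ) (m : ℕ → BitVec w) (j : ℕ) (t : Fin 3) : ℕ :=
  if j < n / w / 3 then word P m (3 * j + t) else 0

theorem word_lt {w : ℕ} (P : ℕ) (m : ℕ → BitVec w) (g : ℕ) : word P m g < 2 ^ w := (m (P + g)).isLt

theorem blocks_lt {w : ℕ} (n P : ℕ) (m : ℕ → BitVec w) (j : ℕ) (t : Fin 3) :
    blocks n P m j t < 2 ^ w := by
  unfold blocks
  split_ifs
  · exact word_lt ..
  · positivity

/-- The two memories agree in the words after the last block. -/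
def SameRest {w : ℕ} (n P : ℕ) (m m' : ℕ → BitVec w) : Prop :=
  ∀ g, 3 * (n / w / 3) ≤ g → word P m' g = word P m g

section

variable {w n P : ℕ} {σ : BitVec w} {m : ℕ → BitVec w}

theorem wp_readAt {Q : ℕ → (ℕ → BitVec w) → Prop} (h : Fits w n P) {g : ℕ} (hg : g ≤ n / w)
    (hQ : Q (word P m g) m) : wp σ (InBlock w P (n + 1)) (readAt P g) Q m :=
  .bind (.add (h.add_lt hg) ⟨h.inBlock hg, hQ⟩)

theorem wp_writeAt {Q : Unit → (ℕ → BitVec w) → Prop} (h : Fits w n P) {g v : ℕ} (hg : g ≤ n / w)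
    (hv : v < 2 ^ w)
    (hQ : ∀ m', (∀ i, word P m' i = if i = g then v else word P m i) → Q () m') :
    wp σ (InBlock w P (n + 1)) (writeAt P g v) Q m := by
  refine .bind (.add (h.add_lt hg) ⟨h.inBlock hg, hQ _ fun i => ?_⟩)
  unfold word
  split_ifs with hi
  · subst hi
    simp [Nat.mod_eq_of_lt hv]
  · rw [Function.update_of_ne (by omega)]

theorem wp_offset {Q : ℕ → (ℕ → BitVec w) → Prop} (h : Fits w n P) {acc : ℕ → Prop} {j t : ℕ}
    (ht : t < 3) (hj : 3 * j + t ≤ n / w) (hN : 0 < n / w / 3)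
    (hQ : Q (3 * j + t) m) : wp σ acc (offset j t) Q m := by
  have h1 := h.three_lt hN
  have h2 := h.div_lt
  exact .bind (.lit h1 (.bind (.mul (by omega) (.bind (.lit (by omega) (.add (by omega) hQ))))))

theorem wp_readWord {Q : ℕ → (ℕ → BitVec w) → Prop} (h : Fits w n P) {j : ℕ} (t : Fin 3)
    (hj : j < n / w / 3) (hQ : Q (blocks n P m j t) m) :
    wp σ (InBlock w P (n + 1)) (readWord P j t) Q m := by
  have h1 := h.blocks_le
  rw [blocks, if_pos hj] at hQ
  exact .bind (wp_offset h t.2 (by omega) (by omega) (wp_readAt h (by omega) hQ))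

/-- Blocks are made of words with numbers below `n / w`, so that the partial last word is never
touched. Since `blocks` is zero beyond the last block, the effect is an equation between functions.
-/
theorem wp_writeWord {Q : Unit → (ℕ → BitVec w) → Prop} (h : Fits w n P) {j v : ℕ} (t : Fin 3)
    (hj : j < n / w / 3) (hv : v < 2 ^ w)
    (hQ : ∀ m', blocks n P m' = setWord (blocks n P m) j t v → SameRest n P m m' → Q () m') :
    wp σ (InBlock w P (n + 1)) (writeWord P j t v) Q m := by
  have h1 := h.blocks_le
  have h2 := t.2
  refine .bind (wp_offset h t.2 (by omega) (by omega) (wp_writeAt h (by omega) hv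
    fun m' hm => hQ m' ?_ fun g hg => ?_))
  · funext i s
    have h3 := s.2
    unfold blocks setWord
    rw [hm]
    simp only [Fin.ext_iff]
    split_ifs <;> first | rfl | omega
  · rw [hm, if_neg (by omega)]

theorem wp_numBlocks {Q : ℕ → (ℕ → BitVec w) → Prop} (h : Fits w n P) {acc : ℕ → Prop}
    (hQ : Q (n / w / 3) m) : wp σ acc (numBlocks n w) Q m := by
  have hw := h.w_pos
  refine .ifLt (fun h1 => ?_) (fun h1 => ?_)
  · have h3 : 3 < 2 ^ w := by
      have := h.lt
      rcases Nat.lt_or_ge w 2 with h2 | h2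
      · obtain rfl : w = 1 := by omega
        omega
      · exact lt_of_lt_of_le (by norm_num) (Nat.pow_le_pow_right (n := 2) (by norm_num) h2)
    exact .bind (.div h.lt h.w_lt hw (.bind (.lit h3 (.div h.div_lt h3 (by norm_num) hQ))))
  · have : n / w ≤ 1 := by
      rw [Nat.div_le_iff_le_mul_add_pred hw]
      omega
    have h2 : n / w / 3 = 0 := Nat.div_eq_of_lt (by omega)
    rw [h2] at hQ
    exact .lit (by positivity) hQ

/-- The first word of a block may be arbitrary data, so it is compared with `k` and `N` before it is
used as a block number; this keeps every access inside the data structure. -/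
theorem wp_getPartner {Q : ℕ → (ℕ → BitVec w) → Prop} (h : Fits w n P) {k j : ℕ}
    (hk : k ≤ n / w / 3) (hj : j < n / w / 3)
    (hQ : Q (partner (n / w / 3) k (blocks n P m) j) m) :
    wp σ (InBlock w P (n + 1)) (getPartner P (n / w / 3) k j) Q m := by
  unfold partner at hQ
  refine .bind (wp_readWord h 0 hj (.ifLt (fun h1 => .ifLt (fun h2 => ?_) (fun h2 => .ifLt
    (fun h3 => .bind (wp_readWord h 0 h3 (.ifEq (fun h4 => ?_) (fun h4 => ?_))))
    (fun h3 => ?_)))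
    (fun h1 => .ifLt
    (fun h3 => .bind (wp_readWord h 0 (h3.trans_le hk) (.ifEq (fun h4 => ?_) (fun h4 => ?_))))
    (fun h3 => ?_))))
  · rw [if_pos h1, if_neg (by omega)] at hQ; exact hQ
  · rw [if_pos h1, if_pos ⟨h2, h3, h4⟩] at hQ; exact hQ
  · rw [if_pos h1, if_neg (fun h => h4 h.2.2)] at hQ; exact hQ
  · rw [if_pos h1, if_neg (fun h => by omega)] at hQ; exact hQ
  · rw [if_neg (by omega), if_pos ⟨h3, h4⟩] at hQ; exact hQ
  · rw [if_neg (by omega), if_neg (fun h => h4 h.2)] at hQ; exact hQ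
  · rw [if_neg (by omega), if_neg (fun h => by omega)] at hQ; exact hQ

theorem wp_getContent {Q : (Fin 3 → ℕ) → (ℕ → BitVec w) → Prop} (h : Fits w n P) {k j : ℕ}
    (hk : k ≤ n / w / 3) (hj : j < n / w / 3)
    (hQ : Q (content (n / w / 3) k (blocks n P m) j) m) :
    wp σ (InBlock w P (n + 1)) (getContent P (n / w / 3) k j) Q m := by
  refine .bind (wp_getPartner h hk hj (.ifEq (fun h1 => .ifLt (fun h2 => ?_) (fun h2 => ?_))
    (fun h1 => .ifLt (fun h2 => ?_) (fun h2 => ?_))))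
  · rw [content_left h1 h2] at hQ
    refine .bind (wp_readWord h 0 hj (.bind (wp_readWord h 1 hj (.bind (wp_readWord h 2 hj ?_)))))
    have : blocks n P m j = ![blocks n P m j 0, blocks n P m j 1, blocks n P m j 2] := by
      ext t; fin_cases t <;> rfl
    rwa [this] at hQ
  · rw [content_right h1 h2] at hQ
    exact .bind (.lit (by positivity) hQ)
  · rw [content_left_matched h1 h2] at hQ
    exact .bind (.lit (by positivity) hQ)
  · rw [content_right_matched h1 h2] at hQ
    have h3 := (partner_partner hk hj h1).1
    exact .bind (wp_readWord h 1 h3 (.bind (wp_readWord h 2 h3 (.bind (wp_readWord h 2 hj hQ)))))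

theorem SameRest.trans {m₁ m₂ m₃ : ℕ → BitVec w} (h : SameRest n P m₁ m₂)
    (h' : SameRest n P m₂ m₃) : SameRest n P m₁ m₃ := fun g hg => (h' g hg).trans (h g hg)

theorem SameRest.refl (m : ℕ → BitVec w) : SameRest n P m m := fun _ _ => rfl

theorem wp_putBlock {Q : Unit → (ℕ → BitVec w) → Prop} (h : Fits w n P) {k x : ℕ} {v : Fin 3 → ℕ}
    (hk : k ≤ n / w / 3) (hx : x < k) (hv : ∀ t, v t < 2 ^ w)
    (hQ : ∀ m', blocks n P m' = setBlock (n / w / 3) k (blocks n P m) x v → SameRest n P m m' →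
      Q () m') :
    wp σ (InBlock w P (n + 1)) (putBlock P (n / w / 3) k x v) Q m := by
  have hx' := hx.trans_le hk
  refine .bind (wp_writeWord h 0 hx' (hv 0) fun m₁ b₁ r₁ => .bind (wp_writeWord h 1 hx' (hv 1)
    fun m₂ b₂ r₂ => .bind (wp_writeWord h 2 hx' (hv 2) fun m₃ b₃ r₃ => ?_)))
  have r := (r₁.trans r₂).trans r₃
  have b : blocks n P m₃ = Function.update (blocks n P m) x v := by
    rw [b₃, b₂, b₁]
    funext j t
    rw [Function.update_apply]
    by_cases hj : j = x
    · subst hj; fin_cases t <;> simp [setWord]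
    · simp [setWord, hj]
  refine .ifLt (fun h1 => ?_) (fun h1 => .ifLt (fun h2 => .bind (wp_readWord h 0 h2 (.ifEq
    (fun h3 => wp_writeWord h 0 h2 (hv 0) fun m₄ b₄ r₄ => ?_) (fun h3 => ?_)))) (fun h2 => ?_))
  · exact hQ _ (by rw [b, setBlock, if_neg (by omega)]) r
  · refine hQ _ ?_ (r.trans r₄)
    -- The block `v 0` lies to the right of the barrier and `x` to the left, so its first word is
    -- still the old one when it is tested.
    rw [b, Function.update_of_ne (by omega)] at h3
    rw [b₄, b, setBlock, if_pos ⟨h1, h2, h3⟩]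
  · refine hQ _ ?_ r
    rw [b, Function.update_of_ne (by omega)] at h3
    rw [b, setBlock, if_neg (fun h => h3 h.2.2)]
  · exact hQ _ (by rw [b, setBlock, if_neg (by omega)]) r

theorem wp_putLink {Q : Unit → (ℕ → BitVec w) → Prop} (h : Fits w n P) {f r : ℕ} {v : Fin 3 → ℕ}
    (hf : f < n / w / 3) (hr : r < n / w / 3) (hv : ∀ t, v t < 2 ^ w)
    (hQ : ∀ m', blocks n P m' = link (blocks n P m) f r v → SameRest n P m m' → Q () m') :
    wp σ (InBlock w P (n + 1)) (putLink P f r v) Q m := by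
  have h1 := h.blocks_le
  have h2 := h.div_lt
  refine .bind (wp_writeWord h 0 hf (by omega) fun m₁ b₁ r₁ => .bind (wp_writeWord h 0 hr
    (by omega) fun m₂ b₂ r₂ => .bind (wp_writeWord h 1 hf (hv 0) fun m₃ b₃ r₃ =>
    .bind (wp_writeWord h 2 hf (hv 1) fun m₄ b₄ r₄ => wp_writeWord h 2 hr (hv 2)
    fun m₅ b₅ r₅ => ?_))))
  exact hQ _ (by rw [b₅, b₄, b₃, b₂, b₁]; rfl) ((((r₁.trans r₂).trans r₃).trans r₄).trans r₅)

/-! ### Bits -/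

theorem wp_getBit {Q : ℕ → (ℕ → BitVec w) → Prop} {acc : ℕ → Prop} {x s : ℕ} (hx : x < 2 ^ w)
    (hs : s < w) (hQ : Q (x.testBit s).toNat m) : wp σ acc (getBit x s) Q m := by
  have h1 := Nat.one_lt_two_pow (show w ≠ 0 by omega)
  have h2 := (Nat.div_le_self x (2 ^ s)).trans_lt hx
  refine .bind (.lit h1 (.bind (.shr hx (hs.trans Nat.lt_two_pow_self) (.and h2 h1 ?_))))
  rwa [Nat.and_one_is_mod, ← Nat.toNat_testBit]

theorem wp_setBit {Q : ℕ → (ℕ → BitVec w) → Prop} {acc : ℕ → Prop} {x s : ℕ} (hx : x < 2 ^ w)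
    (hs : s < w)
    (hQ : ∀ y < 2 ^ w, (∀ i, y.testBit i = (decide (i = s) || x.testBit i)) → Q y m) :
    wp σ acc (setBit x s) Q m := by
  have h1 := Nat.one_lt_two_pow (show w ≠ 0 by omega)
  have h2 : 2 ^ s < 2 ^ w := Nat.pow_lt_pow_right (by norm_num) hs
  refine .bind (.lit h1 (.bind (.one_shl hs (.or hx h2 (hQ _ (Nat.or_lt_two_pow hx h2) ?_)))))
  intro i
  rw [Nat.testBit_or, Nat.testBit_two_pow, Bool.or_comm]
  simp [eq_comm]

theorem wp_clearBit {Q : ℕ → (ℕ → BitVec w) → Prop} {acc : ℕ → Prop} {x s : ℕ} (hx : x < 2 ^ w)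
    (hs : s < w)
    (hQ : ∀ y < 2 ^ w, (∀ i, y.testBit i = (!decide (i = s) && x.testBit i)) → Q y m) :
    wp σ acc (clearBit x s) Q m := by
  have h1 := Nat.one_lt_two_pow (show w ≠ 0 by omega)
  have h2 : 2 ^ s < 2 ^ w := Nat.pow_lt_pow_right (by norm_num) hs
  have h3 : x &&& 2 ^ s < 2 ^ w := Nat.and_lt_two_pow _ h2
  refine .bind (.lit h1 (.bind (.one_shl hs (.bind (.and hx h2 (.xor hx h3
    (hQ _ (Nat.xor_lt_two_pow hx h3) ?_)))))))
  intro i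
  rw [Nat.testBit_xor, Nat.testBit_and, Nat.testBit_two_pow]
  by_cases h : s = i
  · simp [h]
  · simp [h, Ne.symm h]

/-- The two memories agree in the words after the last block, except possibly in bit number `n`. -/
def SameTail {w : ℕ} (n P : ℕ) (m m' : ℕ → BitVec w) : Prop :=
  ∀ g i, 3 * (n / w / 3) ≤ g → (g ≠ n / w ∨ i ≠ n % w) →
    (word P m' g).testBit i = (word P m g).testBit i

theorem SameTail.trans {m₁ m₂ m₃ : ℕ → BitVec w} (h : SameTail n P m₁ m₂)
    (h' : SameTail n P m₂ m₃) : SameTail n P m₁ m₃ :=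
  fun g i hg hi => (h' g i hg hi).trans (h g i hg hi)

theorem SameRest.sameTail {m₁ m₂ : ℕ → BitVec w} (h : SameRest n P m₁ m₂) : SameTail n P m₁ m₂ :=
  fun g i hg _ => by rw [h g hg]

/-- The barrier is stored in the memory as `k`. -/
structure Barrier {w : ℕ} (n P : ℕ) (m : ℕ → BitVec w) (k : ℕ) : Prop where
  le : k ≤ n / w / 3
  flag : 0 < n / w / 3 → (word P m (n / w)).testBit (n % w) = decide (k = n / w / 3)
  stored : k < n / w / 3 → blocks n P m (n / w / 3 - 1) 1 = k

theorem Barrier.congr {m' : ℕ → BitVec w} {k : ℕ} (hb : Barrier n P m k) (hr : SameRest n P m m')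
    (h : k < n / w / 3 → blocks n P m' (n / w / 3 - 1) 1 = blocks n P m (n / w / 3 - 1) 1) :
    Barrier n P m' k := by
  refine ⟨hb.le, fun h0 => ?_, fun hk => (h hk).trans (hb.stored hk)⟩
  rw [hr _ (Nat.mul_div_le _ _)]
  exact hb.flag h0

theorem wp_getBarrier {Q : ℕ → (ℕ → BitVec w) → Prop} (h : Fits w n P) {k : ℕ}
    (hb : Barrier n P m k) (hQ : Q k m) :
    wp σ (InBlock w P (n + 1)) (getBarrier P n w (n / w / 3)) Q m := by
  have h1 := hb.le
  refine .bind (.lit (by positivity) (.ifEq (fun h0 => ?_) (fun h0 => ?_)))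
  · rw [show k = n / w / 3 by omega] at hQ
    exact hQ
  have h2 := hb.flag (by omega)
  refine .bind (.div h.lt h.w_lt h.w_pos (.bind (.mod h.lt h.w_lt h.w_pos
    (.bind (wp_readAt h le_rfl (.bind (wp_getBit (word_lt ..) h.mod_lt
    (.ifEq (fun h3 => ?_) (fun h3 => ?_)))))))))
  · have h4 : k < n / w / 3 := by
      rw [h2] at h3
      simp at h3
      omega
    refine .bind (.lit h.one_lt (.bind (.sub ?_ (by omega) (wp_readWord h 1 (by omega) ?_))))
    · exact (Nat.div_le_self _ _).trans_lt h.div_lt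
    · rwa [hb.stored h4]
  · have h4 : k = n / w / 3 := by
      rw [h2] at h3
      simpa using h3
    rw [h4] at hQ
    exact hQ

/-- Bit `n` belongs to word `n / w`, which lies after all blocks because `3 * N ≤ n / w`. -/
theorem wp_modifyFlag {Q : Unit → (ℕ → BitVec w) → Prop} (h : Fits w n P) (b : Bool)
    {f : ℕ → ℕ → Prog ℕ ℕ}
    (hf : ∀ (x : ℕ) (Q : ℕ → (ℕ → BitVec w) → Prop), x < 2 ^ w →
      (∀ y < 2 ^ w, (∀ i, y.testBit i = if i = n % w then b else x.testBit i) → Q y m) →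
      wp σ (InBlock w P (n + 1)) (f x (n % w)) Q m)
    (hQ : ∀ m', blocks n P m' = blocks n P m → SameTail n P m m' →
      (word P m' (n / w)).testBit (n % w) = b → Q () m') :
    wp σ (InBlock w P (n + 1)) (modifyFlag P n w f) Q m := by
  refine .bind (.div h.lt h.w_lt h.w_pos (.bind (.mod h.lt h.w_lt h.w_pos
    (.bind (wp_readAt h le_rfl (.bind (hf _ _ (word_lt ..) fun y hy hb =>
    wp_writeAt h le_rfl hy fun m' hm => hQ m' ?_ (fun g i hg hi => ?_) ?_)))))))
  · funext j t
    have h1 := h.blocks_le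
    have h2 := t.2
    unfold blocks
    split_ifs
    · rw [hm, if_neg (by omega)]
    · rfl
  · rw [hm]
    split_ifs with h1
    · subst h1
      rw [hb, if_neg (by tauto)]
    · rfl
  · rw [hm, if_pos rfl, hb, if_pos rfl]

/-- For `k = N` the last block is to the left of the barrier and may need all of its words, so only
the flag is written. For `k < N` its word 1 is free. -/
theorem wp_putBarrier {Q : Unit → (ℕ → BitVec w) → Prop} (h : Fits w n P) {k : ℕ}
    (hk : k ≤ n / w / 3) (hN : 0 < n / w / 3)
    (hQ : ∀ m', Barrier n P m' k → SameTail n P m m' →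
      (blocks n P m' = if k = n / w / 3 then blocks n P m else
        setWord (blocks n P m) (n / w / 3 - 1) 1 k) → Q () m') :
    wp σ (InBlock w P (n + 1)) (putBarrier P n w (n / w / 3) k) Q m := by
  refine .ifEq (fun h1 => ?_) (fun h1 => ?_)
  · rw [if_pos h1] at hQ
    refine wp_modifyFlag h true (fun x Q hx hQ => wp_setBit hx h.mod_lt fun y hy hb =>
      hQ y hy fun i => ?_) fun m' b r hf => hQ m' ⟨hk, fun _ => ?_, fun _ => by omega⟩ r b
    · rw [hb]
      by_cases hi : i = n % w <;> simp [hi]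
    · rw [hf]
      simp [h1]
  · rw [if_neg h1] at hQ
    refine .bind (wp_modifyFlag h false (fun x Q hx hQ => wp_clearBit hx h.mod_lt fun y hy hb =>
      hQ y hy fun i => ?_) fun m₁ b₁ r₁ hf => .bind (.lit h.one_lt (.bind (.sub ?_ (by omega)
      (wp_writeWord h 1 (by omega) ?_ fun m₂ b₂ r₂ => hQ m₂ ⟨hk, fun _ => ?_, fun _ => ?_⟩
        (r₁.trans r₂.sameTail) ?_)))))
    · rw [hb]
      by_cases hi : i = n % w <;> simp [hi]
    · exact (Nat.div_le_self _ _).trans_lt h.div_lt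
    · exact hk.trans_lt ((Nat.div_le_self _ _).trans_lt h.div_lt)
    · rw [r₂ _ h.blocks_le, hf]
      simp [h1]
    · rw [b₂]
      simp [setWord]
    · rw [b₂, b₁]

end

end WordRAM

/-! ### The invariant under changes of a block. -/

namespace WordRAM

open Prog

section

variable {w n P : ℕ} {σ : BitVec w} {m : ℕ → BitVec w}

theorem content_lt (N k : ℕ) (m : ℕ → BitVec w) (j : ℕ) (t : Fin 3) :
    content N k (blocks n P m) j t < 2 ^ w := by
  have h0 : 0 < 2 ^ w := by positivity
  unfold content
  split_ifs
  · exact blocks_lt ..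
  · exact h0
  · exact h0
  · fin_cases t <;> exact blocks_lt ..

/-- If the barrier is stored in the last block, that block is on the right and differs from `x`; the
repair of an accidental matching changes at most its word 0. -/
theorem wp_putBlock_of_barrier {Q : Unit → (ℕ → BitVec w) → Prop} (h : Fits w n P) {k x : ℕ}
    {v : Fin 3 → ℕ} (hb : Barrier n P m k) (hx : x < k)
    (hp : partner (n / w / 3) k (blocks n P m) x = n / w / 3) (hv : ∀ t, v t < 2 ^ w)
    (hQ : ∀ m', Barrier n P m' k → SameTail n P m m' →
      (∀ j < n / w / 3, partner (n / w / 3) k (blocks n P m') j =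
        partner (n / w / 3) k (blocks n P m) j) →
      (∀ j < n / w / 3, content (n / w / 3) k (blocks n P m') j =
        if j = x then v else content (n / w / 3) k (blocks n P m) j) → Q () m') :
    wp σ (InBlock w P (n + 1)) (putBlock P (n / w / 3) k x v) Q m := by
  refine wp_putBlock h hb.le hx hv fun m' b r => hQ m' (hb.congr r fun hk => ?_) r.sameTail
    (fun j hj => ?_) (fun j hj => ?_)
  · rw [b, setBlock_apply hx, if_neg (by omega), if_neg (by simp)]
  · rw [b, partner_setBlock hx hp v hj]
  · rw [b, content_setBlock hb.le hx hp v hj]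

/-- Of block `r`, linking writes only the words 0 and 2, so a barrier stored in word 1 survives even
if `r` is the last block. -/
theorem wp_putLink_of_barrier {Q : Unit → (ℕ → BitVec w) → Prop} (h : Fits w n P) {k f r : ℕ}
    {v : Fin 3 → ℕ} (hb : Barrier n P m k) (hf : f < k) (hr : k ≤ r) (hrN : r < n / w / 3)
    (hpf : partner (n / w / 3) k (blocks n P m) f = n / w / 3)
    (hpr : partner (n / w / 3) k (blocks n P m) r = n / w / 3) (hv : ∀ t, v t < 2 ^ w)
    (hQ : ∀ m', Barrier n P m' k → SameTail n P m m' →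
      (∀ j < n / w / 3, partner (n / w / 3) k (blocks n P m') j =
        if j = f then r else if j = r then f else partner (n / w / 3) k (blocks n P m) j) →
      (∀ j < n / w / 3, content (n / w / 3) k (blocks n P m') j =
        if j = f then 0 else if j = r then v else content (n / w / 3) k (blocks n P m) j) →
      Q () m') :
    wp σ (InBlock w P (n + 1)) (putLink P f r v) Q m := by
  refine wp_putLink h (hf.trans_le hb.le) hrN hv fun m' b s => hQ m' (hb.congr s fun hk => ?_)
    s.sameTail (fun j hj => ?_) (fun j hj => ?_)
  · rw [b]
    have : n / w / 3 - 1 ≠ f := by omega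
    simp [link, setWord, this]
  · rw [b, partner_link hf hr hrN hpf hpr v hj]
  · rw [b, content_link hb.le hf hr hrN hpf hpr v hj]

/-- This prepares a right block for relinking or for the passage of the barrier. The former partner
is left with uncontrolled contents, hence the restriction in the last hypothesis on `m'`. -/
theorem wp_detach {Q : Unit → (ℕ → BitVec w) → Prop} (h : Fits w n P) {k r : ℕ}
    (hb : Barrier n P m k) (hr : k ≤ r) (hrN : r < n / w / 3)
    (hQ : ∀ m', Barrier n P m' k → SameTail n P m m' → blocks n P m' r 0 = r →
      (∀ j, partner (n / w / 3) k (blocks n P m') j =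
        if j = r ∨ partner (n / w / 3) k (blocks n P m) j = r then n / w / 3 else
          partner (n / w / 3) k (blocks n P m) j) →
      (∀ j < n / w / 3, partner (n / w / 3) k (blocks n P m) j ≠ r →
        content (n / w / 3) k (blocks n P m') j =
          if j = r then 0 else content (n / w / 3) k (blocks n P m) j) → Q () m') :
    wp σ (InBlock w P (n + 1)) (writeWord P r 0 r) Q m := by
  have h1 := h.div_lt
  refine wp_writeWord h 0 hrN (by omega) fun m' b s => hQ m' (hb.congr s fun hk => ?_)
    s.sameTail ?_ (fun j => ?_) (fun j hj hjr => ?_)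
  · rw [b]
    simp [setWord]
  · rw [b]
    simp [setWord]
  · rw [b, partner_setWord_self hr hrN]
  · rw [b, content_setWord_self hb.le hr hrN hj hjr]

/-- The self-pointer is the condition of `partner_succ` under which the barrier may pass `x` to the
left. The contents of `x` are spoiled and must have been saved or be irrelevant. -/
theorem wp_detach_left {Q : Unit → (ℕ → BitVec w) → Prop} (h : Fits w n P) {k x : ℕ}
    (hb : Barrier n P m k) (hx : x < k)
    (hp : partner (n / w / 3) k (blocks n P m) x = n / w / 3)
    (hQ : ∀ m', Barrier n P m' k → SameTail n P m m' → blocks n P m' x 0 = x →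
      (∀ j < n / w / 3, partner (n / w / 3) k (blocks n P m') j =
        partner (n / w / 3) k (blocks n P m) j) →
      (∀ j < n / w / 3, j ≠ x → content (n / w / 3) k (blocks n P m') j =
        content (n / w / 3) k (blocks n P m) j) → Q () m') :
    wp σ (InBlock w P (n + 1)) (writeWord P x 0 x) Q m := by
  have h1 := h.div_lt
  have h2 := hb.le
  refine wp_writeWord h 0 (hx.trans_le h2) (by omega) fun m' b s => hQ m' (hb.congr s fun hk => ?_)
    s.sameTail ?_ (fun j hj => ?_) (fun j hj hjx => ?_)
  · rw [b]
    simp [setWord]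
  · rw [b]
    simp [setWord]
  · rw [b, partner_setWord_left hx hp hj]
  · rw [b, content_setWord_left h2 hx hp hj hjx]

theorem wp_putBarrier_content {Q : Unit → (ℕ → BitVec w) → Prop} (h : Fits w n P) {k : ℕ}
    (hk : k ≤ n / w / 3) (hN : 0 < n / w / 3)
    (hQ : ∀ m', Barrier n P m' k → SameTail n P m m' →
      (∀ j, blocks n P m' j 0 = blocks n P m j 0) →
      (∀ j, partner (n / w / 3) k (blocks n P m') j =
        partner (n / w / 3) k (blocks n P m) j) →
      (∀ j < n / w / 3, content (n / w / 3) k (blocks n P m') j =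
        content (n / w / 3) k (blocks n P m) j) → Q () m') :
    wp σ (InBlock w P (n + 1)) (putBarrier P n w (n / w / 3) k) Q m := by
  refine wp_putBarrier h hk hN fun m' hb r b => hQ m' hb r (fun j => ?_) (fun j => ?_)
    (fun j hj => ?_) <;> rw [b] <;> split_ifs with h1
  · rfl
  · simp [setWord]
  · rfl
  · exact partner_setWord_one j
  · rfl
  · exact content_setWord_one hk (by omega) k hj

/-- The blocks in the memory represent the words `C`, and the barrier is at position `k`. To the
left of the barrier, only block `f` may be unmatched and represent zero; to the right of the
barrier, only block `f` may be matched and represent zero. -/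
structure Valid (n P : ℕ) (m : ℕ → BitVec w) (k f : ℕ) (C : ℕ → Fin 3 → ℕ) : Prop where
  barrier : Barrier n P m k
  content_eq : ∀ j < n / w / 3, content (n / w / 3) k (blocks n P m) j = C j
  left : ∀ j < n / w / 3, j ≠ f → j < k →
    partner (n / w / 3) k (blocks n P m) j = n / w / 3 → C j ≠ 0
  right : ∀ j < n / w / 3, j ≠ f → k ≤ j →
    partner (n / w / 3) k (blocks n P m) j ≠ n / w / 3 → C j ≠ 0

theorem Valid.matched {k f : ℕ} {C : ℕ → Fin 3 → ℕ} (hV : Valid n P m k f C) :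
    ∀ j < n / w / 3, partner (n / w / 3) k (blocks n P m) j ≠ n / w / 3 →
      partner (n / w / 3) k (blocks n P m) j < n / w / 3 ∧
      (j < k ↔ k ≤ partner (n / w / 3) k (blocks n P m) j) ∧
      partner (n / w / 3) k (blocks n P m) (partner (n / w / 3) k (blocks n P m) j) = j :=
  fun _ hj hp => partner_partner hV.barrier.le hj hp

/-- This is the half of the invariant that holds by the definition of `content`; only the
nonvanishing of the other blocks has to be maintained. -/
theorem Valid.eq_zero {k f : ℕ} {C : ℕ → Fin 3 → ℕ} (hV : Valid n P m k f C) :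
    ∀ j < n / w / 3, (j < k ↔ partner (n / w / 3) k (blocks n P m) j ≠ n / w / 3) → C j = 0 := by
  intro j hj h
  rw [← hV.content_eq j hj]
  by_cases hk : j < k
  · exact content_left_matched (h.1 hk) hk
  · exact content_right (by tauto) (not_lt.1 hk)

/-- The index `N` for the exceptional block means that there is none. Block `k` is made to point to
itself so that the barrier can pass it without altering any other matching, and its contents, saved
before, are then written into it as a left block. The free block is `k` itself if it was unmatched,
since it then represented zero, and otherwise its former partner, which has lost its purpose. -/
theorem wp_raise {Q : ℕ → (ℕ → BitVec w) → Prop} (h : Fits w n P) {k : ℕ}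
    {C : ℕ → Fin 3 → ℕ} (hV : Valid n P m k (n / w / 3) C) (hk : k < n / w / 3)
    (hQ : ∀ m' f, Valid n P m' (k + 1) f C → f < k + 1 →
      partner (n / w / 3) (k + 1) (blocks n P m') f = n / w / 3 → C f = 0 →
      SameTail n P m m' → Q f m') :
    wp σ (InBlock w P (n + 1)) (raise P n w (n / w / 3) k) Q m := by
  have hm := hV.matched
  have hz := hV.eq_zero
  obtain ⟨hb, hC, hl, hr⟩ := hV
  have h1 := h.div_lt
  refine .bind (.lit h.one_lt (.bind (.lit (by positivity) (.bind (wp_getPartner h hb.le hk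
    (.bind (wp_getContent h hb.le hk (.bind (wp_detach h hb le_rfl hk fun m₁ b₁ t₁ s₁ p₁ c₁ =>
    .bind (.add (by omega) (.bind (wp_putBarrier_content h hk (by omega)
    fun m₂ b₂ t₂ s₂ p₂ c₂ => .bind (wp_putBlock_of_barrier h b₂ (Nat.lt_succ_self k)
    (partner_of_self (by rw [s₂, s₁])) (content_lt _ _ _ _) fun m₃ b₃ t₃ p₃ c₃ => ?_)))))))))))))
  have e₁ := fun j => partner_succ (N := n / w / 3) s₁ j
  have e₂ := fun j hjk => content_succ (N := n / w / 3) (j := j) s₁ hjk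
  have ht := (t₁.trans t₂).trans t₃
  -- Apart from `k`, only the partner of `k` is affected by detaching `k`.
  have hpk : ∀ j < n / w / 3, j ≠ k → partner (n / w / 3) k (blocks n P m) k ≠ j →
      partner (n / w / 3) k (blocks n P m) j ≠ k := by
    intro j hj _ hjk e
    have := (hm j hj (by omega)).2.2
    rw [e] at this
    exact hjk this
  clear t₁ t₂ t₃ s₁ s₂ h1
  refine .ifEq (fun h2 => ?_) (fun h2 => .bind ?_)
  · refine hQ m₃ k ⟨b₃, fun j hj => ?_, fun j hj hjk h3 h4 => ?_, fun j hj hjk h3 h4 => ?_⟩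
      (by omega) ?_ (hz k hk (by simp [h2])) ht
    · rw [c₃ j hj]
      split_ifs with h3
      · rw [h3, hC k hk]
      · rw [c₂ j hj, e₂ j h3, c₁ j hj (hpk j hj h3 (by omega)), if_neg h3, hC j hj]
    · have := hpk j hj hjk (by omega)
      grind
    · have := hpk j hj hjk (by omega)
      grind
    · grind
  -- The abandoned partner is an unmatched left block with leftover words; it is overwritten with
  -- zero, which it represents all along.
  · obtain ⟨h3, h4, h5⟩ := hm k hk h2
    refine wp_putBlock_of_barrier h b₃ (by omega) ?_ (fun _ => by positivity)
      fun m₄ b₄ t₄ p₄ c₄ => ?_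
    · grind
    · refine hQ m₄ _ ⟨b₄, fun j hj => ?_, fun j hj hjk h6 h7 => ?_, fun j hj hjk h6 h7 => ?_⟩
        (by omega) ?_ (hz _ h3 (by simp [h5]; omega)) (ht.trans t₄)
      · rw [c₄ j hj]
        split_ifs with h6
        · rw [h6]
          exact (hz _ h3 (by simp [h5]; omega)).symm
        · rw [c₃ j hj]
          split_ifs with h7
          · rw [h7, hC k hk]
          · rw [c₂ j hj, e₂ j h7, c₁ j hj (hpk j hj h7 (Ne.symm h6)), if_neg h7, hC j hj]
      · have := hpk j hj
        grind
      · have := hpk j hj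
        grind
      · grind

/-- Block `c` changes sides, and the free block `f` absorbs the consequences. If `f = c`, a zero
left block becomes an unmatched right block. If `c` is unmatched, it is nonzero and must be matched
as a right block, with `f`. If `c` is matched with `r`, it is zero and must be unmatched as a right
block, while `r` takes `f` as its new partner. -/
theorem wp_lower {Q : Unit → (ℕ → BitVec w) → Prop} (h : Fits w n P) {c f : ℕ}
    {C : ℕ → Fin 3 → ℕ} (hV : Valid n P m (c + 1) f C) (hf : f < c + 1)
    (hpf : partner (n / w / 3) (c + 1) (blocks n P m) f = n / w / 3) (hCf : C f = 0)
    (hQ : ∀ m', Valid n P m' c (n / w / 3) C → SameTail n P m m' → Q () m') :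
    wp σ (InBlock w P (n + 1)) (lower P n w (n / w / 3) (c + 1) f) Q m := by
  have hm := hV.matched
  have hz := hV.eq_zero
  obtain ⟨hb, hC, hl, hr⟩ := hV
  have hc : c < n / w / 3 := hb.le
  have h1 := h.div_lt
  refine .bind (.lit h.one_lt (.bind (.sub (by omega) (by omega) ?_)))
  rw [Nat.add_sub_cancel]
  refine .ifEq (fun h2 => ?_) (fun h2 => .bind (wp_getPartner h hb.le hc (.ifEq
    (fun h3 => ?_) (fun h3 => ?_))))
  · subst h2
    refine .bind (wp_detach_left h hb hf hpf fun m₁ b₁ t₁ s₁ p₁ c₁ =>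
      wp_putBarrier_content h hc.le (by omega) fun m₂ b₂ t₂ s₂ p₂ c₂ =>
      hQ m₂ ⟨b₂, fun j hj => ?_, ?_, ?_⟩ (t₁.trans t₂))
    · have e₁ := partner_succ (N := n / w / 3) s₁
      by_cases hjf : j = f
      · rw [content_right (by grind) (by omega)]
        grind
      · rw [c₂ j hj, ← content_succ s₁ hjf, c₁ j hj hjf, hC j hj]
    all_goals
      have e₁ := partner_succ (N := n / w / 3) s₁
      grind
  · refine .bind (wp_getContent h hb.le hc (.bind (wp_detach_left h hb (Nat.lt_succ_self c) h3
      fun m₁ b₁ t₁ s₁ p₁ c₁ => .bind (wp_putBarrier_content h hc.le (by omega)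
      fun m₂ b₂ t₂ s₂ p₂ c₂ => ?_))))
    have e₁ := partner_succ (N := n / w / 3) s₁
    refine wp_putLink_of_barrier h b₂ (by omega) le_rfl hc (by grind) (by grind)
      (content_lt _ _ _ _) fun m₃ b₃ t₃ p₃ c₃ => hQ m₃ ⟨b₃, fun j hj => ?_, ?_, ?_⟩
        ((t₁.trans t₂).trans t₃)
    · rw [c₃ j hj]
      split_ifs with h4 h5
      · rw [h4, hCf]
      · rw [h5, hC c hc]
      · rw [c₂ j hj, ← content_succ s₁ h5, c₁ j hj h5, hC j hj]
    all_goals grind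
  · obtain ⟨h4, h5, h6⟩ := hm c hc h3
    have h5 := h5.1 (Nat.lt_succ_self c)
    -- The value of `r` is partly stored in `c`, so it is saved before `c` is modified.
    refine .bind (wp_getContent h hb.le h4 (.bind (wp_detach h hb h5 h4
      fun m₀ b₀ t₀ s₀ p₀ c₀ => .bind (wp_detach_left h b₀ (Nat.lt_succ_self c) (by grind)
      fun m₁ b₁ t₁ s₁ p₁ c₁ => .bind (wp_putBarrier_content h hc.le (by omega)
      fun m₂ b₂ t₂ s₂ p₂ c₂ => ?_)))))
    have e₁ := partner_succ (N := n / w / 3) s₁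
    refine wp_putLink_of_barrier h b₂ (by omega) (by omega) h4 (by grind) (by grind)
      (content_lt _ _ _ _) fun m₃ b₃ t₃ p₃ c₃ => hQ m₃ ⟨b₃, fun j hj => ?_, ?_, ?_⟩
        (((t₀.trans t₁).trans t₂).trans t₃)
    · rw [c₃ j hj]
      split_ifs with h7 h8
      · rw [h7, hCf]
      · rw [h8, hC _ h4]
      · by_cases hjc : j = c
        · subst hjc
          rw [content_right (by grind) (by omega)]
          exact (hz j hj (by simp [h3])).symm
        · rw [c₂ j hj, ← content_succ s₁ hjc, c₁ j hj hjc, c₀ j hj (by grind), if_neg h8, hC j hj]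
    all_goals grind

theorem wp_fillBlock {Q : Unit → (ℕ → BitVec w) → Prop} (h : Fits w n P) {k x : ℕ}
    {C : ℕ → Fin 3 → ℕ} {v : Fin 3 → ℕ} (hV : Valid n P m k (n / w / 3) C) (hx : x < n / w / 3)
    (hCx : C x = 0) (hv : ∀ t, v t < 2 ^ w) (hv0 : v ≠ 0)
    (hQ : ∀ m' k', Valid n P m' k' (n / w / 3) (fun j => if j = x then v else C j) →
      SameTail n P m m' → Q () m') :
    wp σ (InBlock w P (n + 1)) (fillBlock P n w (n / w / 3) k x v) Q m := by
  have h1 := h.div_lt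
  have hk : k < n / w / 3 := by
    -- With the barrier at the right end, every block would be unmatched and to the left, hence
    -- nonzero, but block `x` represents zero.
    refine lt_of_le_of_ne hV.barrier.le fun hk => ?_
    have := hV.left x hx (by omega) (by omega)
    have := hV.matched x hx
    grind
  refine .bind (wp_raise h hV hk fun m₁ f V hf hpf hCf t₁ => .bind (.lit h.one_lt
    (.bind (.add (by omega) (.ifLt (fun h2 => ?_) (fun h2 => ?_))))))
  all_goals
    have hm := V.matched
    have hz := V.eq_zero
    obtain ⟨hb, hC, hl, hr⟩ := V
  · refine .bind (wp_getPartner h hb.le hx (.ifEq (fun h3 => ?_) (fun h3 => ?_)))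
    -- An unmatched left block that represents zero must be the free block, so `x = f` and the value
    -- can be stored directly.
    · refine wp_putBlock_of_barrier h hb h2 h3 hv fun m₂ b₂ t₂ p₂ c₂ =>
        hQ m₂ _ ⟨b₂, ?_, ?_, ?_⟩ (t₁.trans t₂) <;> grind
    -- The zero block `x` is to be used for its own value, so `f` replaces it as the partner of `r`.
    · obtain ⟨h4, h5, h6⟩ := hm x hx h3
      have h5 := h5.1 h2
      refine .bind (wp_getContent h hb.le h4 (.bind (wp_detach h hb h5 h4
        fun m₂ b₂ t₂ s₂ p₂ c₂ => .bind (wp_putLink_of_barrier h b₂ hf h5 h4 (by grind) (by grind)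
        (content_lt _ _ _ _) fun m₃ b₃ t₃ p₃ c₃ => wp_putBlock_of_barrier h b₃ h2 (by grind) hv
        fun m₄ b₄ t₄ p₄ c₄ => hQ m₄ _ ⟨b₄, fun j hj => ?_, fun j hj _ h7 h8 => ?_,
        fun j hj _ h7 h8 => ?_⟩ (((t₁.trans t₂).trans t₃).trans t₄)))))
      all_goals
        -- Partners are unique because `partner` is an involution on matched blocks.
        have hjx : partner (n / w / 3) (k + 1) (blocks n P m₁) j =
            partner (n / w / 3) (k + 1) (blocks n P m₁) x → j = x := by
          intro e
          have := (hm j hj (by omega)).2.2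
          rw [e, h6] at this
          exact this.symm
      · rw [c₄ j hj]
        split_ifs with h7
        · rfl
        · rw [c₃ j hj]
          split_ifs with h8 h9
          · rw [h8, hCf]
          · rw [hC _ h4, h9]
          · rw [c₂ j hj (fun e => h7 (hjx e)), if_neg h9, hC j hj]
      · rw [p₄ j hj, p₃ j hj, p₂ j] at h8
        clear p₂ p₃ p₄ c₂ c₃ c₄ hm hz
        grind
      · rw [p₄ j hj, p₃ j hj, p₂ j] at h8
        clear p₂ p₃ p₄ c₂ c₃ c₄ hm hz
        grind
  -- A right block with contents zero is unmatched; it becomes nonzero by being matched with the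
  -- free block.
  · refine wp_putLink_of_barrier h hb hf h2 hx hpf (by grind) hv fun m₂ b₂ t₂ p₂ c₂ =>
        hQ m₂ _ ⟨b₂, ?_, ?_, ?_⟩ (t₁.trans t₂) <;> grind

/-- Emptying creates the free block that `wp_lower` consumes: `x` itself if it is to the left of the
barrier, and otherwise its partner, which exists because `x` is nonzero. In either case some block
is to the left, so `k > 0`. -/
theorem wp_emptyBlock {Q : Unit → (ℕ → BitVec w) → Prop} (h : Fits w n P) {k x : ℕ}
    {C : ℕ → Fin 3 → ℕ} (hV : Valid n P m k (n / w / 3) C) (hx : x < n / w / 3)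
    (hCx : C x ≠ 0)
    (hQ : ∀ m' k', Valid n P m' k' (n / w / 3) (fun j => if j = x then 0 else C j) →
      SameTail n P m m' → Q () m') :
    wp σ (InBlock w P (n + 1)) (emptyBlock P n w (n / w / 3) k x) Q m := by
  have hm := hV.matched
  have hz := hV.eq_zero
  obtain ⟨hb, hC, hl, hr⟩ := hV
  have h0 : ∀ t : Fin 3, (fun _ => 0 : Fin 3 → ℕ) t < 2 ^ w := fun _ => by positivity
  refine .bind (.lit (by positivity) (.ifLt (fun h2 => ?_) (fun h2 => ?_)))
  · obtain ⟨c, rfl⟩ : ∃ c, k = c + 1 := ⟨k - 1, by omega⟩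
    refine .bind (wp_putBlock_of_barrier h hb h2 (by grind) h0 fun m₁ b₁ t₁ p₁ c₁ =>
      wp_lower (C := fun j => if j = x then 0 else C j) h ⟨b₁, ?_, ?_, ?_⟩ h2 ?_ ?_
      fun m₂ V t₂ => hQ m₂ _ V (t₁.trans t₂))
    · intro j hj
      rw [c₁ j hj]
      split_ifs
      · rfl
      · exact hC j hj
    all_goals grind
  · have h3 : partner (n / w / 3) k (blocks n P m) x ≠ n / w / 3 := by grind
    obtain ⟨h4, h5, h6⟩ := hm x hx h3
    have h5 : partner (n / w / 3) k (blocks n P m) x < k := by omega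
    obtain ⟨c, rfl⟩ : ∃ c, k = c + 1 := ⟨k - 1, by omega⟩
    refine .bind (wp_getPartner h hb.le hx (.bind (wp_detach h hb h2 hx fun m₁ b₁ t₁ s₁ p₁ c₁ =>
      .bind (wp_putBlock_of_barrier h b₁ h5 (by grind) h0 fun m₂ b₂ t₂ p₂ c₂ =>
      wp_lower (C := fun j => if j = x then 0 else C j) h ⟨b₂, ?_, ?_, ?_⟩ h5 ?_ ?_
      fun m₃ V t₃ => hQ m₃ _ V ((t₁.trans t₂).trans t₃)))))
    · intro j hj
      rw [c₂ j hj]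
      split_ifs with h7 h8
      · rfl
      · rw [h7]
        exact (hz _ h4 (by simp [h6, h5]; omega)).symm
      all_goals grind
    all_goals grind

/-- The number of nonzero blocks does not change, so the barrier stays. A nonzero right block is
detached and linked anew with the same partner, which rewrites all its words. -/
theorem wp_updateBlock {Q : Unit → (ℕ → BitVec w) → Prop} (h : Fits w n P) {k x : ℕ}
    {C : ℕ → Fin 3 → ℕ} {v : Fin 3 → ℕ} (hV : Valid n P m k (n / w / 3) C) (hx : x < n / w / 3)
    (hCx : C x ≠ 0) (hv : ∀ t, v t < 2 ^ w) (hv0 : v ≠ 0)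
    (hQ : ∀ m' k', Valid n P m' k' (n / w / 3) (fun j => if j = x then v else C j) →
      SameTail n P m m' → Q () m') :
    wp σ (InBlock w P (n + 1)) (updateBlock P (n / w / 3) k x v) Q m := by
  have hm := hV.matched
  have hz := hV.eq_zero
  obtain ⟨hb, hC, hl, hr⟩ := hV
  refine .ifLt (fun h2 => ?_) (fun h2 => ?_)
  · refine wp_putBlock_of_barrier h hb h2 (by grind) hv fun m₁ b₁ t₁ p₁ c₁ =>
      hQ m₁ k ⟨b₁, ?_, ?_, ?_⟩ t₁ <;> grind
  · have h3 : partner (n / w / 3) k (blocks n P m) x ≠ n / w / 3 := by grind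
    obtain ⟨h4, h5, h6⟩ := hm x hx h3
    refine .bind (wp_getPartner h hb.le hx (.bind (wp_detach h hb h2 hx fun m₁ b₁ t₁ s₁ p₁ c₁ =>
      wp_putLink_of_barrier h b₁ (by omega) h2 hx (by grind) (by grind) hv fun m₂ b₂ t₂ p₂ c₂ =>
      hQ m₂ k ⟨b₂, ?_, ?_, ?_⟩ (t₁.trans t₂)))) <;> grind

end

end WordRAM

/-! ### The client set; insertion, deletion and membership. -/

namespace WordRAM

open Prog

/-- The word number `g` of the bit vector of the client set, if the blocks represent `C`. -/
def clientWord {w : ℕ} (n P : ℕ) (m : ℕ → BitVec w) (C : ℕ → Fin 3 → ℕ) (g : ℕ) : ℕ :=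
  if g / 3 < n / w / 3 then C (g / 3) (Fin.ofNat 3 g) else word P m g

/-- The memory words from address `P` represent the client set `S`. -/
def Represents {w : ℕ} (n P : ℕ) (m : ℕ → BitVec w) (S : Set ℕ) : Prop :=
  ∃ k C, Valid n P m k (n / w / 3) C ∧ S ⊆ Set.Icc 1 n ∧
    ∀ e < n, e + 1 ∈ S ↔ (clientWord n P m C (e / w)).testBit (e % w) = true

/-- The two memories agree in the bits of the last word of the data structure that do not belong to
the data structure. -/
def SameHigh {w : ℕ} (n P : ℕ) (m m' : ℕ → BitVec w) : Prop :=
  ∀ i, n % w < i → (word P m' (n / w)).testBit i = (word P m (n / w)).testBit i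

/-- The program `f` assigns `b` to a bit of a word. -/
def AssignsBit {w : ℕ} (σ : BitVec w) (acc : ℕ → Prop) (f : ℕ → ℕ → Prog ℕ ℕ) (b : Bool) : Prop :=
  ∀ (x s : ℕ) (Q : ℕ → (ℕ → BitVec w) → Prop) (m : ℕ → BitVec w), x < 2 ^ w → s < w →
    (∀ y < 2 ^ w, (∀ i, y.testBit i = if i = s then b else x.testBit i) → Q y m) →
    wp σ acc (f x s) Q m

section

variable {w n P : ℕ} {σ : BitVec w} {m : ℕ → BitVec w}

theorem assignsBit_setBit {acc : ℕ → Prop} : AssignsBit σ acc setBit true :=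
  fun x s Q m hx hs hQ => wp_setBit hx hs fun y hy hb => hQ y hy fun i => by
    rw [hb]; by_cases h : i = s <;> simp [h]

theorem assignsBit_clearBit {acc : ℕ → Prop} : AssignsBit σ acc clearBit false :=
  fun x s Q m hx hs hQ => wp_clearBit hx hs fun y hy hb => hQ y hy fun i => by
    rw [hb]; by_cases h : i = s <;> simp [h]

theorem SameTail.sameHigh {m' : ℕ → BitVec w} (h : SameTail n P m m') : SameHigh n P m m' :=
  fun i hi => h _ i (Nat.mul_div_le _ _) (.inr hi.ne')

theorem clientWord_block (C : ℕ → Fin 3 → ℕ) {j : ℕ} (hj : j < n / w / 3) (t : Fin 3) :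
    clientWord n P m C (3 * j + t) = C j t := by
  have h1 : (3 * j + (t : ℕ)) / 3 = j := by omega
  have h2 : Fin.ofNat 3 (3 * j + t) = t := by
    ext; simp [Nat.mod_eq_of_lt t.2]
  rw [clientWord, h1, if_pos hj, h2]

theorem clientWord_rest (C : ℕ → Fin 3 → ℕ) {g : ℕ}
    (hg : 3 * (n / w / 3) ≤ g) : clientWord n P m C g = word P m g := by
  rw [clientWord, if_neg (by omega)]

theorem bit_eq_iff {e e' : ℕ} : e / w = e' / w ∧ e % w = e' % w ↔ e = e' := by
  constructor
  · rintro ⟨h1, h2⟩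
    rw [← Nat.div_add_mod e w, ← Nat.div_add_mod e' w, h1, h2]
  · rintro rfl
    exact ⟨rfl, rfl⟩

theorem div_le_of_lt (e : ℕ) (he : e < n) : e / w ≤ n / w := Nat.div_le_div_right he.le

theorem wp_dispatch {W c : ℕ} (hc : LogConstants σ W c) (h : Fits w n P) {α : Type}
    {Q : α → (ℕ → BitVec w) → Prop} {e k : ℕ} (he : e < n) (hb : Barrier n P m k)
    {direct : ℕ → ℕ → Prog ℕ α} {block : ℕ → ℕ → ℕ → ℕ → ℕ → ℕ → Prog ℕ α}
    (hd : 3 * (n / w / 3) ≤ e / w → wp σ (InBlock w P (n + 1)) (direct (e / w) (e % w)) Q m)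
    (hbl : ∀ (j : ℕ) (t : Fin 3), j < n / w / 3 → e / w = 3 * j + t →
      wp σ (InBlock w P (n + 1)) (block w (n / w / 3) k j t (e % w)) Q m) :
    wp σ (InBlock w P (n + 1)) (dispatch W c n (e + 1) P direct block) Q m := by
  have hn := h.lt
  have hw := h.w_pos
  have hg : e / w < 2 ^ w := (Nat.div_le_self _ _).trans_lt (by omega)
  refine .bind (wp_wordLength hc hw (.bind (wp_numBlocks h (.bind (.lit h.one_lt (.bind
    (.sub (by omega) (by omega) ?_)))))))
  rw [Nat.add_sub_cancel]
  refine .bind (.div (by omega) h.w_lt hw (.bind (.mod (by omega) h.w_lt hw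
    (.bind (.lit (by positivity) (.ifEq (fun h0 => hd (by rw [h0]; exact Nat.zero_le _))
      (fun h0 => ?_)))))))
  have h3 := h.three_lt (Nat.pos_of_ne_zero h0)
  refine .bind (.lit h3 (.bind (.div hg h3 (by norm_num) (.ifLt (fun h1 => ?_)
    (fun h1 => hd (by omega))))))
  refine .bind (.mod hg h3 (by norm_num) (.bind (wp_getBarrier h hb
    (hbl (e / w / 3) ⟨e / w % 3, Nat.mod_lt _ (by norm_num)⟩ h1 ?_))))
  exact (Nat.div_add_mod _ _).symm

theorem wp_modifyWord {acc : ℕ → Prop} {Q : (Fin 3 → ℕ) → (ℕ → BitVec w) → Prop} {t : Fin 3}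
    {v : Fin 3 → ℕ} {f : ℕ → Prog ℕ ℕ} {R : ℕ → Prop} (hw : 0 < w)
    (hf : ∀ Q : ℕ → (ℕ → BitVec w) → Prop, (∀ y, R y → Q y m) → wp σ acc (f (v t)) Q m)
    (hQ : ∀ y, R y → Q (Function.update v t y) m) : wp σ acc (modifyWord t v f) Q m := by
  refine .bind (.lit (by positivity) (.bind (.lit (Nat.one_lt_two_pow hw.ne')
    (.ifEq (fun h1 => ?_) (fun h1 => .ifEq (fun h2 => ?_) (fun h2 => ?_))))))
  · obtain rfl : t = 0 := Fin.ext h1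
    refine .bind (hf _ fun y hy => ?_)
    have e : ![y, v 1, v 2] = Function.update v 0 y := by ext s; fin_cases s <;> simp
    exact e ▸ hQ y hy
  · obtain rfl : t = 1 := Fin.ext h2
    refine .bind (hf _ fun y hy => ?_)
    have e : ![v 0, y, v 2] = Function.update v 1 y := by ext s; fin_cases s <;> simp
    exact e ▸ hQ y hy
  · obtain rfl : t = 2 := Fin.ext (by have := t.2; simp; omega)
    refine .bind (hf _ fun y hy => ?_)
    have e : ![v 0, v 1, y] = Function.update v 2 y := by ext s; fin_cases s <;> simp
    exact e ▸ hQ y hy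

theorem wp_selectWord {acc : ℕ → Prop} {Q : ℕ → (ℕ → BitVec w) → Prop} {t : Fin 3}
    {v : Fin 3 → ℕ} (hw : 0 < w) (hQ : Q (v t) m) : wp σ acc (selectWord t v) Q m := by
  refine .bind (.lit (by positivity) (.bind (.lit (Nat.one_lt_two_pow hw.ne')
    (.ifEq (fun h1 => ?_) (fun h1 => .ifEq (fun h2 => ?_) (fun h2 => ?_))))))
  · obtain rfl : t = 0 := Fin.ext h1
    exact hQ
  · obtain rfl : t = 1 := Fin.ext h2
    exact hQ
  · obtain rfl : t = 2 := Fin.ext (by have := t.2; simp; omega)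
    exact hQ

theorem wp_disjunction {acc : ℕ → Prop} {Q : ℕ → (ℕ → BitVec w) → Prop} {v : Fin 3 → ℕ}
    (hv : ∀ t, v t < 2 ^ w) (hQ : ∀ a, (a = 0 ↔ v = 0) → Q a m) :
    wp σ acc (disjunction v) Q m := by
  refine .bind (.or (hv 0) (hv 1) (.or (Nat.or_lt_two_pow (hv 0) (hv 1)) (hv 2) (hQ _ ?_)))
  rw [Nat.or_eq_zero_iff, Nat.or_eq_zero_iff]
  constructor
  · rintro ⟨⟨h0, h1⟩, h2⟩
    ext t; fin_cases t <;> simpa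
  · rintro rfl
    simp

/-- Element `e + 1` is bit `e % w` of word `e / w`. The words after the blocks may have changed only
in bit `n`, which belongs to no element. -/
theorem Represents.of_block {m' : ℕ → BitVec w} {C : ℕ → Fin 3 → ℕ} {k' : ℕ}
    {S S' : Set ℕ} (hS : ∀ e < n, e + 1 ∈ S ↔ (clientWord n P m C (e / w)).testBit (e % w) = true)
    {e j : ℕ} {t : Fin 3} {y : ℕ} {b : Bool} (hj : j < n / w / 3) (he : e / w = 3 * j + t)
    (hy : ∀ i, y.testBit i = if i = e % w then b else (C j t).testBit i)
    (hV : Valid n P m' k' (n / w / 3) fun i => if i = j then Function.update (C j) t y else C i)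
    (hT : SameTail n P m m') (hS' : S' ⊆ Set.Icc 1 n)
    (hb : ∀ x, x + 1 ∈ S' ↔ if x = e then b = true else x + 1 ∈ S) :
    Represents n P m' S' := by
  refine ⟨k', _, hV, hS', fun x hx => ?_⟩
  rw [hb, hS x hx]
  have hxn := (bit_eq_iff (w := w) (e := x) (e' := n)).not.2 hx.ne
  have hxe := bit_eq_iff (w := w) (e := x) (e' := e)
  unfold clientWord
  by_cases h1 : x / w / 3 < n / w / 3
  · simp only [if_pos h1]
    by_cases h2 : x / w / 3 = j
    · rw [if_pos h2, h2, Function.update_apply]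
      have h3 : Fin.ofNat 3 (x / w) = t ↔ x / w = e / w := by
        have := t.2
        simp only [Fin.ext_iff, Fin.val_ofNat]
        omega
      by_cases h4 : x / w = e / w
      · rw [if_pos (h3.2 h4), h3.2 h4, hy]
        by_cases h5 : x % w = e % w
        · rw [if_pos (hxe.1 ⟨h4, h5⟩), if_pos h5]
        · rw [if_neg (fun h => h5 (hxe.2 h).2), if_neg h5]
      · rw [if_neg (fun h => h4 (h3.1 h)), if_neg (fun h => h4 (hxe.2 h).1)]
    · rw [if_neg h2, if_neg (fun h => by subst h; omega)]
  · rw [if_neg h1, if_neg h1, if_neg (fun h => by subst h; omega),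
      hT _ _ (by omega) (by tauto)]

theorem Represents.of_rest {m' : ℕ → BitVec w} {S S' : Set ℕ} (hS : Represents n P m S)
    {e : ℕ} {y : ℕ} {b : Bool} (he : e < n) (hg : 3 * (n / w / 3) ≤ e / w)
    (hy : ∀ i, y.testBit i = if i = e % w then b else (word P m (e / w)).testBit i)
    (hm : ∀ i, word P m' i = if i = e / w then y else word P m i) (hS' : S' ⊆ Set.Icc 1 n)
    (hb : ∀ x, x + 1 ∈ S' ↔ if x = e then b = true else x + 1 ∈ S) :
    Represents n P m' S' ∧ SameHigh n P m m' := by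
  obtain ⟨k, C, hV, -, hS⟩ := hS
  have hen := (bit_eq_iff (w := w) (e := e) (e' := n)).not.2 he.ne
  have hbit : ∀ i x, (word P m' i).testBit x =
      if i = e / w ∧ x = e % w then b else (word P m i).testBit x := by
    intro i x
    rw [hm]
    by_cases h1 : i = e / w
    · rw [if_pos h1, hy, h1]
      by_cases h2 : x = e % w <;> simp [h2]
    · rw [if_neg h1, if_neg (fun h => h1 h.1)]
  have hB : blocks n P m' = blocks n P m := by
    funext j t
    have := t.2
    unfold blocks
    split_ifs
    · rw [hm, if_neg (by omega)]
    · rfl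
  refine ⟨⟨k, C, ⟨⟨hV.barrier.le, fun h0 => ?_, fun hk => ?_⟩, ?_, ?_, ?_⟩, hS', fun x hx => ?_⟩,
    fun i hi => ?_⟩
  -- The assigned bit `e < n` is not the flag, which is bit `n`.
  · rw [hbit, if_neg (fun h => hen ⟨h.1.symm, h.2.symm⟩)]
    exact hV.barrier.flag h0
  · rw [hB]
    exact hV.barrier.stored hk
  · rw [hB]
    exact hV.content_eq
  · rw [hB]
    exact hV.left
  · rw [hB]
    exact hV.right
  · have hxe := bit_eq_iff (w := w) (e := x) (e' := e)
    rw [hb, hS x hx]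
    by_cases h1 : 3 * (n / w / 3) ≤ x / w
    · rw [clientWord_rest C h1, clientWord_rest C h1, hbit]
      simp only [hxe]
      split_ifs <;> rfl
    · rw [if_neg (fun h => by subst h; omega), clientWord, clientWord, if_pos (by omega),
        if_pos (by omega)]
  · rw [hbit, if_neg]
    rintro ⟨h1, h2⟩
    have := Nat.div_add_mod e w
    have := Nat.div_add_mod n w
    rw [← h1] at *
    omega

theorem wp_assign_rest {f : ℕ → ℕ → Prog ℕ ℕ} {b : Bool}
    (hf : AssignsBit σ (InBlock w P (n + 1)) f b) (h : Fits w n P) {S S' : Set ℕ}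
    (hS : Represents n P m S) {e : ℕ} (he : e < n) (hg : 3 * (n / w / 3) ≤ e / w)
    (hS' : S' ⊆ Set.Icc 1 n) (hb : ∀ x, x + 1 ∈ S' ↔ if x = e then b = true else x + 1 ∈ S) :
    wp σ (InBlock w P (n + 1))
      (do let x ← readAt P (e / w)
          let x ← f x (e % w)
          writeAt P (e / w) x)
      (fun _ m' => Represents n P m' S' ∧ SameHigh n P m m') m :=
  .bind (wp_readAt h (div_le_of_lt e he) (.bind (hf _ _ _ _ (word_lt ..)
    (Nat.mod_lt _ h.w_pos) fun _ hy hbit => wp_writeAt h (div_le_of_lt e he) hy fun _ hm =>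
    hS.of_rest he hg hbit hm hS' hb)))

theorem update_ne_zero {v : Fin 3 → ℕ} {t : Fin 3} {y : ℕ} (hy : y ≠ 0) :
    Function.update v t y ≠ 0 := fun e => hy (by simpa using congrFun e t)

theorem update_lt {v : Fin 3 → ℕ} {t : Fin 3} {y : ℕ} (hv : ∀ t, v t < 2 ^ w) (hy : y < 2 ^ w)
    (s : Fin 3) : Function.update v t y s < 2 ^ w := by
  rw [Function.update_apply]
  split_ifs
  · exact hy
  · exact hv s

theorem wp_insert {W c : ℕ} (hc : LogConstants σ W c) (h : Fits w n P) {S : Set ℕ}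
    (hS : Represents n P m S) {ℓ : ℕ} (hℓ : ℓ ∈ Set.Icc 1 n) :
    wp σ (InBlock w P (n + 1)) (insert W c n ℓ P)
      (fun _ m' => Represents n P m' (S ∪ {ℓ}) ∧ SameHigh n P m m') m := by
  obtain ⟨e, rfl⟩ : ∃ e, ℓ = e + 1 := ⟨ℓ - 1, by have := hℓ.1; omega⟩
  have he : e < n := hℓ.2
  have hR := hS
  obtain ⟨k, C, hV, hSn, hSC⟩ := hS
  have hS' : S ∪ {e + 1} ⊆ Set.Icc 1 n := Set.union_subset hSn (by simpa using hℓ)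
  have hb : ∀ x, x + 1 ∈ S ∪ {e + 1} ↔ if x = e then true = true else x + 1 ∈ S := by
    intro x
    by_cases hx : x = e <;> simp [hx]
  refine .bind (wp_dispatch hc h he hV.barrier
    (fun hg => wp_mono (wp_assign_rest assignsBit_setBit h hR he hg
      hS' hb) fun _ _ h => h)
    (fun j t hj hjt => .bind (wp_getContent h hV.barrier.le hj ?_)))
  have hCj := hV.content_eq j hj
  have hCw : ∀ t, C j t < 2 ^ w := hCj ▸ content_lt _ _ _ _
  rw [hCj]
  refine .bind (wp_modifyWord (R := fun y => y < 2 ^ w ∧ ∀ i, y.testBit i =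
    if i = e % w then true else (C j t).testBit i) h.w_pos
    (fun Q hQ => assignsBit_setBit _ _ _ _ (hCw t) (Nat.mod_lt _ h.w_pos)
      fun y h1 h2 => hQ y ⟨h1, h2⟩) fun y ⟨hyw, hy⟩ => .bind (wp_disjunction hCw fun a ha =>
    .bind (.lit (by positivity) (.ifEq (fun h0 => ?_) (fun h0 => ?_)))))
  all_goals
    -- An insertion always leaves a nonzero block, whence only two cases.
    have hy0 : y ≠ 0 := by
      rintro rfl
      simpa using hy (e % w)
  · exact wp_fillBlock h hV hj (ha.1 h0) (update_lt hCw hyw) (update_ne_zero hy0)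
      fun m' k' hV' hT => ⟨.of_block hSC hj hjt hy hV' hT hS' hb, hT.sameHigh⟩
  · exact wp_updateBlock h hV hj (ha.not.1 h0) (update_lt hCw hyw) (update_ne_zero hy0)
      fun m' k' hV' hT => ⟨.of_block hSC hj hjt hy hV' hT hS' hb, hT.sameHigh⟩

theorem wp_delete {W c : ℕ} (hc : LogConstants σ W c) (h : Fits w n P) {S : Set ℕ}
    (hS : Represents n P m S) {ℓ : ℕ} (hℓ : ℓ ∈ Set.Icc 1 n) :
    wp σ (InBlock w P (n + 1)) (delete W c n ℓ P)
      (fun _ m' => Represents n P m' (S \ {ℓ}) ∧ SameHigh n P m m') m := by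
  obtain ⟨e, rfl⟩ : ∃ e, ℓ = e + 1 := ⟨ℓ - 1, by have := hℓ.1; omega⟩
  have he : e < n := hℓ.2
  have hR := hS
  obtain ⟨k, C, hV, hSn, hSC⟩ := hS
  have hS' : S \ {e + 1} ⊆ Set.Icc 1 n := Set.sdiff_subset.trans hSn
  have hb : ∀ x, x + 1 ∈ S \ {e + 1} ↔ if x = e then false = true else x + 1 ∈ S := by
    intro x
    by_cases hx : x = e <;> simp [hx]
  refine .bind (wp_dispatch hc h he hV.barrier
    (fun hg => wp_mono (wp_assign_rest assignsBit_clearBit h hR he hg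
      hS' hb) fun _ _ h => h)
    (fun j t hj hjt => .bind (wp_getContent h hV.barrier.le hj ?_)))
  have hCj := hV.content_eq j hj
  have hCw : ∀ t, C j t < 2 ^ w := hCj ▸ content_lt _ _ _ _
  rw [hCj]
  refine .bind (wp_modifyWord (R := fun y => y < 2 ^ w ∧ ∀ i, y.testBit i =
    if i = e % w then false else (C j t).testBit i) h.w_pos
    (fun Q hQ => assignsBit_clearBit _ _ _ _ (hCw t) (Nat.mod_lt _ h.w_pos)
      fun y h1 h2 => hQ y ⟨h1, h2⟩) fun y ⟨hyw, hy⟩ => .bind (wp_disjunction hCw fun a ha =>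
    .bind (wp_disjunction (update_lt hCw hyw) fun a' ha' =>
    .bind (.lit (by positivity) (.ifEq (fun h0 => ?_) (fun h0 => .ifEq (fun h1 => ?_)
    (fun h1 => ?_)))))))
  -- Deleting from a zero block changes nothing.
  · have hC0 := ha.1 h0
    have hy0 : y = 0 := Nat.eq_of_testBit_eq fun i => by
      rw [hy, hC0]
      simp
    have hCC : (fun i => if i = j then Function.update (C j) t y else C i) = C := by
      funext i
      split_ifs with hi
      · rw [hi, hy0, hC0]
        exact Function.update_eq_self t (0 : Fin 3 → ℕ)
      · rfl
    exact ⟨.of_block hSC hj hjt hy (hCC.symm ▸ hV) (SameRest.refl m).sameTail hS' hb,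
      fun _ _ => rfl⟩
  · refine wp_emptyBlock h hV hj (ha.not.1 h0) fun m' k' hV' hT =>
      ⟨.of_block (k' := k') hSC hj hjt hy ?_ hT hS' hb, hT.sameHigh⟩
    rwa [ha'.1 h1]
  · exact wp_updateBlock h hV hj (ha.not.1 h0) (update_lt hCw hyw) (ha'.not.1 h1)
      fun m' k' hV' hT => ⟨.of_block hSC hj hjt hy hV' hT hS' hb, hT.sameHigh⟩

theorem wp_contains {W c : ℕ} (hc : LogConstants σ W c) (h : Fits w n P) {S : Set ℕ}
    (hS : Represents n P m S) {ℓ : ℕ} (hℓ : ℓ ∈ Set.Icc 1 n) :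
    wp σ (InBlock w P (n + 1)) (contains W c n ℓ P)
      (fun r m' => m' = m ∧ (ℓ ∈ S → r = 1) ∧ (ℓ ∉ S → r = 0)) m := by
  obtain ⟨e, rfl⟩ : ∃ e, ℓ = e + 1 := ⟨ℓ - 1, by have := hℓ.1; omega⟩
  have he : e < n := hℓ.2
  obtain ⟨k, C, hV, hSn, hSC⟩ := hS
  have hs := Nat.mod_lt e h.w_pos
  refine wp_dispatch hc h he hV.barrier
    (fun hg => .bind (wp_readAt h (div_le_of_lt e he) (wp_getBit (word_lt ..) hs ?_)))
    (fun j t hj hjt => .bind (wp_getContent h hV.barrier.le hj ?_))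
  · rw [hSC e he, clientWord_rest C hg]
    simp +contextual
  · rw [hV.content_eq j hj]
    refine .bind (wp_selectWord h.w_pos (wp_getBit ?_ hs ?_))
    · rw [← hV.content_eq j hj]
      exact content_lt ..
    · rw [hSC e he, hjt, clientWord_block C hj]
      simp +contextual

end

end WordRAM

/-! ### The operation `choice` and the initialization. -/

namespace WordRAM

open Prog

section

variable {w n P : ℕ} {σ : BitVec w} {m : ℕ → BitVec w}

theorem wp_element {W c : ℕ} (hc : LogConstants σ W c) (h : Fits w n P) {acc : ℕ → Prop}
    {Q : ℕ → (ℕ → BitVec w) → Prop} {g x : ℕ} (hx : x ≠ 0) (hxw : x < 2 ^ w)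
    (hb : ∀ i < w, x.testBit i = true → g * w + i < n)
    (hQ : ∀ e < n, e / w = g → x.testBit (e % w) = true → Q (e + 1) m) :
    wp σ acc (element W c w g x) Q m := by
  have hn := h.lt
  refine .bind (wp_bitIndex hc hx hxw fun i hi hxi => ?_)
  have h1 := hb i hi hxi
  have h2 : (g * w + i) / w = g := by
    rw [mul_comm, Nat.mul_add_div h.w_pos, Nat.div_eq_of_lt hi, add_zero]
  have h3 : (g * w + i) % w = i := by
    rw [mul_comm, Nat.mul_add_mod, Nat.mod_eq_of_lt hi]
  exact .bind (.lit h.one_lt (.bind (.mul (by omega) (.bind (.add (by omega) (.add (by omega)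
    (hQ _ h1 h2 (by rwa [h3]))))))))

/-- At most `d` words are left to inspect. In the last one, reduction modulo `2 ^ (n % w)` hides the
flag and the bits beyond the data structure. -/
theorem wp_search {W c : ℕ} (hc : LogConstants σ W c) (h : Fits w n P)
    {Q : ℕ → (ℕ → BitVec w) → Prop} (d : ℕ) : ∀ {g : ℕ}, g ≤ n / w → n / w < g + d →
    ((∀ e < n, g ≤ e / w → (word P m (e / w)).testBit (e % w) = false) → Q 0 m) →
    (∀ e < n, g ≤ e / w → (word P m (e / w)).testBit (e % w) = true → Q (e + 1) m) →
    wp σ (InBlock w P (n + 1)) (search W c P w (n / w) (n % w) d g) Q m := by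
  have hw := h.w_pos
  have hdn := h.div_lt
  induction d with
  | zero => intro g h1 h2; omega
  | succ d ih =>
    intro g h1 h2 h0 hQ
    have hlt : 2 ^ (n % w) < 2 ^ w := Nat.pow_lt_pow_right (by norm_num) h.mod_lt
    refine .bind (.lit (by positivity) (.bind (.lit h.one_lt (.bind (wp_readAt h h1
      (.ifEq (fun h3 => ?_) (fun h3 => .ifEq (fun h4 => ?_) (fun h4 => ?_))))))))
    · have hbit : ∀ e < n, g ≤ e / w → (word P m (e / w)).testBit (e % w) =
          (word P m g % 2 ^ (n % w)).testBit (e % w) := by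
        intro e he hge
        have h5 : e / w = n / w := le_antisymm (div_le_of_lt e he) (h3 ▸ hge)
        have h6 : e % w < n % w := by
          have := Nat.div_add_mod e w
          have := Nat.div_add_mod n w
          rw [h5] at *
          omega
        rw [h5, ← h3, Nat.testBit_mod_two_pow]
        simp [h6]
      have hxw : word P m g % 2 ^ (n % w) < 2 ^ w := (Nat.mod_le _ _).trans_lt (word_lt ..)
      refine .bind (.one_shl h.mod_lt (.bind (.mod (word_lt ..) hlt (by positivity)
        (.ifEq (fun h4 => h0 fun e he hge => ?_) (fun h4 => wp_element hc h h4 hxw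
        (fun i hi hxi => ?_) fun e he hge hxe => ?_)))))
      · rw [hbit e he hge, h4, Nat.zero_testBit]
      · rw [Nat.testBit_mod_two_pow, Bool.and_eq_true, decide_eq_true_eq] at hxi
        have := Nat.div_add_mod n w
        rw [h3, mul_comm]
        omega
      · exact hQ e he hge.ge (by rwa [hbit e he hge.ge])
    · refine .bind (.add (by omega) (ih (by omega) (by omega) (fun h5 => h0 fun e he hge => ?_)
        fun e he hge => hQ e he (by omega)))
      rcases eq_or_lt_of_le hge with h6 | h6
      · rw [← h6, h4, Nat.zero_testBit]
      · exact h5 e he h6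
    · refine wp_element hc h h4 (word_lt ..) (fun i hi _ => ?_) fun e he hge hxe =>
        hQ e he hge.ge (by rwa [hge])
      have h5 : (g + 1) * w ≤ n / w * w := Nat.mul_le_mul_right _ (by omega)
      have h6 := Nat.div_mul_le_self n w
      rw [Nat.succ_mul] at h5
      omega

theorem wp_choice {W c : ℕ} (hc : LogConstants σ W c) (h : Fits w n P) {S : Set ℕ}
    (hS : Represents n P m S) :
    wp σ (InBlock w P (n + 1)) (choice W c n P)
      (fun r m' => m' = m ∧ (S.Nonempty → r ∈ S) ∧ (S = ∅ → r = 0)) m := by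
  obtain ⟨k, C, hV, hSn, hSC⟩ := hS
  have hbl := h.blocks_le
  have found : ∀ e < n, (clientWord n P m C (e / w)).testBit (e % w) = true →
      m = m ∧ (S.Nonempty → e + 1 ∈ S) ∧ (S = ∅ → e + 1 = 0) := by
    intro e he hb
    have h1 := (hSC e he).2 hb
    exact ⟨rfl, fun _ => h1, fun h0 => by simp [h0] at h1⟩
  have rest : k = 0 → wp σ (InBlock w P (n + 1))
      (search W c P w (n / w) (n % w) 3 (3 * (n / w / 3)))
      (fun r m' => m' = m ∧ (S.Nonempty → r ∈ S) ∧ (S = ∅ → r = 0)) m := by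
    intro hk
    -- The words after the blocks are those from `3 * N` to `n / w`, at most three.
    refine wp_search hc h 3 hbl (by omega) (fun h0 => ⟨rfl, ?_, fun _ => rfl⟩) fun e he hge hb =>
      found e he (by rwa [clientWord_rest C hge])
    rintro ⟨ℓ, hℓ⟩
    obtain ⟨e, rfl⟩ : ∃ e, ℓ = e + 1 := ⟨ℓ - 1, by have := (hSn hℓ).1; omega⟩
    have he : e < n := (hSn hℓ).2
    have h1 := (hSC e he).1 hℓ
    by_cases h2 : 3 * (n / w / 3) ≤ e / w
    · rw [clientWord_rest C h2, h0 e he h2] at h1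
      simp at h1
    · have h3 : e / w / 3 < n / w / 3 := by omega
      -- With the barrier at 0, no block is to the left and so none is matched.
      have h4 : C (e / w / 3) = 0 := by
        have hm := hV.matched (e / w / 3) h3
        refine hV.eq_zero _ h3
          ⟨fun h => absurd h (by rw [hk]; exact Nat.not_lt_zero _), fun h => ?_⟩
        have := hm h
        omega
      rw [clientWord, if_pos h3, h4] at h1
      simp at h1
  refine .bind (wp_wordLength hc h.w_pos (.bind (wp_numBlocks h (.bind (.lit (by positivity)
    (.bind (.div h.lt h.w_lt h.w_pos (.bind (.mod h.lt h.w_lt h.w_pos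
    (.ifEq (fun h1 => ?_) (fun h1 => .bind (wp_getBarrier h hV.barrier
    (.ifEq (fun h2 => ?_) (fun h2 => ?_))))))))))))))
  · have h2 := rest (by have := hV.barrier.le; omega)
    rwa [h1] at h2
  · exact .bind (wp_offset (t := 0) h (by norm_num) hbl (by omega) (rest h2))
  · have hN : 0 < n / w / 3 := by omega
    have main : ∀ j < n / w / 3, C j ≠ 0 → wp σ (InBlock w P (n + 1))
        (do let v ← getContent P (n / w / 3) k j
            .ifEq (v 0) 0
              (.ifEq (v 1) 0
                (do let g ← offset j 2
                    element W c w g (v 2))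
                (do let g ← offset j 1
                    element W c w g (v 1)))
              (do let g ← offset j 0
                  element W c w g (v 0)))
        (fun r m' => m' = m ∧ (S.Nonempty → r ∈ S) ∧ (S = ∅ → r = 0)) m := by
      intro j hj hCj
      have hC := hV.content_eq j hj
      have hCw : ∀ t, C j t < 2 ^ w := hC ▸ content_lt _ _ _ _
      have one : ∀ t : Fin 3, C j t ≠ 0 → wp σ (InBlock w P (n + 1))
          (do let g ← offset j t
              element W c w g (C j t))
          (fun r m' => m' = m ∧ (S.Nonempty → r ∈ S) ∧ (S = ∅ → r = 0)) m := by
        intro t ht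
        have h3 := t.2
        refine .bind (wp_offset h t.2 (by omega) hN (wp_element hc h ht (hCw t)
          (fun i hi _ => ?_) fun e he hge hb => found e he ?_))
        · have h5 : (3 * j + t + 1) * w ≤ n / w * w := Nat.mul_le_mul_right _ (by omega)
          have h6 := Nat.div_mul_le_self n w
          rw [Nat.succ_mul] at h5
          omega
        · rwa [hge, clientWord_block C hj]
      refine .bind (wp_getContent h hV.barrier.le hj ?_)
      rw [hC]
      refine .ifEq (fun h3 => .ifEq (fun h4 => one 2 fun h5 => hCj ?_) (one 1)) (one 0)
      ext t; fin_cases t <;> assumption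
    -- As `k > 0`, block 0 is to the left. If it is unmatched, it is nonzero; if not, its partner is
    -- a matched right block and so nonzero.
    have h3 := hV.matched 0 hN
    refine .bind (wp_getPartner h hV.barrier.le hN (.bind (.ifEq (fun h4 => ?_) (fun h4 => ?_))))
    · exact main 0 hN (hV.left 0 hN hN.ne (by omega) h4)
    · obtain ⟨h5, h6, h7⟩ := h3 h4
      exact main _ h5 (hV.right _ h5 h5.ne (by omega) (by rw [h7]; exact hN.ne))

theorem wp_clear (h : Fits w n P) {Q : Unit → (ℕ → BitVec w) → Prop} (d : ℕ) :
    ∀ {g : ℕ} {m : ℕ → BitVec w}, g ≤ n / w → n / w < g + d →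
    (∀ m', (∀ e ≤ n, g ≤ e / w → (word P m' (e / w)).testBit (e % w) = false) →
      (∀ i < g, word P m' i = word P m i) → SameHigh n P m m' → Q () m') →
    wp σ (InBlock w P (n + 1)) (clear P (n / w) (n % w) d g) Q m := by
  have hw := h.w_pos
  have hdn := h.div_lt
  induction d with
  | zero => intro g m h1 h2; omega
  | succ d ih =>
    intro g m h1 h2 hQ
    have hsw := h.mod_lt.trans h.w_lt
    refine .bind (.lit (by positivity) (.bind (.lit h.one_lt (.ifEq (fun h3 => ?_)
      (fun h3 => .bind (wp_writeAt h h1 (by positivity) fun m₁ hm₁ => .bind (.add (by omega)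
      (ih (by omega) (by omega) fun m₂ hm₂ hl hh => hQ m₂ (fun e he hge => ?_) (fun i hi => ?_)
        (fun i hi => ?_)))))))))
    · have hx := word_lt P m g
      -- The four shifts together clear the `n % w + 1` low bits, including the flag, and keep the
      -- bits that do not belong to the data structure.
      have e1 : word P m g / 2 ^ (n % w) / 2 ^ 1 * 2 ^ 1 * 2 ^ (n % w) =
          word P m g / 2 ^ (n % w + 1) * 2 ^ (n % w + 1) := by
        rw [Nat.div_div_eq_div_mul, ← pow_add, mul_assoc, ← pow_add, add_comm 1]
      have h5 : word P m g / 2 ^ (n % w) / 2 ^ 1 * 2 ^ 1 * 2 ^ (n % w) < 2 ^ w := by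
        rw [e1]
        exact (Nat.div_mul_le_self _ _).trans_lt hx
      have h6 : word P m g / 2 ^ (n % w) / 2 ^ 1 * 2 ^ 1 < 2 ^ w :=
        (Nat.le_mul_of_pos_right _ (by positivity)).trans_lt h5
      have h7 : word P m g / 2 ^ (n % w) < 2 ^ w := (Nat.div_le_self _ _).trans_lt hx
      refine .bind (wp_readAt h h1 (.bind (.shr hx hsw (.bind (.shr h7 h.one_lt
        (.bind (.shl h.one_lt h6 (.bind (.shl hsw h5 (wp_writeAt h h1 h5 fun m₁ hm₁ =>
        hQ m₁ (fun e he hge => ?_) (fun i hi => ?_) (fun i hi => ?_)))))))))))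
      · have h8 : e / w = n / w := le_antisymm (Nat.div_le_div_right he) (h3 ▸ hge)
        have h9 : e % w ≤ n % w := by
          have := Nat.div_add_mod e w
          have := Nat.div_add_mod n w
          rw [h8] at *
          omega
        rw [hm₁, if_pos (h8.trans h3.symm), e1, Nat.testBit_mul_two_pow]
        simp
        omega
      · rw [hm₁, if_neg hi.ne]
      · rw [hm₁, if_pos h3.symm, e1, Nat.testBit_mul_two_pow, Nat.testBit_div_two_pow, h3,
          Nat.sub_add_cancel hi]
        simp
        omega
    · rcases eq_or_lt_of_le hge with h6 | h6
      · rw [hl _ (by omega), hm₁, if_pos h6.symm, Nat.zero_testBit]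
      · exact hm₂ e he h6
    · rw [hl i (by omega), hm₁, if_neg hi.ne]
    · rw [hh i hi, hm₁, if_neg (Ne.symm h3)]

/-- This is why constant-time initialization is possible: with the barrier at 0, every block
represents zero regardless of its words, so only the few words after the blocks need clearing. -/
theorem represents_empty {m : ℕ → BitVec w} (hb : Barrier n P m 0)
    (hm : ∀ e < n, 3 * (n / w / 3) ≤ e / w → (word P m (e / w)).testBit (e % w) = false) :
    Represents n P m ∅ := by
  have hp : ∀ j < n / w / 3, partner (n / w / 3) 0 (blocks n P m) j = n / w / 3 := by
    intro j hj
    by_contra hne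
    have := partner_partner hb.le hj hne
    omega
  refine ⟨0, fun _ => 0, ⟨hb, fun j hj => content_right (hp j hj) (Nat.zero_le _),
    fun j _ _ hj => by omega, fun j hj _ _ h => absurd (hp j hj) h⟩, Set.empty_subset _,
    fun e he => ?_⟩
  by_cases h2 : 3 * (n / w / 3) ≤ e / w
  · rw [clientWord_rest _ h2, hm e he h2]
    simp
  · rw [clientWord, if_pos (by omega)]
    simp

theorem wp_init {W c : ℕ} (hc : LogConstants σ W c) (h : Fits w n P) :
    wp σ (InBlock w P (n + 1)) (init W c n P)
      (fun _ m' => Represents n P m' ∅ ∧ SameHigh n P m m') m := by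
  have hbl := h.blocks_le
  refine .bind (wp_wordLength hc h.w_pos (.bind (wp_numBlocks h (.bind (.lit (by positivity)
    (.bind (.div h.lt h.w_lt h.w_pos (.bind (.mod h.lt h.w_lt h.w_pos
    (.bind (.ifEq (fun h1 => ?_) (fun h1 => ?_))))))))))))
  -- Without blocks, the barrier is trivially 0 and the flag has no meaning.
  · refine wp_clear h 3 (Nat.zero_le _) (by omega) fun m₁ h2 h3 h4 =>
      ⟨represents_empty ⟨Nat.zero_le _, by omega, by omega⟩ fun e he _ =>
        h2 e he.le (Nat.zero_le _), h4⟩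
  · refine .bind (wp_offset (t := 0) h (by norm_num) hbl (by omega) (.bind
      (wp_clear h 3 hbl (by omega) fun m₁ h2 h3 h4 => wp_putBarrier h (Nat.zero_le _) (by omega)
      fun m₂ h5 h6 _ => ⟨represents_empty h5 fun e he hge => ?_, fun i hi => ?_⟩)))
    · rw [h6 _ _ hge ?_]
      · exact h2 e he.le hge
      · have := (bit_eq_iff (w := w) (e := e) (e' := n)).not.2 he.ne
        tauto
    · rw [h6.sameHigh i hi, h4 i hi]

end

end WordRAM

namespace WordRAM

namespace Prog

/-! ### The programs depend only on the names of their variables -/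

section

variable {G : ℕ → ℕ → Prop} {α β : Type}

theorem forall_three {u v : Fin 3 → ℕ} (h0 : G (u 0) (v 0)) (h1 : G (u 1) (v 1))
    (h2 : G (u 2) (v 2)) : ∀ t, G (u t) (v t) := by
  intro t; fin_cases t <;> assumption

theorem related_lit {k : ℕ} : Related G G (lit k) (lit k) :=
  .const fun _ _ h => .ret h

theorem related_sqrtLength : Related G G sqrtLength sqrtLength :=
  .loadSqrt fun _ _ h => .ret h

theorem related_bin {o : BinOp} {a a' b b' : ℕ} (ha : G a a') (hb : G b b') :
    Related G G (bin o a b) (bin o a' b') := .op ha hb fun _ _ h => .ret h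

theorem related_mod {a a' b b' : ℕ} (ha : G a a') (hb : G b b') :
    Related G G (mod a b) (mod a' b') := by
  unfold mod
  repeat' first
    | assumption | apply related_bin | apply Related.bind | intro _ _ _

theorem related_exponent {a a' b b' : ℕ} (ha : G a a') (hb : G b b') :
    Related G G (exponent a b) (exponent a' b') := by
  unfold exponent
  repeat' first
    | assumption | apply related_lit | apply related_bin | apply related_mod | apply Related.bind
    | intro _ _ _

theorem related_logLarge {c a a' : ℕ} (ha : G a a') :
    Related G G (logLarge c a) (logLarge c a') := by
  unfold logLarge
  repeat' first
    | assumption | apply related_lit | apply related_bin | apply related_mod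
    | apply related_exponent | apply related_sqrtLength | apply Related.bind | intro _ _ _

theorem related_log {W c a a' : ℕ} (ha : G a a') : Related G G (log c a W) (log c a' W) := by
  induction W with
  | zero => exact related_logLarge ha
  | succ W ih =>
    unfold log
    repeat' first
      | assumption | apply related_lit | apply Related.pure | with_reducible apply Related.ifEq
      | apply Related.bind | intro _ _ _

theorem related_wordLength {W c : ℕ} : Related G G (wordLength W c) (wordLength W c) := by
  unfold wordLength
  repeat' first
    | assumption | apply related_lit | apply related_bin | apply related_log
    | apply Related.bind | intro _ _ _

theorem related_bitIndex {W c a a' : ℕ} (ha : G a a') :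
    Related G G (bitIndex W c a) (bitIndex W c a') := by
  unfold bitIndex
  repeat' first
    | assumption | apply related_lit | apply related_bin | apply related_log
    | apply Related.bind | intro _ _ _

variable {p p' n n' w w' N N' k k' j j' x x' s s' g g' ℓ ℓ' : ℕ} {v v' : Fin 3 → ℕ}

theorem related_readAt (hp : G p p') (hg : G g g') :
    Related G G (readAt p g) (readAt p' g') :=
  (related_bin hp hg).bind fun _ _ h => .load h fun _ _ h => .ret h

theorem related_writeAt (hp : G p p') (hg : G g g') (hx : G x x') :
    Related G (fun _ _ => True) (writeAt p g x) (writeAt p' g' x') :=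
  (related_bin hp hg).bind fun _ _ h => .store h hx (.ret trivial)

theorem related_offset {t : ℕ} (hj : G j j') : Related G G (offset j t) (offset j' t) := by
  unfold offset
  repeat' first
    | assumption | apply related_lit | apply related_bin | apply Related.bind | intro _ _ _

theorem related_readWord {t : ℕ} (hp : G p p') (hj : G j j') :
    Related G G (readWord p j t) (readWord p' j' t) :=
  (related_offset hj).bind fun _ _ h => related_readAt hp h

theorem related_writeWord {t : ℕ} (hp : G p p') (hj : G j j') (hx : G x x') :
    Related G (fun _ _ => True) (writeWord p j t x) (writeWord p' j' t x') :=
  (related_offset hj).bind fun _ _ h => related_writeAt hp h hx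

theorem related_numBlocks (hn : G n n') (hw : G w w') :
    Related G G (numBlocks n w) (numBlocks n' w') := by
  unfold numBlocks
  repeat' first
    | assumption | apply related_lit | apply related_bin | with_reducible apply Related.ifLt
    | apply Related.bind | intro _ _ _

theorem related_getPartner (hp : G p p') (hN : G N N') (hk : G k k') (hj : G j j') :
    Related G G (getPartner p N k j) (getPartner p' N' k' j') := by
  unfold getPartner
  repeat' first
    | assumption | apply related_readWord | with_reducible apply Related.ifLt
    | with_reducible apply Related.ifEq
    | apply Related.pure | apply Related.bind | intro _ _ _

theorem related_getContent (hp : G p p') (hN : G N N') (hk : G k k') (hj : G j j') :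
    Related G (fun u v => ∀ t, G (u t) (v t)) (getContent p N k j) (getContent p' N' k' j') := by
  unfold getContent
  repeat' first
    | assumption | apply related_lit | apply related_readWord | apply related_getPartner
    | with_reducible apply Related.ifLt | with_reducible apply Related.ifEq
    | apply Related.pure | apply Related.bind | apply forall_three | intro _ _ _

theorem related_putBlock (hp : G p p') (hN : G N N') (hk : G k k') (hx : G x x')
    (hv : ∀ t, G (v t) (v' t)) :
    Related G (fun _ _ => True) (putBlock p N k x v) (putBlock p' N' k' x' v') := by
  unfold putBlock
  repeat' first
    | assumption | apply hv | exact trivial | apply related_readWord | apply related_writeWord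
    | with_reducible apply Related.ifLt | with_reducible apply Related.ifEq
    | apply Related.pure | apply Related.bind | intro _ _ _

theorem related_putLink (hp : G p p') (hx : G x x') (hj : G j j') (hv : ∀ t, G (v t) (v' t)) :
    Related G (fun _ _ => True) (putLink p x j v) (putLink p' x' j' v') := by
  unfold putLink
  repeat' first
    | assumption | apply hv | apply related_writeWord | apply Related.bind | intro _ _ _

theorem related_getBit (hx : G x x') (hs : G s s') :
    Related G G (getBit x s) (getBit x' s') := by
  unfold getBit
  repeat' first
    | assumption | apply related_lit | apply related_bin | apply Related.bind | intro _ _ _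

theorem related_setBit (hx : G x x') (hs : G s s') :
    Related G G (setBit x s) (setBit x' s') := by
  unfold setBit
  repeat' first
    | assumption | apply related_lit | apply related_bin | apply Related.bind | intro _ _ _

theorem related_clearBit (hx : G x x') (hs : G s s') :
    Related G G (clearBit x s) (clearBit x' s') := by
  unfold clearBit
  repeat' first
    | assumption | apply related_lit | apply related_bin | apply Related.bind | intro _ _ _

theorem related_modifyFlag {f : ℕ → ℕ → Prog ℕ ℕ}
    (hf : ∀ {x x' s s'}, G x x' → G s s' → Related G G (f x s) (f x' s'))
    (hp : G p p') (hn : G n n') (hw : G w w') :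
    Related G (fun _ _ => True) (modifyFlag p n w f) (modifyFlag p' n' w' f) := by
  unfold modifyFlag
  repeat' first
    | assumption | apply hf | apply related_bin | apply related_mod | apply related_readAt
    | apply related_writeAt | apply Related.bind | intro _ _ _

theorem related_getBarrier (hp : G p p') (hn : G n n') (hw : G w w') (hN : G N N') :
    Related G G (getBarrier p n w N) (getBarrier p' n' w' N') := by
  unfold getBarrier
  repeat' first
    | assumption | apply related_lit | apply related_bin | apply related_mod | apply related_readAt
    | apply related_readWord | apply related_getBit | with_reducible apply Related.ifEq
    | apply Related.pure
    | apply Related.bind | intro _ _ _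

theorem related_putBarrier (hp : G p p') (hn : G n n') (hw : G w w') (hN : G N N')
    (hk : G k k') :
    Related G (fun _ _ => True) (putBarrier p n w N k) (putBarrier p' n' w' N' k') := by
  unfold putBarrier
  repeat' first
    | assumption | apply related_lit | apply related_bin
    | apply related_modifyFlag related_setBit | apply related_modifyFlag related_clearBit
    | apply related_writeWord | with_reducible apply Related.ifEq | apply Related.bind | intro _ _ _

theorem related_raise (hp : G p p') (hn : G n n') (hw : G w w') (hN : G N N') (hk : G k k') :
    Related G G (raise p n w N k) (raise p' n' w' N' k') := by
  unfold raise
  repeat' first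
    | assumption | apply related_putBarrier | apply related_lit | apply related_bin
    | apply related_getPartner | apply related_getContent | apply related_writeWord
    | apply related_putBlock | with_reducible apply Related.ifEq | apply Related.pure
    | apply Related.bind
    | intro _ _ _ | intro _

theorem related_lower (hp : G p p') (hn : G n n') (hw : G w w') (hN : G N N') (hk : G k k')
    (hx : G x x') :
    Related G (fun _ _ => True) (lower p n w N k x) (lower p' n' w' N' k' x') := by
  unfold lower
  repeat' first
    | assumption | apply related_putBarrier | apply related_lit | apply related_bin
    | apply related_getPartner | apply related_getContent | apply related_writeWord
    | apply related_putLink | with_reducible apply Related.ifEq | apply Related.bind | intro _ _ _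

theorem related_fillBlock (hp : G p p') (hn : G n n') (hw : G w w') (hN : G N N') (hk : G k k')
    (hx : G x x') (hv : ∀ t, G (v t) (v' t)) :
    Related G (fun _ _ => True) (fillBlock p n w N k x v) (fillBlock p' n' w' N' k' x' v') := by
  unfold fillBlock
  repeat' first
    | assumption | apply related_lit | apply related_bin | apply related_getPartner
    | apply related_getContent | apply related_writeWord | apply related_raise
    | apply related_putLink | apply related_putBlock | with_reducible apply Related.ifEq
    | with_reducible apply Related.ifLt
    | apply Related.bind | intro _ _ _

theorem related_emptyBlock (hp : G p p') (hn : G n n') (hw : G w w') (hN : G N N')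
    (hk : G k k') (hx : G x x') :
    Related G (fun _ _ => True) (emptyBlock p n w N k x) (emptyBlock p' n' w' N' k' x') := by
  unfold emptyBlock
  repeat' first
    | assumption | apply related_lit | apply related_getPartner
    | apply related_writeWord | apply related_lower
    | apply related_putBlock | with_reducible apply Related.ifLt
    | apply Related.bind | intro _ _ _ | intro _

theorem related_updateBlock (hp : G p p') (hN : G N N') (hk : G k k') (hx : G x x')
    (hv : ∀ t, G (v t) (v' t)) :
    Related G (fun _ _ => True) (updateBlock p N k x v) (updateBlock p' N' k' x' v') := by
  unfold updateBlock
  repeat' first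
    | assumption | apply related_getPartner | apply related_writeWord | apply related_putLink
    | apply related_putBlock | with_reducible apply Related.ifLt | apply Related.bind | intro _ _ _

theorem related_disjunction (hv : ∀ t, G (v t) (v' t)) :
    Related G G (disjunction v) (disjunction v') :=
  (related_bin (hv 0) (hv 1)).bind fun _ _ h => related_bin h (hv 2)

theorem related_modifyWord {f f' : ℕ → Prog ℕ ℕ} (hx : G x x') (hv : ∀ t, G (v t) (v' t))
    (hf : ∀ {x x'}, G x x' → Related G G (f x) (f' x')) :
    Related G (fun u v => ∀ t, G (u t) (v t)) (modifyWord x v f) (modifyWord x' v' f') := by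
  unfold modifyWord
  repeat' first
    | assumption | apply hv | apply hf | apply related_lit | with_reducible apply Related.ifEq
    | apply Related.pure | apply Related.bind | apply forall_three | intro _ _ _

theorem related_selectWord (hx : G x x') (hv : ∀ t, G (v t) (v' t)) :
    Related G G (selectWord x v) (selectWord x' v') := by
  unfold selectWord
  repeat' first
    | assumption | apply hv | apply related_lit | with_reducible apply Related.ifEq
    | apply Related.pure | apply Related.bind | intro _ _ _

theorem related_dispatch {W c : ℕ} {R : α → β → Prop} {d : ℕ → ℕ → Prog ℕ α}
    {d' : ℕ → ℕ → Prog ℕ β} {b : ℕ → ℕ → ℕ → ℕ → ℕ → ℕ → Prog ℕ α}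
    {b' : ℕ → ℕ → ℕ → ℕ → ℕ → ℕ → Prog ℕ β} (hn : G n n') (hℓ : G ℓ ℓ') (hp : G p p')
    (hd : ∀ {g g' s s'}, G g g' → G s s' → Related G R (d g s) (d' g' s'))
    (hb : ∀ {w w' N N' k k' j j' t t' s s'}, G w w' → G N N' → G k k' → G j j' → G t t' →
      G s s' → Related G R (b w N k j t s) (b' w' N' k' j' t' s')) :
    Related G R (dispatch W c n ℓ p d b) (dispatch W c n' ℓ' p' d' b') := by
  unfold dispatch
  repeat' first
    | assumption | apply hd | apply hb | apply related_lit | apply related_bin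
    | apply related_mod | apply related_wordLength | apply related_numBlocks
    | apply related_getBarrier | with_reducible apply Related.ifEq
    | with_reducible apply Related.ifLt
    | apply Related.bind | intro _ _ _

theorem related_insert {W c : ℕ} (hn : G n n') (hℓ : G ℓ ℓ') (hp : G p p') :
    Related G G (insert W c n ℓ p) (insert W c n' ℓ' p') := by
  refine .bind (related_dispatch (R := fun _ _ => True) hn hℓ hp ?_ ?_) fun _ _ _ => .pure hn
  all_goals
    intros
    repeat' first
      | assumption | apply related_lit | apply related_readAt | apply related_writeAt
      | apply related_setBit | apply related_getContent | apply related_modifyWord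
      | apply related_disjunction | apply related_fillBlock | apply related_updateBlock
      | with_reducible apply Related.ifEq | apply Related.bind | intro _ _ _

theorem related_delete {W c : ℕ} (hn : G n n') (hℓ : G ℓ ℓ') (hp : G p p') :
    Related G G (delete W c n ℓ p) (delete W c n' ℓ' p') := by
  refine .bind (related_dispatch (R := fun _ _ => True) hn hℓ hp ?_ ?_) fun _ _ _ => .pure hn
  all_goals
    intros
    repeat' first
      | assumption | exact trivial | apply related_lit | apply related_readAt
      | apply related_writeAt
      | apply related_clearBit | apply related_getContent | apply related_modifyWord
      | apply related_disjunction | apply related_emptyBlock | apply related_updateBlock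
      | with_reducible apply Related.ifEq | apply Related.pure | apply Related.bind | intro _ _ _

theorem related_contains {W c : ℕ} (hn : G n n') (hℓ : G ℓ ℓ') (hp : G p p') :
    Related G G (contains W c n ℓ p) (contains W c n' ℓ' p') := by
  refine related_dispatch hn hℓ hp ?_ ?_
  all_goals
    intros
    repeat' first
      | assumption | apply related_readAt | apply related_getBit | apply related_getContent
      | apply related_selectWord | apply Related.bind | intro _ _ _

theorem related_element {W c : ℕ} (hw : G w w') (hg : G g g') (hx : G x x') :
    Related G G (element W c w g x) (element W c w' g' x') := by
  unfold element
  repeat' first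
    | assumption | apply related_lit | apply related_bin | apply related_bitIndex
    | apply Related.bind | intro _ _ _

theorem related_search {W c : ℕ} {last last' : ℕ} (hp : G p p') (hw : G w w')
    (hl : G last last') (hs : G s s') (d : ℕ) : ∀ {g g' : ℕ}, G g g' →
    Related G G (search W c p w last s d g) (search W c p' w' last' s' d g') := by
  induction d with
  | zero => exact fun _ => related_lit
  | succ d ih =>
    intro g g' hg
    unfold search
    repeat' first
      | assumption | apply ih | apply related_lit | apply related_bin | apply related_mod
      | apply related_readAt | apply related_element | with_reducible apply Related.ifEq
      | apply Related.pure
      | apply Related.bind | intro _ _ _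

theorem related_choice {W c : ℕ} (hn : G n n') (hp : G p p') :
    Related G G (choice W c n p) (choice W c n' p') := by
  unfold choice
  repeat' first
    | assumption | apply related_lit | apply related_bin | apply related_mod
    | apply related_wordLength | apply related_numBlocks | apply related_getBarrier
    | apply related_search | apply related_element | apply related_offset
    | apply related_getPartner | apply related_getContent | with_reducible apply Related.ifEq
    | refine Related.bind (Related.ifEq (R := G) ?_ ?_ ?_ ?_) ?_
    | apply Related.pure | apply Related.bind | intro _ _ _ | apply_assumption

theorem related_clear {last last' : ℕ} (hp : G p p') (hl : G last last') (hs : G s s') (d : ℕ) :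
    ∀ {g g' : ℕ}, G g g' →
    Related G (fun _ _ => True) (clear p last s d g) (clear p' last' s' d g') := by
  induction d with
  | zero => exact fun _ => .pure trivial
  | succ d ih =>
    intro g g' hg
    unfold clear
    repeat' first
      | assumption | apply ih | apply related_lit | apply related_bin
      | apply related_readAt | apply related_writeAt | with_reducible apply Related.ifEq
      | apply Related.bind | intro _ _ _

theorem related_init {W c : ℕ} (hn : G n n') (hp : G p p') :
    Related G G (init W c n p) (init W c n' p') := by
  unfold init
  repeat' first
    | assumption | apply related_lit | apply related_bin | apply related_mod
    | apply related_wordLength | apply related_numBlocks | apply related_putBarrier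
    | apply related_clear | apply related_offset | with_reducible apply Related.ifEq
    | refine Related.bind (Related.ifEq (R := fun _ _ => True) ?_ ?_ ?_ ?_) ?_
    | apply Related.pure | apply Related.bind | intro _ _ _

end

end Prog

end WordRAM

namespace WordRAM

open Prog

/-! ### The programs realize a choice dictionary -/

theorem memBit_eq_testBit {w : ℕ} (hw : 0 < w) (P : ℕ) (m : ℕ → BitVec w) (e : ℕ) :
    memBit m (w * P + e) = (word P m (e / w)).testBit (e % w) := by
  rw [memBit, Nat.mul_add_div hw, Nat.mul_add_mod, word, BitVec.testBit_toNat]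

/-- Pointers are block numbers rather than addresses, so the representation does not depend on its
position in memory. Nor does it depend on anything but the `n + 1` bits: words before number `n / w`
lie entirely within these, and of word `n / w` only bits up to position `n % w` matter. -/
theorem Represents.congr {w n P P' : ℕ} (hw : 0 < w) {m m' : ℕ → BitVec w} {S : Set ℕ}
    (h : ∀ e ≤ n, memBit m' (w * P' + e) = memBit m (w * P + e)) (hS : Represents n P m S) :
    Represents n P' m' S := by
  simp only [memBit_eq_testBit hw] at h
  have hword : ∀ g < n / w, word P' m' g = word P m g := by
    intro g hg
    refine Nat.eq_of_testBit_eq fun i => ?_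
    rcases lt_or_ge i w with hi | hi
    · have h1 : (w * g + i) / w = g := by rw [Nat.mul_add_div hw, Nat.div_eq_of_lt hi, add_zero]
      have h2 : (w * g + i) % w = i := by rw [Nat.mul_add_mod, Nat.mod_eq_of_lt hi]
      have := h (w * g + i) ?_
      · rwa [h1, h2] at this
      · have h3 : w * (g + 1) ≤ w * (n / w) := Nat.mul_le_mul_left _ hg
        have h4 := Nat.mul_div_le n w
        rw [mul_add] at h3
        omega
    -- Positions beyond the word length hold no ones in either word.
    · have hp : 2 ^ w ≤ 2 ^ i := Nat.pow_le_pow_right two_pos hi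
      rw [Nat.testBit_lt_two_pow ((word_lt ..).trans_le hp),
        Nat.testBit_lt_two_pow ((word_lt ..).trans_le hp)]
  have hblocks : blocks n P' m' = blocks n P m := by
    funext j t
    unfold blocks
    split_ifs with hj
    · exact hword _ (by omega)
    · rfl
  obtain ⟨k, C, ⟨⟨hk, hflag, hstored⟩, hcontent, hleft, hright⟩, hSn, hSC⟩ := hS
  refine ⟨k, C, ⟨⟨hk, fun h0 => (h n le_rfl).trans (hflag h0), ?_⟩, ?_, ?_, ?_⟩, hSn,
    fun e he => (hSC e he).trans ?_⟩
  · rwa [hblocks]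
  · rwa [hblocks]
  · rwa [hblocks]
  · rwa [hblocks]
  · unfold clientWord
    split_ifs
    · rfl
    · rw [h e he.le]

/-- The bits `d` are a possible content of a data structure with client set `S`. -/
def BitsRepresent (w : ℕ) {n : ℕ} (d : Fin (n + 1) → Bool) (S : Set ℕ) : Prop :=
  ∃ m : ℕ → BitVec w, (∀ j : Fin (n + 1), memBit m j = d j) ∧ Represents n 0 m S

theorem BitsRepresent.represents {w n P : ℕ} (hw : 0 < w) {d : Fin (n + 1) → Bool} {S : Set ℕ}
    (h : BitsRepresent w d S) {m : ℕ → BitVec w}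
    (hm : ∀ j : Fin (n + 1), memBit m (w * P + j) = d j) : Represents n P m S := by
  obtain ⟨m₀, h₀, hS⟩ := h
  refine hS.congr hw fun e he => ?_
  rw [hm ⟨e, by omega⟩, ← h₀ ⟨e, by omega⟩, mul_zero, zero_add]

theorem Represents.bitsRepresent {w n P : ℕ} (hw : 0 < w) {S : Set ℕ} {m : ℕ → BitVec w}
    (h : Represents n P m S) :
    BitsRepresent w (fun j : Fin (n + 1) => memBit m (w * P + j)) S := by
  refine ⟨fun a => m (P + a), fun j => ?_, h.congr hw fun e _ => ?_⟩
  all_goals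
    simp only [memBit_eq_testBit hw P]
    simp only [memBit, word, BitVec.testBit_toNat, mul_zero, zero_add]

/-- The register program of a family of programs with three arguments. -/
def compile (K : ℕ) (p : ℕ → ℕ → ℕ → Prog ℕ ℕ) : Program (K + 3) :=
  (p 0 1 2).code K ((p 0 1 2).size 3) 3 0

/-- By parametricity, the code for registers 0, 1, 2 behaves like the program run on the values `n`,
`ℓ`, `P`. As the data structure starts at a word boundary, foreign bits in accessible words occur
only in the last word, where `SameHigh` protects them; inaccessible words are untouched by
`run_code`. -/
theorem call_compile {w K T n ℓ : ℕ} {σ : BitVec w} (hn : 0 < n) (hnw : n < 2 ^ w)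
    {p : ℕ → ℕ → ℕ → Prog ℕ ℕ} (hK : (p 0 1 2).regsNeeded 3 ≤ K + 3) (hT : (p 0 1 2).size 3 ≤ T)
    (hp : ∀ {G : ℕ → ℕ → Prop} {a a' b b' c c' : ℕ}, G a a' → G b b' → G c c' →
      Related G G (p a b c) (p a' b' c'))
    {d : Fin (n + 1) → Bool} {post : (Fin (n + 1) → Bool) → ℕ → Prop}
    (H : ∀ (P : ℕ) (m : ℕ → BitVec w), Fits w n P →
      (∀ j : Fin (n + 1), memBit m (w * P + j) = d j) →
      wp σ (InBlock w P (n + 1)) (p n ℓ P) (fun r m' => SameHigh n P m m' ∧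
        post (fun j => memBit m' (w * P + j)) r) m) :
    Call σ T n (n + 1) (compile K p) ℓ d post := by
  intro P c hfit hpc h0 h1 h2 hd
  have hF : Fits w n P.toNat := ⟨hn, hnw, hfit⟩
  have hw := hF.w_pos
  obtain ⟨c', hrun, ⟨hhigh, hpost⟩, hacc⟩ := run_code σ (InBlock w P.toNat (n + 1)) (compile K p)
    ((p 0 1 2).size 3) (List.getElem?_eq_none (length_code ..).le) _ (p 0 1 2) (p n ℓ P.toNat) 3 T
    [] [] c (by simp [compile]) hpc hK
    (fun G hG => hp (h0 ▸ hG 0 (by omega)) (h1 ▸ hG 1 (by omega)) (h2 ▸ hG 2 (by omega)))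
    (H _ _ hF hd) hT
  refine ⟨c', hrun, fun g hg => ?_, hpost⟩
  by_cases hb : InBlock w P.toNat (n + 1) (g / w)
  · obtain ⟨hb1, hb2⟩ := hb
    have hdiv := Nat.div_add_mod g w
    have hdn := Nat.div_add_mod n w
    have hmod := Nat.mod_lt g hw
    have hmul := Nat.mul_le_mul_left w hb1
    -- A foreign bit in an accessible word cannot precede the data structure, so it follows it.
    have hg' : w * P.toNat + (n + 1) ≤ g := hg.resolve_left (by omega)
    have hgw : g / w = P.toNat + n / w := by
      rw [← Nat.mul_add_div hw]
      have h3 : (w * P.toNat + n) / w ≤ g / w := Nat.div_le_div_right (by omega)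
      have h4 : g / w ≤ (w * P.toNat + n) / w := (Nat.le_div_iff_mul_le hw).2 (by
        rw [mul_comm]; omega)
      exact h4.antisymm h3
    have := hhigh (g % w) (by rw [hgw, mul_add] at hdiv; omega)
    simpa only [memBit, word, ← hgw, BitVec.testBit_toNat] using this
  · rw [memBit, memBit, hacc _ hb]

end WordRAM

open WordRAM WordRAM.Prog

theorem theorem1 (C : ℝ) :
    ∃ (K T : ℕ) (D : WordRAM.DictCode K),
      ∀ (w : ℕ) (σ : BitVec w),
        Real.sqrt (w : ℝ) ≤ C * (σ.toNat : ℝ) → (σ.toNat : ℝ) ≤ C * Real.sqrt (w : ℝ) →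
        ∀ n : ℕ, 1 ≤ n → n < 2 ^ w →
          WordRAM.IsChoiceDictionary σ D T n (n + 1) := by
  -- Both constants depend on `C` alone, so they may be built into the programs. The register count
  -- and the time bound are crude sums over the five programs.
  obtain ⟨W, c, hlog⟩ := exists_logConstants C
  let init := fun n (_ : ℕ) p => Prog.init (V := ℕ) W c n p
  let insert := Prog.insert (V := ℕ) W c
  let delete := Prog.delete (V := ℕ) W c
  let contains := Prog.contains (V := ℕ) W c
  let choice := fun n (_ : ℕ) p => Prog.choice (V := ℕ) W c n p
  let K := (init 0 1 2).regsNeeded 3 + (insert 0 1 2).regsNeeded 3 +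
    (delete 0 1 2).regsNeeded 3 + (contains 0 1 2).regsNeeded 3 + (choice 0 1 2).regsNeeded 3
  let T := (init 0 1 2).size 3 + (insert 0 1 2).size 3 + (delete 0 1 2).size 3 +
    (contains 0 1 2).size 3 + (choice 0 1 2).size 3
  refine ⟨K, T, ⟨compile K init, compile K insert, compile K delete, compile K contains,
    compile K choice⟩, fun w σ h1 h2 n hn hnw => ⟨BitsRepresent w, fun d x => ?_,
    fun d S hS => ⟨fun ℓ hℓ => ?_, fun ℓ hℓ => ?_, fun ℓ hℓ => ?_, fun x => ?_⟩⟩⟩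
  · refine call_compile (p := init) hn hnw (by omega) (by omega)
      (fun ha _ hc => related_init ha hc)
      fun P m hF hm => wp_mono (wp_init (hlog w σ h1 h2) hF) ?_
    exact fun _ _ h => ⟨h.2, h.1.bitsRepresent hF.w_pos⟩
  · refine call_compile (p := insert) hn hnw (by omega) (by omega)
      (fun ha hb hc => related_insert ha hb hc)
      fun P m hF hm => wp_mono
        (wp_insert (hlog w σ h1 h2) hF (hS.represents hF.w_pos hm) hℓ) ?_
    exact fun _ _ h => ⟨h.2, h.1.bitsRepresent hF.w_pos⟩
  · refine call_compile (p := delete) hn hnw (by omega) (by omega)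
      (fun ha hb hc => related_delete ha hb hc)
      fun P m hF hm => wp_mono
        (wp_delete (hlog w σ h1 h2) hF (hS.represents hF.w_pos hm) hℓ) ?_
    exact fun _ _ h => ⟨h.2, h.1.bitsRepresent hF.w_pos⟩
  · refine call_compile (p := contains) hn hnw (by omega) (by omega)
      (fun ha hb hc => related_contains ha hb hc)
      fun P m hF hm => wp_mono
        (wp_contains (hlog w σ h1 h2) hF (hS.represents hF.w_pos hm) hℓ) ?_
    rintro _ _ ⟨rfl, h⟩
    exact ⟨fun _ _ => rfl, (hS.represents hF.w_pos hm).bitsRepresent hF.w_pos, h⟩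
  · refine call_compile (p := choice) hn hnw (by omega) (by omega)
      (fun ha _ hc => related_choice ha hc)
      fun P m hF hm => wp_mono
        (wp_choice (hlog w σ h1 h2) hF (hS.represents hF.w_pos hm)) ?_
    rintro _ _ ⟨rfl, h⟩
    exact ⟨fun _ _ => rfl, (hS.represents hF.w_pos hm).bitsRepresent hF.w_pos, h⟩
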